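/- **Theorem (ground state).** Let $n\ge 2$ and $d\ge n-1$, let $m_1,\dots,m_n>0$ be masses, and let $V$ be a real measurable function of the relative distances $r_{ij}=|\mathbf r_i-\mathbf r_j|$, $1\le i<j\le n$. On the space of relative motion $\mathbb R^{d(n-1)}$, with the Jacobi vectors $$\mathbf y_j=\sqrt{\tfrac{m_{j+1}M_j}{M_{j+1}}}\Big(\mathbf r_{j+1}-\sum_{k=1}^{j}\tfrac{m_k\mathbf r_k}{M_j}\Big),\qquad M_j=\sum_{k\le j}m_k,\quad 1\le j\le n-1,$$ as coordinates, consider in $L^2(\mathbb R^{d(n-1)})$ the Hamiltonian $$\mathcal H_r=-\Delta_r+V(r_{ij}),\qquad \Delta_r=\tfrac12\sum_{j=1}^{n-1}\Delta_{\mathbf y_j},$$ where $\Delta_r$ is the relative part of $\sum_i\frac1{2m_i}\Delta_{\mathbf r_i}$, with domain the $\varphi\in C_c^\infty(\mathbb R^{d(n-1)},\mathbb C)$ for which $V\varphi\in L^2$. Put $\rho_{ij}=r_{ij}^2$ and consider the restricted (radial) Hamiltonian $\mathcal H_{\rm rad}=-\Delta_{\rm rad}+V$, where $$\Delta_{\rm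 rad}=2\sum_{\substack{i\ne j,\ i\neq k\\ j<k}}\frac1{m_i}(\rho_{ij}+\rho_{ik}-\rho_{jk})\,\partial_{\rho_{ij}}\partial_{\rho_{ik}}+2\sum_{i<j}\frac{m_i+m_j}{m_im_j}\,\rho_{ij}\,\partial_{\rho_{ij}}^2+d\sum_{i<j}\frac{m_i+m_j}{m_im_j}\,\partial_{\rho_{ij}},$$ in the space $L^2$ of the radial measure $(V_n^2)^{(d-n)/2}\prod_{i<j}d\rho_{ij}$ on the set of those $\rho$ that are the squared edge lengths of a nondegenerate simplex with $n$ vertices, $V_n$ being its volume; the domain consists of the functions $f(\rho)$, smooth on that set, whose composition with the squared distances is in $C_c^\infty(\mathbb R^{d(n-1)},\mathbb C)$ and for which $\mathcal H_{\rm rad}f$ is square integrable. By a nondegenerate ground state of energy $E$ of an essentially self-adjoint operator we mean a nonzero eigenvector with eigenvalue $E$ of its closure, where $E$ is a lower bound of the closure and the eigenspace of $E$ is one-dimensional. Suppose that $\mathcal H_r$ is essentially self-adjoint and has a nondegenerate ground state $\Psi_0$, of energy $E_0$. Then $\Psi_0$ is invariant under the orthogonal group $O(d)$ (in particular under the rotations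 in $SO(d)$) acting on all Jacobi vectors simultaneously, and depends on the relative distances alone: $\Psi_0=F(r_{ij})$ almost everywhere for some function $F$. Moreover, $\mathcal H_{\rm rad}$ is essentially self-adjoint, and $\Psi_0$, as the function $\rho\mapsto F((\sqrt{\rho_{ij}})_{i<j})$, is square integrable for the radial measure and is the nondegenerate ground state of $\mathcal H_{\rm rad}$, with the same energy $E_0$. -/

import Mathlib

open MeasureTheory Laplacian
open scoped ContDiff

noncomputable section

namespace NBody

/-! Throughout there are `n = N + 1` bodies in `d` dimensions, labelled by `Fin (N + 1)`. -/

/-! ### Relative motion and Jacobi coordinates -/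

/-- Unordered pairs of distinct bodies, written as `i < j`. -/
abbrev Pair (N : ℕ) : Type := {p : Fin (N + 1) × Fin (N + 1) // p.1 < p.2}

/-- The space of relative motion `ℝ^{d(n-1)}`; the point `y` consists of the `n - 1` Jacobi vectors
`(y (j, 0), …, y (j, d - 1))`, `j : Fin N`. -/
abbrev RelSpace (N d : ℕ) : Type := EuclideanSpace ℝ (Fin N × Fin d)

/-- The mass of the bodies `0, …, i`. -/
def cumMass {N : ℕ} (m : Fin (N + 1) → ℝ) (i : Fin (N + 1)) : ℝ := ∑ k ∈ Finset.Iic i, m k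

/-- The `j`-th Jacobi vector of a point of the space of relative motion. -/
def jacobiVec {N d : ℕ} (y : RelSpace N d) (j : Fin N) : EuclideanSpace ℝ (Fin d) :=
  WithLp.toLp 2 fun s => y (j, s)

/-- The Jacobi coordinates of a configuration `r` of the bodies. -/
def jacobi {N d : ℕ} (m : Fin (N + 1) → ℝ) (r : Fin (N + 1) → EuclideanSpace ℝ (Fin d)) :
    RelSpace N d :=
  WithLp.toLp 2 fun p =>
    (√(m p.1.succ * cumMass m p.1.castSucc / cumMass m p.1.succ) •
      (r p.1.succ - ∑ k ∈ Finset.Iic p.1.castSucc, (m k / cumMass m p.1.castSucc) • r k)) p.2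

/-- The position of body `i` relative to body `0`, as a function of the Jacobi vectors. -/
def relPos {N d : ℕ} (m : Fin (N + 1) → ℝ) (y : RelSpace N d) (i : Fin (N + 1)) :
    EuclideanSpace ℝ (Fin d) :=
  ∑ j : Fin N,
    (if j.succ < i then √(m j.succ / (cumMass m j.castSucc * cumMass m j.succ))
      else if j.succ = i then √(cumMass m j.succ / (m j.succ * cumMass m j.castSucc))
      else 0) • jacobiVec y j

lemma fin_telescope {E : Type*} [AddCommGroup E] {N : ℕ} (c : Fin (N + 1) → E) :
    ∑ j : Fin N, (c j.succ - c j.castSucc) = c (Fin.last N) - c 0 := by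
  induction N with
  | zero => simp
  | succ N ih =>
    rw [Fin.sum_univ_castSucc]
    have := ih (fun k => c k.castSucc)
    simp only [Fin.castSucc_zero] at this
    simp only [Fin.succ_castSucc, this, Fin.succ_last]
    abel

lemma cumMass_pos {N : ℕ} {m : Fin (N + 1) → ℝ} (hm : ∀ i, 0 < m i) (i : Fin (N + 1)) :
    0 < cumMass m i := Finset.sum_pos (fun k _ => hm k) ⟨i, by simp⟩

/-- The formula for the relative positions inverts the definition of the Jacobi vectors. -/
lemma relPos_jacobi {N d : ℕ} {m : Fin (N + 1) → ℝ} (hm : ∀ i, 0 < m i)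
    (r : Fin (N + 1) → EuclideanSpace ℝ (Fin d)) (i : Fin (N + 1)) :
    relPos m (jacobi m r) i = r i - r 0 := by
  set C : Fin (N + 1) → EuclideanSpace ℝ (Fin d) :=
    fun k => ∑ l ∈ Finset.Iic k, (m l / cumMass m k) • r l with hC
  have hIic : ∀ j : Fin N, Finset.Iic j.succ = insert j.succ (Finset.Iic j.castSucc) := by
    intro j
    ext k
    simp only [Finset.mem_Iic, Finset.mem_insert, Fin.le_def, Fin.ext_iff, Fin.val_succ,
      Fin.val_castSucc]
    omega
  have hnot : ∀ j : Fin N, j.succ ∉ Finset.Iic j.castSucc := by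
    intro j
    simp [Fin.le_def]
  have hM : ∀ j : Fin N, cumMass m j.succ = m j.succ + cumMass m j.castSucc := by
    intro j
    rw [cumMass, hIic, Finset.sum_insert (hnot j), cumMass]
  have hCs : ∀ j : Fin N, C j.succ - C j.castSucc =
      (m j.succ / cumMass m j.succ) • (r j.succ - C j.castSucc) := by
    intro j
    have p1 := (cumMass_pos hm j.castSucc).ne'
    have p2 := (cumMass_pos hm j.succ).ne'
    have h1 : C j.succ = (m j.succ / cumMass m j.succ) • r j.succ +
        (cumMass m j.castSucc / cumMass m j.succ) • C j.castSucc := by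
      simp only [hC]
      rw [hIic, Finset.sum_insert (hnot j), Finset.smul_sum]
      congr 1
      refine Finset.sum_congr rfl fun l _ => ?_
      rw [smul_smul]
      congr 1
      field_simp
    have h2 : cumMass m j.castSucc / cumMass m j.succ = 1 - m j.succ / cumMass m j.succ := by
      rw [eq_sub_iff_add_eq, ← add_div, add_comm, ← hM, div_self p2]
    rw [h1, h2]
    module
  have hJ : ∀ j : Fin N, jacobiVec (jacobi m r) j =
      √(m j.succ * cumMass m j.castSucc / cumMass m j.succ) • (r j.succ - C j.castSucc) := by
    intro j
    rfl
  have key : ∀ j : Fin N,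
      (if j.succ < i then √(m j.succ / (cumMass m j.castSucc * cumMass m j.succ))
        else if j.succ = i then √(cumMass m j.succ / (m j.succ * cumMass m j.castSucc))
        else 0) • jacobiVec (jacobi m r) j =
      Function.update C i (r i) (min j.succ i) - Function.update C i (r i) (min j.castSucc i) := by
    intro j
    have p0 := hm j.succ
    have p1 := cumMass_pos hm j.castSucc
    have p2 := cumMass_pos hm j.succ
    have hlt : j.castSucc < j.succ := Fin.castSucc_lt_succ
    rw [hJ, smul_smul]
    split_ifs with h1 h2
    · rw [min_eq_left h1.le, min_eq_left (hlt.trans h1).le, Function.update_of_ne h1.ne,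
        Function.update_of_ne (hlt.trans h1).ne, hCs, ← Real.sqrt_mul (by positivity)]
      congr 1
      rw [Real.sqrt_eq_iff_mul_self_eq (by positivity) (by positivity)]
      field_simp
    · subst h2
      rw [min_self, min_eq_left hlt.le, Function.update_self, Function.update_of_ne hlt.ne,
        ← Real.sqrt_mul (by positivity)]
      have : cumMass m j.succ / (m j.succ * cumMass m j.castSucc) *
          (m j.succ * cumMass m j.castSucc / cumMass m j.succ) = 1 := by field_simp
      rw [this, Real.sqrt_one, one_smul]
    · have h3 : i < j.succ := lt_of_le_of_ne (not_lt.mp h1) (Ne.symm h2)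
      have h4 : i ≤ j.castSucc := by
        simp only [Fin.lt_def, Fin.le_def, Fin.val_succ, Fin.val_castSucc] at h3 ⊢
        omega
      rw [min_eq_right h3.le, min_eq_right h4]
      simp
  rw [relPos, Finset.sum_congr rfl fun j _ => key j,
    fin_telescope (fun k => Function.update C i (r i) (min k i)),
    min_eq_right (Fin.le_last i), min_eq_left (Fin.zero_le i), Function.update_self]
  congr 1
  rcases eq_or_ne 0 i with h | h
  · subst h; simp
  · rw [Function.update_of_ne h]
    have e : Finset.Iic (0 : Fin (N + 1)) = {0} := by
      ext k; simp
    have := (hm 0).ne'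
    simp [hC, cumMass, e, this]

/-- The relative distances `r_ij = |r_i - r_j|`. -/
def distances {N d : ℕ} (m : Fin (N + 1) → ℝ) (y : RelSpace N d) : Pair N → ℝ :=
  fun p => dist (relPos m y p.1.1) (relPos m y p.1.2)

/-- The squared relative distances `ρ_ij = r_ij²`. -/
def sqDistances {N d : ℕ} (m : Fin (N + 1) → ℝ) (y : RelSpace N d) : Pair N → ℝ :=
  fun p => distances m y p ^ 2

/-- The action of a `d × d` matrix on the space of relative motion, applied to each Jacobi vector
(equivalently, to the position of each body). -/
def rotate {N d : ℕ} (A : Matrix (Fin d) (Fin d) ℝ) (y : RelSpace N d) : RelSpace N d :=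
  WithLp.toLp 2 fun p => A.mulVec (fun s => y (p.1, s)) p.2

/-! ### Unbounded operators -/

/-- The operator `T` is essentially self-adjoint: densely defined, with self-adjoint closure. -/
def IsEssentiallySelfAdjoint {H : Type*} [NormedAddCommGroup H] [InnerProductSpace ℂ H]
    [CompleteSpace H] (T : H →ₗ.[ℂ] H) : Prop :=
  Dense (T.domain : Set H) ∧ IsSelfAdjoint T.closure

/-- `ψ` is a nondegenerate ground state of energy `E` of the operator `T`: `ψ` is an eigenvector
of `T` with eigenvalue `E`, the energy `E` is a lower bound of `T`, and every eigenvector of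
eigenvalue `E` is a multiple of `ψ`. -/
def IsNondegenerateGroundState {H : Type*} [NormedAddCommGroup H] [InnerProductSpace ℂ H]
    (T : H →ₗ.[ℂ] H) (E : ℝ) (ψ : H) : Prop :=
  ψ ≠ 0 ∧
  (∃ hψ : ψ ∈ T.domain, T ⟨ψ, hψ⟩ = (E : ℂ) • ψ) ∧
  (∀ φ : T.domain, E * ‖(φ : H)‖ ^ 2 ≤ (inner ℂ (φ : H) (T φ)).re) ∧
  (∀ φ : T.domain, T φ = (E : ℂ) • (φ : H) → ∃ c : ℂ, (φ : H) = c • ψ)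

/-! ### The Hamiltonian of relative motion -/

/-- The Hilbert space `L²(ℝ^{d(n-1)})`. -/
abbrev RelL2 (N d : ℕ) : Type := Lp ℂ 2 (volume : Measure (RelSpace N d))

/-- The differential expression `-Δ_r + V(r_ij)`. Here `Δ_r` is the relative part of
`∑ i, (1 / (2 m_i)) Δ_i`, that is, half of the Laplacian in the Jacobi coordinates. -/
def relExpr {N d : ℕ} (m : Fin (N + 1) → ℝ) (V : (Pair N → ℝ) → ℝ) (φ : RelSpace N d → ℂ)
    (y : RelSpace N d) : ℂ :=
  -((1 / 2 : ℂ) * Δ φ y) + (V (distances m y) : ℂ) * φ y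

/-- The graph of the Hamiltonian of relative motion: its domain consists of the test functions `φ`
for which `-Δ_r φ + V φ` (equivalently `V φ`) is square integrable; if `V` is locally square
integrable these are all test functions. (A test function is determined by its class, so that this
is the graph of an operator.) -/
def relGraph (N d : ℕ) (m : Fin (N + 1) → ℝ) (V : (Pair N → ℝ) → ℝ) :
    Submodule ℂ (RelL2 N d × RelL2 N d) where
  carrier := {u | ∃ φ : RelSpace N d → ℂ, ContDiff ℝ ∞ φ ∧ HasCompactSupport φ ∧
    u.1 =ᵐ[volume] φ ∧ u.2 =ᵐ[volume] relExpr m V φ}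
  zero_mem' := by
    refine ⟨0, contDiff_const, HasCompactSupport.zero, Lp.coeFn_zero _ _ _, ?_⟩
    have h : relExpr m V (0 : RelSpace N d → ℂ) = 0 := by
      funext y
      have : Δ (0 : RelSpace N d → ℂ) y = 0 := by
        have := InnerProductSpace.laplacian_const (E := RelSpace N d) (c := (0 : ℂ))
        exact congrFun this y
      simp [relExpr, this]
    rw [h]
    exact Lp.coeFn_zero _ _ _
  add_mem' := by
    rintro u v ⟨φ, h1, h2, h3, h4⟩ ⟨χ, k1, k2, k3, k4⟩
    refine ⟨φ + χ, h1.add k1, h2.add k2, (Lp.coeFn_add _ _).trans (h3.add k3), ?_⟩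
    refine (Lp.coeFn_add _ _).trans ((h4.add k4).trans (Filter.Eventually.of_forall fun y => ?_))
    have : Δ (φ + χ) y = Δ φ y + Δ χ y :=
      ContDiffAt.laplacian_add (h1.contDiffAt.of_le (WithTop.coe_le_coe.mpr (le_top : (2 : ℕ∞) ≤ ⊤)))
        (k1.contDiffAt.of_le (WithTop.coe_le_coe.mpr (le_top : (2 : ℕ∞) ≤ ⊤)))
    simp only [relExpr, this, Pi.add_apply]
    ring
  smul_mem' := by
    rintro c u ⟨φ, h1, h2, h3, h4⟩
    refine ⟨c • φ, contDiff_const.smul h1, h2.smul_left (f := fun _ => c),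
      (Lp.coeFn_smul _ _).trans (h3.const_smul c), ?_⟩
    refine (Lp.coeFn_smul _ _).trans
      ((h4.const_smul c).trans (Filter.Eventually.of_forall fun y => ?_))
    have : Δ (c • φ) y = c • Δ φ y :=
      InnerProductSpace.laplacian_smul c (h1.contDiffAt.of_le (WithTop.coe_le_coe.mpr (le_top : (2 : ℕ∞) ≤ ⊤)))
    simp only [relExpr, this, Pi.smul_apply, smul_eq_mul]
    ring

/-- The Hamiltonian `H_r = -Δ_r + V` of relative motion in `L²(ℝ^{d(n-1)})`, on test functions. -/
def relHamiltonian (N d : ℕ) (m : Fin (N + 1) → ℝ) (V : (Pair N → ℝ) → ℝ) :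
    RelL2 N d →ₗ.[ℂ] RelL2 N d :=
  (relGraph N d m V).toLinearPMap

/-! ### The restricted radial problem -/

/-- The coordinate `ρ_ij = ρ_ji` for arbitrary `i`, `j`, with `ρ_ii = 0`. -/
def coord {N : ℕ} (ρ : Pair N → ℝ) (i j : Fin (N + 1)) : ℝ :=
  if h : i < j then ρ ⟨(i, j), h⟩ else if h : j < i then ρ ⟨(j, i), h⟩ else 0

/-- The partial derivative `∂_{ρ_ij} = ∂_{ρ_ji}`. -/
def pderiv {N : ℕ} (i j : Fin (N + 1)) (f : (Pair N → ℝ) → ℂ) (ρ : Pair N → ℝ) : ℂ :=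
  fderiv ℝ f ρ fun p => if p.1 = (i, j) ∨ p.1 = (j, i) then 1 else 0

/-- The radial operator `Δ_rad` in the variables `ρ_ij`. -/
def radLaplacian {N : ℕ} (d : ℕ) (m : Fin (N + 1) → ℝ) (f : (Pair N → ℝ) → ℂ)
    (ρ : Pair N → ℝ) : ℂ :=
  2 * ∑ i, ∑ j, ∑ k, (if i ≠ j ∧ i ≠ k ∧ j < k then
      ((1 / m i * (coord ρ i j + coord ρ i k - coord ρ j k) : ℝ) : ℂ) *
        pderiv i j (pderiv i k f) ρ else 0)
  + 2 * ∑ p : Pair N, (((m p.1.1 + m p.1.2) / (m p.1.1 * m p.1.2) * ρ p : ℝ) : ℂ) *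
      pderiv p.1.1 p.1.2 (pderiv p.1.1 p.1.2 f) ρ
  + (d : ℂ) * ∑ p : Pair N, (((m p.1.1 + m p.1.2) / (m p.1.1 * m p.1.2) : ℝ) : ℂ) *
      pderiv p.1.1 p.1.2 f ρ

/-- The Gram matrix of the edges issuing from body `0`, `⟨r_i - r_0, r_j - r_0⟩`, expressed through
the squared distances by the law of cosines. -/
def gram {N : ℕ} (ρ : Pair N → ℝ) : Matrix (Fin N) (Fin N) ℝ :=
  Matrix.of fun i j => (coord ρ 0 i.succ + coord ρ 0 j.succ - coord ρ i.succ j.succ) / 2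

/-- The radial configuration space: the `ρ` that are the squared edge lengths of a nondegenerate
polytope (simplex) of interaction. -/
def region (N : ℕ) : Set (Pair N → ℝ) := {ρ | (gram ρ).PosDef}

/-- The squared volume `V_n²` of the simplex with squared edge lengths `ρ`. -/
def sqVol {N : ℕ} (ρ : Pair N → ℝ) : ℝ := (gram ρ).det / (N.factorial : ℝ) ^ 2

/-- The radial measure `(V_n²)^((d - n) / 2) ∏ dρ_ij` on the radial configuration space. -/
def radMeasure (N d : ℕ) : Measure (Pair N → ℝ) :=
  (volume.restrict (region N)).withDensity fun ρ =>
    ENNReal.ofReal (sqVol ρ ^ (((d : ℝ) - ((N : ℝ) + 1)) / 2))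

/-- The Hilbert space of the restricted problem. -/
abbrev RadL2 (N d : ℕ) : Type := Lp ℂ 2 (radMeasure N d)

/-- The differential expression `-Δ_rad + V` in the variables `ρ_ij`, with `V` a function of the
distances `r_ij = √ρ_ij`. -/
def radExpr {N : ℕ} (d : ℕ) (m : Fin (N + 1) → ℝ) (V : (Pair N → ℝ) → ℝ)
    (f : (Pair N → ℝ) → ℂ) (ρ : Pair N → ℝ) : ℂ :=
  -radLaplacian d m f ρ + (V (fun p => √(ρ p)) : ℂ) * f ρ

lemma coord_continuous {N : ℕ} (i j : Fin (N + 1)) :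
    Continuous fun ρ : Pair N → ℝ => coord ρ i j := by
  unfold coord
  split_ifs <;> fun_prop

lemma gram_continuous {N : ℕ} : Continuous fun ρ : Pair N → ℝ => gram ρ := by
  refine continuous_matrix fun i j => ?_
  simp only [gram, Matrix.of_apply]
  exact (((coord_continuous _ _).add (coord_continuous _ _)).sub (coord_continuous _ _)).div_const _

lemma coord_comm {N : ℕ} (ρ : Pair N → ℝ) (i j : Fin (N + 1)) : coord ρ i j = coord ρ j i := by
  unfold coord
  rcases lt_trichotomy i j with h | h | h
  · simp [h, h.not_gt]
  · simp [h]
  · simp [h, h.not_gt]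

lemma gram_isHermitian {N : ℕ} (ρ : Pair N → ℝ) : (gram ρ).IsHermitian := by
  ext i j
  simp only [gram, Matrix.conjTranspose_apply, Matrix.of_apply, star_trivial]
  rw [coord_comm ρ j.succ i.succ]
  ring

lemma region_measurableSet (N : ℕ) : MeasurableSet (region N) := by
  have h : region N = {ρ | ∀ x : Fin N → ℝ, 0 ≤ star x ⬝ᵥ ((gram ρ).mulVec x)} ∩
      {ρ | (gram ρ).det ≠ 0} := by
    ext ρ
    constructor
    · intro hρ
      exact ⟨fun x => hρ.posSemidef.dotProduct_mulVec_nonneg x,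
        hρ.posSemidef.posDef_iff_det_ne_zero.mp hρ⟩
    · rintro ⟨h1, h2⟩
      exact (Matrix.PosSemidef.of_dotProduct_mulVec_nonneg
        (gram_isHermitian ρ) h1).posDef_iff_det_ne_zero.mpr h2
  rw [h]
  refine (IsClosed.measurableSet ?_).inter (IsOpen.measurableSet ?_)
  · simp only [Set.ofPred_forall]
    refine isClosed_iInter fun x => isClosed_le continuous_const ?_
    exact Continuous.dotProduct continuous_const (gram_continuous.matrix_mulVec continuous_const)
  · exact isOpen_ne_fun gram_continuous.matrix_det continuous_const

lemma radMeasure_ae_mem_region (N d : ℕ) : ∀ᵐ ρ ∂(radMeasure N d), ρ ∈ region N :=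
  (withDensity_absolutelyContinuous _ _).ae_le (ae_restrict_mem (region_measurableSet N))

lemma pderiv_add {N : ℕ} {i j : Fin (N + 1)} {f g : (Pair N → ℝ) → ℂ} {ρ : Pair N → ℝ}
    (hf : DifferentiableAt ℝ f ρ) (hg : DifferentiableAt ℝ g ρ) :
    pderiv i j (f + g) ρ = pderiv i j f ρ + pderiv i j g ρ := by
  simp [pderiv, fderiv_add hf hg]

lemma pderiv_smul {N : ℕ} {i j : Fin (N + 1)} {f : (Pair N → ℝ) → ℂ} {ρ : Pair N → ℝ}
    (c : ℂ) (hf : DifferentiableAt ℝ f ρ) :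
    pderiv i j (c • f) ρ = c * pderiv i j f ρ := by
  simp [pderiv, fderiv_const_smul hf]

lemma differentiable_nhds {N : ℕ} {f : (Pair N → ℝ) → ℂ} {ρ : Pair N → ℝ}
    (hf : ContDiffAt ℝ ∞ f ρ) : ∀ᶠ σ in nhds ρ, DifferentiableAt ℝ f σ := by
  have h1 : ContDiffAt ℝ 1 f ρ := hf.of_le (by exact_mod_cast (le_top : (1 : ℕ∞) ≤ ⊤))
  exact (h1.eventually (by simp)).mono fun σ hσ => hσ.differentiableAt (by simp)

lemma pderiv_differentiableAt {N : ℕ} {i j : Fin (N + 1)} {f : (Pair N → ℝ) → ℂ} {ρ : Pair N → ℝ}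
    (hf : ContDiffAt ℝ ∞ f ρ) : DifferentiableAt ℝ (pderiv i j f) ρ := by
  have h2 : ContDiffAt ℝ 2 f ρ := hf.of_le (WithTop.coe_le_coe.mpr (le_top : (2 : ℕ∞) ≤ ⊤))
  have h : ContDiffAt ℝ 1 (fderiv ℝ f) ρ := h2.fderiv_right (by norm_num)
  exact (h.differentiableAt (by simp)).clm_apply (differentiableAt_const _)

lemma pderiv_pderiv_add {N : ℕ} {i j k l : Fin (N + 1)} {f g : (Pair N → ℝ) → ℂ}
    {ρ : Pair N → ℝ} (hf : ContDiffAt ℝ ∞ f ρ) (hg : ContDiffAt ℝ ∞ g ρ) :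
    pderiv i j (pderiv k l (f + g)) ρ =
      pderiv i j (pderiv k l f) ρ + pderiv i j (pderiv k l g) ρ := by
  have h : pderiv k l (f + g) =ᶠ[nhds ρ] pderiv k l f + pderiv k l g := by
    filter_upwards [differentiable_nhds hf, differentiable_nhds hg] with σ h1 h2
    exact pderiv_add h1 h2
  rw [← pderiv_add (pderiv_differentiableAt hf) (pderiv_differentiableAt hg)]
  unfold pderiv at h ⊢
  rw [h.fderiv_eq]

lemma pderiv_pderiv_smul {N : ℕ} {i j k l : Fin (N + 1)} {f : (Pair N → ℝ) → ℂ}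
    {ρ : Pair N → ℝ} (c : ℂ) (hf : ContDiffAt ℝ ∞ f ρ) :
    pderiv i j (pderiv k l (c • f)) ρ = c * pderiv i j (pderiv k l f) ρ := by
  have h : pderiv k l (c • f) =ᶠ[nhds ρ] c • pderiv k l f := by
    filter_upwards [differentiable_nhds hf] with σ h1
    exact pderiv_smul c h1
  rw [← pderiv_smul c (pderiv_differentiableAt hf)]
  unfold pderiv at h ⊢
  rw [h.fderiv_eq]

lemma radExpr_add {N d : ℕ} {m : Fin (N + 1) → ℝ} {V : (Pair N → ℝ) → ℝ}
    {f g : (Pair N → ℝ) → ℂ} {ρ : Pair N → ℝ}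
    (hf : ContDiffAt ℝ ∞ f ρ) (hg : ContDiffAt ℝ ∞ g ρ) :
    radExpr d m V (f + g) ρ = radExpr d m V f ρ + radExpr d m V g ρ := by
  simp only [radExpr, radLaplacian, pderiv_pderiv_add hf hg,
    pderiv_add (differentiable_nhds hf).self_of_nhds (differentiable_nhds hg).self_of_nhds,
    Pi.add_apply, mul_add, ite_add_zero, Finset.sum_add_distrib]
  ring

lemma radExpr_smul {N d : ℕ} {m : Fin (N + 1) → ℝ} {V : (Pair N → ℝ) → ℝ}
    {f : (Pair N → ℝ) → ℂ} {ρ : Pair N → ℝ} (c : ℂ) (hf : ContDiffAt ℝ ∞ f ρ) :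
    radExpr d m V (c • f) ρ = c * radExpr d m V f ρ := by
  simp only [radExpr, radLaplacian, pderiv_pderiv_smul c hf,
    pderiv_smul c (differentiable_nhds hf).self_of_nhds, Pi.smul_apply, smul_eq_mul,
    mul_left_comm _ c, ← mul_ite_zero, ← Finset.mul_sum]
  ring

/-- The graph of the restricted Hamiltonian: its domain consists of the radial test functions, i.e.
of the functions `f` of `ρ`, smooth in the radial configuration space, that give a test function
on the space of relative motion when they are expressed through the Jacobi vectors, and for which
`-Δ_rad f + V f` is square integrable. -/
def radGraph (N d : ℕ) (m : Fin (N + 1) → ℝ) (V : (Pair N → ℝ) → ℝ) :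
    Submodule ℂ (RadL2 N d × RadL2 N d) where
  carrier := {u | ∃ f : (Pair N → ℝ) → ℂ, (∀ ρ ∈ region N, ContDiffAt ℝ ∞ f ρ) ∧
    ContDiff ℝ ∞ (fun y : RelSpace N d => f (sqDistances m y)) ∧
    HasCompactSupport (fun y : RelSpace N d => f (sqDistances m y)) ∧
    u.1 =ᵐ[radMeasure N d] f ∧ u.2 =ᵐ[radMeasure N d] radExpr d m V f}
  zero_mem' := by
    refine ⟨0, fun ρ _ => contDiffAt_const, contDiff_const, HasCompactSupport.zero,
      Lp.coeFn_zero _ _ _, ?_⟩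
    have h : radExpr d m V (0 : (Pair N → ℝ) → ℂ) = 0 := by
      funext ρ
      have := radExpr_smul (d := d) (m := m) (V := V) (f := 0) (ρ := ρ) 0 contDiffAt_const
      simpa using this
    rw [h]
    exact Lp.coeFn_zero _ _ _
  add_mem' := by
    rintro u v ⟨f, h0, h1, h2, h3, h4⟩ ⟨g, k0, k1, k2, k3, k4⟩
    refine ⟨f + g, fun ρ hρ => (h0 ρ hρ).add (k0 ρ hρ), h1.add k1, h2.add k2,
      (Lp.coeFn_add _ _).trans (h3.add k3), ?_⟩
    refine (Lp.coeFn_add _ _).trans ((h4.add k4).trans ?_)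
    filter_upwards [radMeasure_ae_mem_region N d] with ρ hρ
    exact (radExpr_add (h0 ρ hρ) (k0 ρ hρ)).symm
  smul_mem' := by
    rintro c u ⟨f, h0, h1, h2, h3, h4⟩
    refine ⟨c • f, fun ρ hρ => contDiffAt_const.smul (h0 ρ hρ), contDiff_const.smul h1,
      h2.smul_left (f := fun _ => c), (Lp.coeFn_smul _ _).trans (h3.const_smul c), ?_⟩
    refine (Lp.coeFn_smul _ _).trans ((h4.const_smul c).trans ?_)
    filter_upwards [radMeasure_ae_mem_region N d] with ρ hρ
    exact (radExpr_smul c (h0 ρ hρ)).symm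

/-- The restricted Hamiltonian `H_rad = -Δ_rad + V` in the `L²` space of the radial measure, on
radial test functions. -/
def radHamiltonian (N d : ℕ) (m : Fin (N + 1) → ℝ) (V : (Pair N → ℝ) → ℝ) :
    RadL2 N d →ₗ.[ℂ] RadL2 N d :=
  (radGraph N d m V).toLinearPMap

end NBody

end

/-! Composition with the squared distances turns functions of `ρ` into functions on the space of
relative motion. It multiplies every inner product by one constant, so the radial `L²` space becomes
a closed subspace of `L²(ℝ^{d(n-1)})`, and a multiple of the adjoint is a left inverse. The
resulting projection is the average over `O(d)`, and it reduces the Hamiltonian: `H_rad` is the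
compression of `H_r` to radial functions (`isCompression`). Essential self-adjointness descends to a
compression, and so does a nondegenerate ground state that lies in the subspace. It remains to see
that `Ψ₀` is radial.

Three facts make up the compression. The image of Lebesgue measure is a multiple of the radial
measure (`exists_map_shape_eq_smul_radMeasure`): both scale by `|det W| ^ d` under linear changes
`W` of the simplex, and such a measure is unique up to a factor, by a Fubini argument over `N × N`
matrices. On radial functions half of the Jacobi Laplacian is `Δ_rad`
(`half_laplacian_comp_sqDistances`). Finally, averaging over `O(d)` commutes with the Laplacian and
with `V`, and an averaged test function is a smooth function of `ρ` on the region
(`exists_comp_sqDistances_eq`). Since `n - 1 ≤ d`, almost every configuration is a nondegenerate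
simplex, so degenerate ones can be ignored.

Nondegeneracy alone shows only that `O(d)` acts on `Ψ₀` by a character, which might be the
determinant; the radial projection of `Ψ₀` would then vanish. Positivity excludes this. Replacing
test functions by smooth approximations of their modulus does not raise the kinetic energy and, in
the limit, leaves the potential energy unchanged, so `|Ψ₀|` also minimises the energy and is an
eigenvector (`absL2_mem_closure_graph`), hence a multiple of `Ψ₀`. The average of a nonzero
nonnegative function is nonzero, so the projection of `Ψ₀` is a nonzero eigenvector of energy `E₀`,
and `Ψ₀` is a multiple of it. The argument stays at the level of test functions and quadratic forms,
so neither regularity of `Ψ₀` nor strict positivity is needed. -/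

noncomputable section

namespace NBody

/-! ### Essentially self-adjoint operators and their graphs -/

section Operators

variable {H K : Type*} [NormedAddCommGroup H] [InnerProductSpace ℂ H]
  [NormedAddCommGroup K] [InnerProductSpace ℂ K]

lemma IsEssentiallySelfAdjoint.isClosable [CompleteSpace H] {T : H →ₗ.[ℂ] H}
    (hT : IsEssentiallySelfAdjoint T) : T.IsClosable :=
  hT.2.isClosed.isClosable.leIsClosable T.le_closure

/-- The adjoint relation is a closed condition on `(a, b)`, so testing on `g` is the same as testing
on its closure. -/
lemma mem_adjoint_topologicalClosure (g : Submodule ℂ (H × H)) (x : H × H) :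
    x ∈ g.topologicalClosure.adjoint ↔
      ∀ a b, (a, b) ∈ g → inner ℂ b x.1 = inner ℂ a x.2 := by
  rw [Submodule.mem_adjoint_iff]
  simp only [sub_eq_zero]
  refine ⟨fun h a b hab => h a b (g.le_topologicalClosure hab), fun h a b hab => ?_⟩
  have hc : IsClosed {p : H × H | inner ℂ p.2 x.1 = inner ℂ p.1 x.2} :=
    isClosed_eq (by fun_prop) (by fun_prop)
  have hsub : (g : Set (H × H)) ⊆ {p : H × H | inner ℂ p.2 x.1 = inner ℂ p.1 x.2} :=
    fun p hp => h p.1 p.2 hp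
  exact closure_minimal hsub hc hab

/-- The closure of an essentially self-adjoint operator is its adjoint. -/
lemma IsEssentiallySelfAdjoint.mem_closure_graph_iff [CompleteSpace H] {T : H →ₗ.[ℂ] H}
    (hT : IsEssentiallySelfAdjoint T) (x : H × H) :
    x ∈ T.closure.graph ↔ ∀ a b, (a, b) ∈ T.graph → inner ℂ b x.1 = inner ℂ a x.2 := by
  have h2 := hT.2
  rw [LinearPMap.isSelfAdjoint_def] at h2
  rw [← mem_adjoint_topologicalClosure, hT.isClosable.graph_closure_eq_closure_graph,
    ← LinearPMap.adjoint_graph_eq_graph_adjoint hT.2.dense_domain, h2]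

/-- Converse of `mem_closure_graph_iff`: self-adjointness of the closure is an equality of graphs,
both sides of which are explicit in terms of the graph of `T`. -/
lemma isEssentiallySelfAdjoint_of_graph [CompleteSpace H] {T : H →ₗ.[ℂ] H} (hc : T.IsClosable)
    (hd : Dense (T.domain : Set H))
    (h : ∀ x : H × H, x ∈ T.graph.topologicalClosure ↔
      ∀ a b, (a, b) ∈ T.graph → inner ℂ b x.1 = inner ℂ a x.2) :
    IsEssentiallySelfAdjoint T := by
  refine ⟨hd, ?_⟩
  have hd' : Dense (T.closure.domain : Set H) := hd.mono T.le_closure.1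
  rw [LinearPMap.isSelfAdjoint_def]
  refine LinearPMap.eq_of_eq_graph ?_
  rw [LinearPMap.adjoint_graph_eq_graph_adjoint hd', ← hc.graph_closure_eq_closure_graph]
  ext x
  rw [mem_adjoint_topologicalClosure, h]

lemma mem_topologicalClosure_of_maps {E F : Type*} [NormedAddCommGroup E] [NormedSpace ℂ E]
    [NormedAddCommGroup F] [NormedSpace ℂ F] (U : E →L[ℂ] F) {g : Submodule ℂ (E × E)}
    {g' : Submodule ℂ (F × F)} (h : ∀ a b, (a, b) ∈ g → (U a, U b) ∈ g') {x : E × E}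
    (hx : x ∈ g.topologicalClosure) : (U x.1, U x.2) ∈ g'.topologicalClosure := by
  have hcont : Continuous fun p : E × E => (U p.1, U p.2) := by fun_prop
  exact (map_mem_closure hcont hx fun p hp => h p.1 p.2 hp : _ ∈ _root_.closure (g' : Set (F × F)))

/-- A compression of an essentially self-adjoint operator `T` to a closed subspace that reduces it:
`U` embeds the subspace, up to the scale `c`, and `W` is a left inverse that is a multiple of the
adjoint. -/
structure IsCompression (T : H →ₗ.[ℂ] H) (S : K →ₗ.[ℂ] K) (U : K →L[ℂ] H) (W : H →L[ℂ] K)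
    (c : ℝ) : Prop where
  pos : 0 < c
  left_inv : ∀ k, W (U k) = k
  inner_map : ∀ k h, inner ℂ (U k) h = (c : ℂ) * inner ℂ k (W h)
  map_graph : ∀ a b, (a, b) ∈ S.graph → (U a, U b) ∈ T.graph
  comap_graph : ∀ a b, (a, b) ∈ T.graph → (W a, W b) ∈ S.graph

namespace IsCompression

variable {T : H →ₗ.[ℂ] H} {S : K →ₗ.[ℂ] K} {U : K →L[ℂ] H} {W : H →L[ℂ] K} {c : ℝ}

lemma inner_map' (h : IsCompression T S U W c) (v : H) (k : K) :
    inner ℂ v (U k) = (c : ℂ) * inner ℂ (W v) k := by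
  rw [← inner_conj_symm, h.inner_map, map_mul, inner_conj_symm, Complex.conj_ofReal]

lemma inner_map_map (h : IsCompression T S U W c) (k l : K) :
    inner ℂ (U k) (U l) = (c : ℂ) * inner ℂ k l := by
  rw [h.inner_map, h.left_inv]

lemma norm_map_sq (h : IsCompression T S U W c) (k : K) : ‖U k‖ ^ 2 = c * ‖k‖ ^ 2 := by
  have := h.inner_map_map k k
  have h2 := congrArg Complex.re this
  rw [Complex.re_ofReal_mul] at h2
  rwa [← inner_self_eq_norm_sq (𝕜 := ℂ), ← inner_self_eq_norm_sq (𝕜 := ℂ)]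

/-- If `(0, b)` is a limit of points of the graph of `S`, then `(0, U b)` lies in the graph of the
closure of `T`. Hence `U b = 0`, and the left inverse gives `b = 0`. -/
lemma isClosable [CompleteSpace H] (h : IsCompression T S U W c) (hT : IsEssentiallySelfAdjoint T) :
    S.IsClosable := by
  refine ⟨S.graph.topologicalClosure.toLinearPMap, (Submodule.toLinearPMap_graph_eq _ ?_).symm⟩
  intro x hx hx0
  have h1 := mem_topologicalClosure_of_maps U h.map_graph hx
  rw [hT.isClosable.graph_closure_eq_closure_graph, hx0, map_zero] at h1
  have h2 : U x.2 = 0 := T.closure.graph_fst_eq_zero_snd h1 rfl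
  rw [← h.left_inv x.2, h2, map_zero]

lemma map_closure [CompleteSpace H] (h : IsCompression T S U W c) (hT : IsEssentiallySelfAdjoint T) {a b : K}
    (hab : (a, b) ∈ S.closure.graph) : (U a, U b) ∈ T.closure.graph := by
  rw [← (h.isClosable hT).graph_closure_eq_closure_graph] at hab
  rw [← hT.isClosable.graph_closure_eq_closure_graph]
  exact mem_topologicalClosure_of_maps U h.map_graph hab

lemma comap_closure [CompleteSpace H] (h : IsCompression T S U W c)
    (hT : IsEssentiallySelfAdjoint T) {a b : H}
    (hab : (a, b) ∈ T.closure.graph) : (W a, W b) ∈ S.closure.graph := by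
  rw [← hT.isClosable.graph_closure_eq_closure_graph] at hab
  rw [← (h.isClosable hT).graph_closure_eq_closure_graph]
  exact mem_topologicalClosure_of_maps W h.comap_graph hab

/-- Since `W` is proportional to the adjoint of `U` and both preserve the graphs, the adjoint
relation passes between `S` and `T`: a pair adjoint to `S` is lifted by `U`, found in the closure of
`T`, and brought back by `W`. -/
lemma isEssentiallySelfAdjoint [CompleteSpace H] [CompleteSpace K] (h : IsCompression T S U W c)
    (hT : IsEssentiallySelfAdjoint T) :
    IsEssentiallySelfAdjoint S := by
  have hc0 : (c : ℂ) ≠ 0 := by exact_mod_cast h.pos.ne'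
  refine isEssentiallySelfAdjoint_of_graph (h.isClosable hT) ?_ fun x => ⟨fun hx a b hab => ?_,
    fun hx => ?_⟩
  -- A continuous surjection maps the dense domain of `T` onto a dense set, which lies in the domain
  -- of `S`.
  · have hW : Function.Surjective W := fun k => ⟨U k, h.left_inv k⟩
    refine (hW.denseRange.dense_image W.continuous hT.1).mono ?_
    rintro _ ⟨u, hu, rfl⟩
    have := h.comap_graph u (T ⟨u, hu⟩) (T.mem_graph ⟨u, hu⟩)
    exact S.mem_domain_of_mem_graph this
  · have h1 := mem_topologicalClosure_of_maps U h.map_graph hx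
    rw [hT.isClosable.graph_closure_eq_closure_graph, hT.mem_closure_graph_iff] at h1
    have h2 := h1 _ _ (h.map_graph a b hab)
    rw [h.inner_map_map, h.inner_map_map] at h2
    exact mul_left_cancel₀ hc0 h2
  -- Pairing `U x` with a point of the graph of `T` is, up to `c`, pairing `x` with the image of
  -- that point under `W`, which lies in the graph of `S`.
  · have h1 : (U x.1, U x.2) ∈ T.closure.graph := by
      rw [hT.mem_closure_graph_iff]
      intro a b hab
      rw [h.inner_map', h.inner_map', hx _ _ (h.comap_graph a b hab)]
    have h2 := h.comap_closure hT h1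
    rw [h.left_inv, h.left_inv] at h2
    rwa [(h.isClosable hT).graph_closure_eq_closure_graph]

/-- Eigenvectors of the closure of `S` are carried by `U` to eigenvectors of the closure of `T`. In
the lower bound both sides acquire the same positive factor `c`. -/
lemma isNondegenerateGroundState [CompleteSpace H] (h : IsCompression T S U W c)
    (hT : IsEssentiallySelfAdjoint T)
    {E : ℝ} {k : K} (hψ : IsNondegenerateGroundState T.closure E (U k)) :
    IsNondegenerateGroundState S.closure E k := by
  obtain ⟨h0, ⟨hd, he⟩, hb, hu⟩ := hψ
  refine ⟨fun hk => h0 (by rw [hk, map_zero]), ?_, fun φ => ?_, fun φ hφ => ?_⟩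
  · have h1 : (U k, (E : ℂ) • U k) ∈ T.closure.graph := by
      rw [← he]; exact T.closure.mem_graph ⟨_, hd⟩
    have h2 := h.comap_closure hT h1
    rw [map_smul, h.left_inv] at h2
    rw [LinearPMap.mem_graph_iff] at h2
    obtain ⟨y, hy1, hy2⟩ := h2
    simp only at hy1 hy2
    subst hy1
    exact ⟨y.2, hy2⟩
  · have h1 := h.map_closure hT (S.closure.mem_graph φ)
    obtain ⟨y, hy1, hy2⟩ := (LinearPMap.mem_graph_iff _).1 h1
    simp only at hy1 hy2
    have h2 := hb y
    rw [hy1, hy2, h.inner_map_map, h.norm_map_sq, Complex.re_ofReal_mul] at h2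
    have := h.pos
    nlinarith
  · have h1 := h.map_closure hT (S.closure.mem_graph φ)
    obtain ⟨y, hy1, hy2⟩ := (LinearPMap.mem_graph_iff _).1 h1
    simp only at hy1 hy2
    obtain ⟨z, hz⟩ := hu y (by rw [hy1, hy2, hφ, map_smul])
    refine ⟨z, ?_⟩
    rw [← h.left_inv (φ : K), ← hy1, hz, map_smul, h.left_inv]

end IsCompression

lemma IsEssentiallySelfAdjoint.inner_symm [CompleteSpace H] {T : H →ₗ.[ℂ] H}
    (hT : IsEssentiallySelfAdjoint T) (x y : T.domain) :
    inner ℂ (T x) (y : H) = inner ℂ (x : H) (T y) := by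
  have h : ((y : H), T y) ∈ T.closure.graph :=
    LinearPMap.le_graph_of_le T.le_closure (T.mem_graph y)
  exact (hT.mem_closure_graph_iff _).1 h _ _ (T.mem_graph x)

/-- The positive semidefinite form `⟨x, (T - E) y⟩` of a semibounded operator. -/
@[reducible]
def semiboundedCore [CompleteSpace H] {T : H →ₗ.[ℂ] H} (hT : IsEssentiallySelfAdjoint T) {E : ℝ}
    (hE : ∀ φ : T.domain, E * ‖(φ : H)‖ ^ 2 ≤ (inner ℂ (φ : H) (T φ)).re) :
    PreInnerProductSpace.Core ℂ T.domain where
  inner x y := inner ℂ (x : H) (T y) - (E : ℂ) * inner ℂ (x : H) (y : H)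
  conj_inner_symm x y := by
    rw [map_sub, map_mul, inner_conj_symm, inner_conj_symm, Complex.conj_ofReal, hT.inner_symm]
  re_inner_nonneg x := by
    have h2 : (inner ℂ (x : H) (x : H)).re = ‖(x : H)‖ ^ 2 := inner_self_eq_norm_sq (𝕜 := ℂ) _
    simp only [map_sub, RCLike.re_to_complex, Complex.re_ofReal_mul, h2]
    linarith [hE x]
  add_left x y z := by
    simp only [Submodule.coe_add, inner_add_left]
    ring
  smul_left x y r := by
    simp only [Submodule.coe_smul, inner_smul_left]
    ring

/-- Cauchy–Schwarz for the positive semidefinite form of `T - E`. -/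
lemma norm_inner_sub_sq_le [CompleteSpace H] {T : H →ₗ.[ℂ] H} (hT : IsEssentiallySelfAdjoint T)
    {E : ℝ} (hE : ∀ φ : T.domain, E * ‖(φ : H)‖ ^ 2 ≤ (inner ℂ (φ : H) (T φ)).re)
    (x y : T.domain) :
    ‖inner ℂ (T x) (y : H) - (E : ℂ) * inner ℂ (x : H) (y : H)‖ ^ 2 ≤
      ((inner ℂ (x : H) (T x)).re - E * ‖(x : H)‖ ^ 2) *
        ((inner ℂ (y : H) (T y)).re - E * ‖(y : H)‖ ^ 2) := by
  have h := @InnerProductSpace.Core.inner_mul_inner_self_le ℂ T.domain _ _ _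
    (semiboundedCore hT hE) x y
  have h2 : ∀ x : H, (inner ℂ x x).re = ‖x‖ ^ 2 := fun x => inner_self_eq_norm_sq (𝕜 := ℂ) _
  have h3 : ‖inner ℂ (y : H) (T x) - (E : ℂ) * inner ℂ (y : H) (x : H)‖ =
      ‖inner ℂ (T x) (y : H) - (E : ℂ) * inner ℂ (x : H) (y : H)‖ := by
    rw [← RCLike.norm_conj, map_sub, map_mul, inner_conj_symm, inner_conj_symm,
      Complex.conj_ofReal]
  change ‖inner ℂ (x : H) (T y) - (E : ℂ) * inner ℂ (x : H) (y : H)‖ *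
    ‖inner ℂ (y : H) (T x) - (E : ℂ) * inner ℂ (y : H) (x : H)‖ ≤
    (inner ℂ (x : H) (T x) - (E : ℂ) * inner ℂ (x : H) (x : H)).re *
    (inner ℂ (y : H) (T y) - (E : ℂ) * inner ℂ (y : H) (y : H)).re at h
  rw [h3, ← hT.inner_symm, ← sq] at h
  simpa only [Complex.sub_re, Complex.re_ofReal_mul, h2] using h

/-- A sequence along which the quadratic form of a semibounded operator tends to its lower bound
can only converge to an eigenvector. -/
lemma mem_closure_graph_of_minimizing [CompleteSpace H] {T : H →ₗ.[ℂ] H}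
    (hT : IsEssentiallySelfAdjoint T) {E : ℝ}
    (hE : ∀ φ : T.domain, E * ‖(φ : H)‖ ^ 2 ≤ (inner ℂ (φ : H) (T φ)).re)
    {u : ℕ → T.domain} {ψ : H}
    (hu : Filter.Tendsto (fun n => (u n : H)) Filter.atTop (nhds ψ))
    (hq : Filter.Tendsto (fun n => (inner ℂ (u n : H) (T (u n))).re - E * ‖(u n : H)‖ ^ 2)
      Filter.atTop (nhds 0)) :
    (ψ, (E : ℂ) • ψ) ∈ T.closure.graph := by
  rw [hT.mem_closure_graph_iff]
  intro a b hab
  obtain ⟨x, hx1, hx2⟩ := (LinearPMap.mem_graph_iff _).1 hab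
  simp only at hx1 hx2
  subst hx1 hx2
  -- By Cauchy–Schwarz the pairing of a fixed `x` with `u n` in the form of `T - E` is controlled by
  -- the excess energy of `u n`. In the limit `ψ` solves the eigenvalue equation weakly, which is
  -- enough because the closure of `T` is its adjoint.
  have h1 : Filter.Tendsto (fun n => ‖inner ℂ (T x) (u n : H) -
      (E : ℂ) * inner ℂ (x : H) (u n : H)‖ ^ 2) Filter.atTop (nhds 0) := by
    refine squeeze_zero (fun n => by positivity) (fun n => norm_inner_sub_sq_le hT hE x (u n)) ?_
    simpa using hq.const_mul ((inner ℂ (x : H) (T x)).re - E * ‖(x : H)‖ ^ 2)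
  have h2 : Filter.Tendsto (fun n => ‖inner ℂ (T x) (u n : H) -
      (E : ℂ) * inner ℂ (x : H) (u n : H)‖ ^ 2) Filter.atTop
      (nhds (‖inner ℂ (T x) ψ - (E : ℂ) * inner ℂ (x : H) ψ‖ ^ 2)) :=
    (((tendsto_const_nhds.inner hu).sub
      ((tendsto_const_nhds.inner hu).const_mul _)).norm.pow 2)
  have h3 := tendsto_nhds_unique h2 h1
  simp only [ne_eq, OfNat.ofNat_ne_zero, not_false_eq_true, pow_eq_zero_iff, norm_eq_zero,
    sub_eq_zero] at h3
  simp only [inner_smul_right, h3]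

end Operators

/-! ### Linear algebra of the Jacobi coordinates -/

/-- The coefficient of the `j`-th Jacobi vector in the relative position of the body `i`. -/
def relCoeff {N : ℕ} (m : Fin (N + 1) → ℝ) (i : Fin (N + 1)) (j : Fin N) : ℝ :=
  if j.succ < i then √(m j.succ / (cumMass m j.castSucc * cumMass m j.succ))
  else if j.succ = i then √(cumMass m j.succ / (m j.succ * cumMass m j.castSucc))
  else 0

section LinearAlgebra

variable {N d : ℕ} {m : Fin (N + 1) → ℝ}

lemma cumMass_succ (m : Fin (N + 1) → ℝ) (j : Fin N) :
    cumMass m j.succ = m j.succ + cumMass m j.castSucc := by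
  have h1 : Finset.Iic j.succ = insert j.succ (Finset.Iic j.castSucc) := by
    ext k
    simp only [Finset.mem_Iic, Finset.mem_insert, Fin.le_def, Fin.ext_iff, Fin.val_succ,
      Fin.val_castSucc]
    omega
  rw [cumMass, h1, Finset.sum_insert (by simp [Fin.le_def]), cumMass]

lemma cumMass_zero (m : Fin (N + 1) → ℝ) : cumMass m 0 = m 0 := by
  have e : Finset.Iic (0 : Fin (N + 1)) = {0} := by ext k; simp
  simp [cumMass, e]

lemma relCoeff_zero (m : Fin (N + 1) → ℝ) (j : Fin N) : relCoeff m 0 j = 0 := by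
  simp [relCoeff, (Fin.succ_ne_zero j)]

/-- The sum telescopes. Below `i` the product of coefficients is `m_{j+1} / (M_j M_{j+1}) = 1 / M_j
- 1 / M_{j+1}`. At `j + 1 = i` it is `1 / M_j`, with an additional `1 / m_i` when `i = k`. Beyond
`i` the coefficients vanish, which the minimum with `i` in `key` encodes. -/
lemma sum_relCoeff_mul_of_le (hm : ∀ i, 0 < m i) {i k : Fin (N + 1)} (h0 : i ≠ 0) (hik : i ≤ k) :
    ∑ j, relCoeff m i j * relCoeff m k j = (if i = k then 1 / m i else 0) + 1 / m 0 := by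
  set g : Fin (N + 1) → ℝ := Function.update (fun l => -(1 / cumMass m l)) i
    (if i = k then 1 / m i else 0) with hg
  have key : ∀ j : Fin N, relCoeff m i j * relCoeff m k j =
      g (min j.succ i) - g (min j.castSucc i) := by
    intro j
    have p0 := hm j.succ
    have p1 := cumMass_pos hm j.castSucc
    have p2 := cumMass_pos hm j.succ
    have hs := cumMass_succ m j
    have hlt : j.castSucc < j.succ := Fin.castSucc_lt_succ
    rcases lt_trichotomy j.succ i with h | h | h
    · rw [min_eq_left h.le, min_eq_left (hlt.trans h).le, hg, Function.update_of_ne h.ne,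
        Function.update_of_ne (hlt.trans h).ne, relCoeff, relCoeff, if_pos h,
        if_pos (h.trans_le hik), Real.mul_self_sqrt (by positivity)]
      field_simp
      linarith
    · subst h
      rw [min_self, min_eq_left hlt.le, hg, Function.update_self, Function.update_of_ne hlt.ne,
        relCoeff, if_neg (lt_irrefl _), if_pos rfl]
      rcases hik.lt_or_eq with h | h
      · rw [relCoeff, if_pos h, if_neg h.ne, ← Real.sqrt_mul (by positivity),
          Real.sqrt_eq_iff_mul_self_eq (by positivity) (by simp; positivity)]
        field_simp
        ring
      · subst h
        rw [relCoeff, if_neg (lt_irrefl _), if_pos rfl, if_pos rfl,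
          Real.mul_self_sqrt (by positivity)]
        field_simp
        linarith
    · have h4 : i ≤ j.castSucc := by
        simp only [Fin.lt_def, Fin.le_def, Fin.val_succ, Fin.val_castSucc] at h ⊢
        omega
      rw [min_eq_right h.le, min_eq_right h4, relCoeff, if_neg h.not_gt, if_neg h.ne']
      simp
  rw [Finset.sum_congr rfl fun j _ => key j, fin_telescope (fun l => g (min l i)),
    min_eq_right (Fin.le_last i), min_eq_left (Fin.zero_le i), hg, Function.update_self,
    Function.update_of_ne h0.symm, cumMass_zero]
  ring

/-- The Jacobi coordinates diagonalise the kinetic energy: the Gram matrix of the coefficients of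
the relative positions is the inverse mass matrix. -/
lemma sum_relCoeff_mul (hm : ∀ i, 0 < m i) (i k : Fin (N + 1)) :
    ∑ j, relCoeff m i j * relCoeff m k j = (if i = k then 1 / m i else 0) + 1 / m 0
      - (if i = 0 then 1 / m 0 else 0) - (if k = 0 then 1 / m 0 else 0) := by
  by_cases hi : i = 0
  · subst hi
    by_cases hk : k = 0
    · subst hk; simp [relCoeff_zero]
    · simp [relCoeff_zero, hk, Ne.symm hk]
  by_cases hk : k = 0
  · subst hk; simp [relCoeff_zero, hi]
  rw [if_neg hi, if_neg hk, sub_zero, sub_zero]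
  rcases le_total i k with h | h
  · exact sum_relCoeff_mul_of_le hm hi h
  · have h1 := sum_relCoeff_mul_of_le hm hk h
    rw [Finset.sum_congr rfl fun j _ => mul_comm (relCoeff m i j) _, h1]
    rcases eq_or_ne i k with rfl | h2
    · rfl
    · rw [if_neg h2, if_neg h2.symm]

lemma relPos_apply (m : Fin (N + 1) → ℝ) (y : RelSpace N d) (i : Fin (N + 1)) (s : Fin d) :
    relPos m y i s = ∑ j, relCoeff m i j * y (j, s) := by
  have : relPos m y i = ∑ j, relCoeff m i j • jacobiVec y j := rfl
  rw [this]
  simp [jacobiVec]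

lemma relPos_zero (m : Fin (N + 1) → ℝ) (y : RelSpace N d) : relPos m y 0 = 0 := by
  ext s
  simp [relPos_apply, relCoeff_zero]

/-- The Jacobi vectors as the rows of a matrix. -/
def toMat (y : RelSpace N d) : Matrix (Fin N) (Fin d) ℝ := Matrix.of fun j s => y (j, s)

/-- The matrix that turns Jacobi vectors into positions relative to body `0`. -/
def posMat (m : Fin (N + 1) → ℝ) : Matrix (Fin N) (Fin N) ℝ :=
  Matrix.of fun i j => relCoeff m i.succ j

lemma posMat_mul_toMat (m : Fin (N + 1) → ℝ) (y : RelSpace N d) (i : Fin N) (s : Fin d) :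
    (posMat m * toMat y) i s = relPos m y i.succ s := by
  simp [Matrix.mul_apply, posMat, toMat, relPos_apply]

/-- The position of a body involves only the Jacobi vectors up to its own, so the matrix is lower
triangular, with positive diagonal. -/
lemma det_posMat_ne_zero (hm : ∀ i, 0 < m i) : (posMat m).det ≠ 0 := by
  have h : (posMat m).BlockTriangular OrderDual.toDual := by
    intro i j hij
    have hij' : i < j := hij
    have h1 : ¬ j.succ < i.succ := by simpa using hij'.le
    have h2 : ¬ j.succ = i.succ := by simpa using hij'.ne'
    rw [posMat, Matrix.of_apply, relCoeff, if_neg h1, if_neg h2]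
  rw [Matrix.det_of_isLowerTriangular _ h]
  refine Finset.prod_ne_zero_iff.2 fun i _ => ?_
  have p0 := hm i.succ
  have p1 := cumMass_pos hm i.castSucc
  have p2 := cumMass_pos hm i.succ
  simp only [posMat, relCoeff, Matrix.of_apply, lt_self_iff_false, if_false, if_true]
  positivity

lemma coord_self (ρ : Pair N → ℝ) (i : Fin (N + 1)) : coord ρ i i = 0 := by simp [coord]

lemma coord_pair (ρ : Pair N → ℝ) (p : Pair N) : coord ρ p.1.1 p.1.2 = ρ p := by
  simp [coord, p.2]

lemma coord_sqDistances (m : Fin (N + 1) → ℝ) (y : RelSpace N d) (i j : Fin (N + 1)) :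
    coord (sqDistances m y) i j = dist (relPos m y i) (relPos m y j) ^ 2 := by
  rcases lt_trichotomy i j with h | h | h
  · simp [coord, h, sqDistances, distances]
  · subst h; simp [coord_self]
  · simp [coord, h, h.not_gt, sqDistances, distances, dist_comm]

lemma gram_sqDistances_apply (m : Fin (N + 1) → ℝ) (y : RelSpace N d) (i j : Fin N) :
    gram (sqDistances m y) i j = inner ℝ (relPos m y i.succ) (relPos m y j.succ) := by
  simp only [gram, Matrix.of_apply, coord_sqDistances, relPos_zero, dist_zero_left]
  rw [dist_eq_norm]
  rw [real_inner_eq_norm_mul_self_add_norm_mul_self_sub_norm_sub_mul_self_div_two]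
  ring

lemma gram_sqDistances (m : Fin (N + 1) → ℝ) (y : RelSpace N d) :
    gram (sqDistances m y) = (posMat m * toMat y) * (posMat m * toMat y).transpose := by
  ext i j
  rw [gram_sqDistances_apply, Matrix.mul_apply]
  simp only [Matrix.transpose_apply, posMat_mul_toMat, PiLp.inner_apply, RCLike.inner_apply,
    conj_trivial]
  exact Finset.sum_congr rfl fun _ _ => mul_comm _ _

/-- A Gram matrix of relative positions, bordered by zeros for the body `0`. -/
def border (G : Matrix (Fin N) (Fin N) ℝ) (i j : Fin (N + 1)) : ℝ :=
  Fin.cases 0 (fun a => Fin.cases 0 (fun b => G a b) j) i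

/-- The squared distances of a configuration in terms of the Gram matrix of relative positions. -/
def ungram : Matrix (Fin N) (Fin N) ℝ →ₗ[ℝ] (Pair N → ℝ) where
  toFun G p := border G p.1.1 p.1.1 + border G p.1.2 p.1.2 - 2 * border G p.1.1 p.1.2
  map_add' G G' := by
    have h : ∀ i j, border (G + G') i j = border G i j + border G' i j := by
      intro i j
      cases i using Fin.cases <;> cases j using Fin.cases <;> simp [border]
    ext p
    simp only [h, Pi.add_apply]
    ring
  map_smul' c G := by
    have h : ∀ i j, border (c • G) i j = c * border G i j := by
      intro i j
      cases i using Fin.cases <;> cases j using Fin.cases <;> simp [border]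
    ext p
    simp only [h, Pi.smul_apply, smul_eq_mul, RingHom.id_apply]
    ring

lemma coord_ungram {G : Matrix (Fin N) (Fin N) ℝ} (hG : G.transpose = G) (i j : Fin (N + 1)) :
    coord (ungram G) i j = border G i i + border G j j - 2 * border G i j := by
  have hs : ∀ i j, border G i j = border G j i := by
    intro i j
    cases i using Fin.cases <;> cases j using Fin.cases <;> simp [border]
    exact congrFun (congrFun hG _) _
  rcases lt_trichotomy i j with h | h | h
  · simp [coord, h, ungram]
  · subst h; rw [coord_self]; ring
  · simp only [coord, h, h.not_gt, ungram, dif_neg, dif_pos, not_false_eq_true, LinearMap.coe_mk,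
      AddHom.coe_mk, hs i j]
    ring

/-- Together with `ungram_gram` this makes squared distances linear coordinates on the symmetric
matrices, on which a matrix `W` acts by `G ↦ W G Wᵀ`. -/
lemma gram_ungram {G : Matrix (Fin N) (Fin N) ℝ} (hG : G.transpose = G) :
    gram (ungram G) = G := by
  ext i j
  simp only [gram, Matrix.of_apply, coord_ungram hG]
  simp only [border, Fin.cases_zero, Fin.cases_succ]
  ring

lemma ungram_gram (ρ : Pair N → ℝ) : ungram (gram ρ) = ρ := by
  have h : ∀ i j, border (gram ρ) i j = (coord ρ 0 i + coord ρ 0 j - coord ρ i j) / 2 := by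
    intro i j
    cases i using Fin.cases with
    | zero => cases j using Fin.cases <;> simp [border, coord_self]
    | succ a =>
      cases j using Fin.cases with
      | zero => simp [border, coord_self, coord_comm ρ a.succ 0]
      | succ b => simp [border, gram]
  ext p
  simp only [ungram, LinearMap.coe_mk, AddHom.coe_mk, h, coord_self, coord_pair]
  ring

lemma gram_transpose (ρ : Pair N → ℝ) : (gram ρ).transpose = gram ρ := by
  have := gram_isHermitian ρ
  rwa [Matrix.IsHermitian, Matrix.conjTranspose_eq_transpose_of_trivial] at this

lemma gram_injective : Function.Injective (gram : (Pair N → ℝ) → _) :=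
  Function.LeftInverse.injective ungram_gram

lemma gram_add (ρ σ : Pair N → ℝ) : gram (ρ + σ) = gram ρ + gram σ := by
  have h : ∀ i j, coord (ρ + σ) i j = coord ρ i j + coord σ i j := by
    intro i j; unfold coord; split_ifs <;> simp
  ext i j; simp only [gram, Matrix.of_apply, h, Matrix.add_apply]; ring

lemma gram_smul (c : ℝ) (ρ : Pair N → ℝ) : gram (c • ρ) = c • gram ρ := by
  have h : ∀ i j, coord (c • ρ) i j = c * coord ρ i j := by
    intro i j; unfold coord; split_ifs <;> simp
  ext i j; simp only [gram, Matrix.of_apply, h, Matrix.smul_apply, smul_eq_mul]; ring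

lemma sqDistances_eq_ungram (m : Fin (N + 1) → ℝ) (y : RelSpace N d) :
    sqDistances m y = ungram ((posMat m * toMat y) * (posMat m * toMat y).transpose) := by
  rw [← gram_sqDistances, ungram_gram]

lemma sqrt_sqDistances (m : Fin (N + 1) → ℝ) (y : RelSpace N d) :
    (fun p => √(sqDistances m y p)) = distances m y := by
  funext p
  exact Real.sqrt_sq dist_nonneg

/-! ### Rotations -/

lemma toMat_rotate (A : Matrix (Fin d) (Fin d) ℝ) (y : RelSpace N d) :
    toMat (rotate A y) = toMat y * A.transpose := by
  ext j s
  simp only [toMat, rotate, Matrix.of_apply, Matrix.mul_apply, Matrix.mulVec, dotProduct,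
    Matrix.transpose_apply]
  exact Finset.sum_congr rfl fun _ _ => mul_comm _ _

lemma toMat_injective : Function.Injective (toMat : RelSpace N d → _) := by
  intro y z h
  ext p
  exact congrFun (congrFun h p.1) p.2

lemma rotate_mul (A B : Matrix (Fin d) (Fin d) ℝ) (y : RelSpace N d) :
    rotate (A * B) y = rotate A (rotate B y) := by
  apply toMat_injective
  simp [toMat_rotate, Matrix.transpose_mul, Matrix.mul_assoc]

lemma rotate_one (y : RelSpace N d) : rotate 1 y = y := by
  apply toMat_injective
  simp [toMat_rotate]

lemma transpose_mul_self_of_mem_orthogonalGroup {A : Matrix (Fin d) (Fin d) ℝ}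
    (hA : A ∈ Matrix.orthogonalGroup (Fin d) ℝ) : A.transpose * A = 1 := by
  simpa using (Matrix.mem_orthogonalGroup_iff' (Fin d) ℝ).1 hA

lemma sqDistances_rotate (m : Fin (N + 1) → ℝ) {A : Matrix (Fin d) (Fin d) ℝ}
    (hA : A ∈ Matrix.orthogonalGroup (Fin d) ℝ) (y : RelSpace N d) :
    sqDistances m (rotate A y) = sqDistances m y := by
  rw [sqDistances_eq_ungram, sqDistances_eq_ungram, toMat_rotate, ← Matrix.mul_assoc,
    Matrix.transpose_mul _ A.transpose, Matrix.transpose_transpose, Matrix.mul_assoc _ A.transpose,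
    ← Matrix.mul_assoc A.transpose, transpose_mul_self_of_mem_orthogonalGroup hA, Matrix.one_mul]

lemma distances_rotate (m : Fin (N + 1) → ℝ) {A : Matrix (Fin d) (Fin d) ℝ}
    (hA : A ∈ Matrix.orthogonalGroup (Fin d) ℝ) (y : RelSpace N d) :
    distances m (rotate A y) = distances m y := by
  rw [← sqrt_sqDistances, ← sqrt_sqDistances, sqDistances_rotate m hA]

end LinearAlgebra

/-- Two families of vectors with the same Gram matrix differ by a linear isometry. -/
lemma exists_linearIsometry_of_inner_eq {ι E : Type*} [Fintype ι] [NormedAddCommGroup E]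
    [InnerProductSpace ℝ E] [FiniteDimensional ℝ E] (x x' : ι → E)
    (h : ∀ i j, inner ℝ (x i) (x j) = inner ℝ (x' i) (x' j)) :
    ∃ L : E →ₗᵢ[ℝ] E, ∀ i, L (x i) = x' i := by
  classical
  set S := Fintype.linearCombination ℝ x with hS
  set S' := Fintype.linearCombination ℝ x' with hS'
  have hn : ∀ a, ‖S' a‖ = ‖S a‖ := by
    intro a
    have : ‖S' a‖ ^ 2 = ‖S a‖ ^ 2 := by
      rw [← real_inner_self_eq_norm_sq, ← real_inner_self_eq_norm_sq, hS, hS']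
      simp only [Fintype.linearCombination_apply, sum_inner, inner_sum, inner_smul_left,
        inner_smul_right, h]
    exact (pow_left_inj₀ (norm_nonneg _) (norm_nonneg _) two_ne_zero).1 this
  -- The Gram matrix determines the norm of every linear combination, so linear relations among the
  -- `x i` hold among the `x' i` as well. The assignment `x i ↦ x' i` is therefore a well-defined
  -- isometry on the span, and extends to the whole space by finite dimension.
  have hker : LinearMap.ker S ≤ LinearMap.ker S' := by
    intro a ha
    rw [LinearMap.mem_ker] at ha ⊢
    rw [← norm_eq_zero, hn, ha, norm_zero]
  let f : LinearMap.range S →ₗ[ℝ] E :=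
    ((LinearMap.ker S).liftQ S' hker) ∘ₗ S.quotKerEquivRange.symm.toLinearMap
  have hf : ∀ a, f ⟨S a, LinearMap.mem_range_self S a⟩ = S' a := by
    intro a
    simp [f, LinearMap.quotKerEquivRange_symm_apply_image]
  let fi : LinearMap.range S →ₗᵢ[ℝ] E :=
    { toLinearMap := f
      norm_map' := by
        rintro ⟨_, a, rfl⟩
        rw [hf, hn]; rfl }
  refine ⟨fi.extend, fun i => ?_⟩
  have h1 : S (Pi.single i 1) = x i := by simp [hS, Fintype.linearCombination_apply_single]
  have h2 : S' (Pi.single i 1) = x' i := by simp [hS', Fintype.linearCombination_apply_single]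
  rw [← h1, ← h2, ← hf]
  exact LinearIsometry.extend_apply fi ⟨S (Pi.single i 1), LinearMap.mem_range_self S _⟩

lemma exists_mem_orthogonalGroup_of_linearIsometry {d : ℕ}
    (L : EuclideanSpace ℝ (Fin d) →ₗᵢ[ℝ] EuclideanSpace ℝ (Fin d)) :
    ∃ A ∈ Matrix.orthogonalGroup (Fin d) ℝ, ∀ v, L v = WithLp.toLp 2 (A.mulVec v) := by
  set A := Matrix.of fun s t => L (EuclideanSpace.single t 1) s with hA
  have hv : ∀ v, L v = WithLp.toLp 2 (A.mulVec v) := by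
    intro v
    have h1 : v = ∑ t, v t • EuclideanSpace.single t (1 : ℝ) := by
      ext s
      simp [Finset.sum_apply, Pi.single_apply]
    conv_lhs => rw [h1]
    rw [map_sum]
    ext s
    simp [hA, Matrix.mulVec, dotProduct, mul_comm]
  refine ⟨A, ?_, hv⟩
  rw [Matrix.mem_orthogonalGroup_iff']
  ext s t
  have h1 := L.inner_map_map (EuclideanSpace.single s 1) (EuclideanSpace.single t 1)
  rw [PiLp.inner_apply] at h1
  simp only [Matrix.mul_apply, Matrix.transpose_apply, hA, Matrix.of_apply, Matrix.one_apply]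
  simp only [RCLike.inner_apply, conj_trivial, EuclideanSpace.inner_single_left, one_mul,
    map_one] at h1
  rw [Finset.sum_congr rfl fun _ _ => mul_comm _ _, h1]
  simp

/-- The relative distances determine the configuration up to an orthogonal transformation. -/
lemma exists_rotate_eq {N d : ℕ} {m : Fin (N + 1) → ℝ} (hm : ∀ i, 0 < m i) {y z : RelSpace N d}
    (h : sqDistances m y = sqDistances m z) :
    ∃ A ∈ Matrix.orthogonalGroup (Fin d) ℝ, rotate A y = z := by
  obtain ⟨L, hL⟩ := exists_linearIsometry_of_inner_eq (fun i : Fin N => relPos m y i.succ)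
    (fun i : Fin N => relPos m z i.succ) (fun i j => by
      rw [← gram_sqDistances_apply, ← gram_sqDistances_apply, h])
  obtain ⟨A, hA, hv⟩ := exists_mem_orthogonalGroup_of_linearIsometry L
  refine ⟨A, hA, toMat_injective ?_⟩
  have h1 : posMat m * toMat (rotate A y) = posMat m * toMat z := by
    rw [toMat_rotate, ← Matrix.mul_assoc]
    ext i s
    rw [posMat_mul_toMat, ← hL i, hv]
    simp only [Matrix.mul_apply (M := posMat m * toMat y), posMat_mul_toMat, Matrix.mulVec,
      dotProduct, Matrix.transpose_apply]
    exact Finset.sum_congr rfl fun _ _ => mul_comm _ _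
  have h2 := congrArg (fun X => (posMat m)⁻¹ * X) h1
  simpa only [← Matrix.mul_assoc, Matrix.nonsing_inv_mul _
    (isUnit_iff_ne_zero.2 (det_posMat_ne_zero hm)), Matrix.one_mul] using h2

/-! ### Jacobian determinants of matrix actions -/

section Multiplicative

variable {n : Type*} [Fintype n] [DecidableEq n]

lemma monoidHom_ne_zero (J : Matrix n n ℝ →* ℝ) {A : Matrix n n ℝ} (hA : A.det ≠ 0) :
    J A ≠ 0 := by
  have h : J A * J A⁻¹ = 1 := by
    rw [← map_mul, Matrix.mul_nonsing_inv _ (isUnit_iff_ne_zero.2 hA), map_one]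
  exact left_ne_zero_of_mul_eq_one h

/-- Conjugation by a diagonal matrix with a single entry `2` doubles the parameter of the
transvection, that is, squares it. So `J` takes equal values on the transvection and on its square,
and the value, being nonzero, is `1`. -/
lemma monoidHom_transvection (J : Matrix n n ℝ →* ℝ) {i j : n} (hij : i ≠ j) (c : ℝ) :
    J (Matrix.transvection i j c) = 1 := by
  set D : Matrix n n ℝ := Matrix.diagonal fun k => if k = i then 2 else 1 with hD
  have hD0 : J D ≠ 0 := by
    refine monoidHom_ne_zero J ?_
    rw [hD, Matrix.det_diagonal]
    exact Finset.prod_ne_zero_iff.2 fun k _ => by split_ifs <;> norm_num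
  have h1 : D * Matrix.transvection i j c = Matrix.transvection i j (c + c) * D := by
    ext a b
    simp only [hD, Matrix.transvection, Matrix.add_apply, Matrix.diagonal_mul,
      Matrix.mul_diagonal, Matrix.single_apply, Matrix.one_apply]
    grind
  rw [← Matrix.transvection_mul_transvection_same _ _ hij] at h1
  have h2 := congrArg J h1
  simp only [map_mul] at h2
  have h3 : J (Matrix.transvection i j c) ≠ 0 := by
    refine monoidHom_ne_zero J ?_
    simp [Matrix.det_transvection_of_ne _ _ hij]
  have h4 : J D * J (Matrix.transvection i j c) * (J (Matrix.transvection i j c) - 1) = 0 := by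
    linear_combination -h2
  rcases mul_eq_zero.1 h4 with h5 | h5
  · exact absurd h5 (mul_ne_zero hD0 h3)
  · linarith

/-- Relabelling the basis is conjugation by a permutation matrix, which a homomorphism to a
commutative monoid does not see. -/
lemma monoidHom_submatrix (J : Matrix n n ℝ →* ℝ) (σ : n ≃ n) (A : Matrix n n ℝ) :
    J (A.submatrix σ σ) = J A := by
  set P := (1 : Matrix n n ℝ).submatrix σ id
  set Q := (1 : Matrix n n ℝ).submatrix id σ
  have h1 : P * A * Q = A.submatrix σ σ := by
    have e1 : P * A = A.submatrix σ id := by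
      have := Matrix.submatrix_mul_equiv (1 : Matrix n n ℝ) A σ (Equiv.refl n) id
      simpa using this
    have e2 : A.submatrix σ id * Q = A.submatrix σ σ := by
      have := Matrix.submatrix_mul_equiv A (1 : Matrix n n ℝ) σ (Equiv.refl n) σ
      simpa using this
    rw [e1, e2]
  have h2 : Q * P = 1 := by
    refine (Matrix.submatrix_mul_equiv (1 : Matrix n n ℝ) (1 : Matrix n n ℝ) id σ id).trans ?_
    rw [Matrix.one_mul, Matrix.submatrix_id_id]
  have h3 : J Q * J P = 1 := by rw [← map_mul, h2, map_one]
  rw [← h1, map_mul, map_mul]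
  linear_combination J A * h3

/-- A nonnegative multiplicative function of matrices is a power of the determinant, and the
exponent is read off from the multiples of the identity. -/
lemma monoidHom_eq_det_pow [Nonempty n] (J : Matrix n n ℝ →* ℝ) (hJ : ∀ A, 0 ≤ J A) {k : ℕ}
    (hs : ∀ t : ℝ, J (t • 1) = |t| ^ (k * Fintype.card n)) {A : Matrix n n ℝ} (hA : A.det ≠ 0) :
    J A = |A.det| ^ k := by
  set δ : n → ℝ → ℝ := fun i b => J (Matrix.diagonal (Pi.mulSingle i b)) with hδ
  have hprod : ∀ b : n → ℝ, J (Matrix.diagonal b) = ∏ i, δ i (b i) := by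
    intro b
    have h := map_prod (J.comp (Matrix.diagonalRingHom n ℝ : (n → ℝ) →* Matrix n n ℝ))
      (fun i => Pi.mulSingle i (b i)) Finset.univ
    rw [Finset.univ_prod_mulSingle] at h
    exact h
  have hsame : ∀ i j b, δ i b = δ j b := by
    intro i j b
    have h := monoidHom_submatrix J (Equiv.swap i j) (Matrix.diagonal (Pi.mulSingle i b))
    rw [Matrix.submatrix_diagonal_equiv] at h
    have e : (Pi.mulSingle i b : n → ℝ) ∘ Equiv.swap i j = Pi.mulSingle j b := by
      funext k
      simp only [Function.comp_apply, Pi.mulSingle_apply, Equiv.swap_apply_eq_iff,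
        Equiv.swap_apply_left]
    rw [e] at h
    exact h.symm
  -- All diagonal slots contribute equally, so `J (b • 1)` is a power of one factor with exponent
  -- the number of slots. Nonnegativity makes the root unique.
  have hpow : ∀ i b, δ i b = |b| ^ k := by
    intro i b
    have h := hs b
    rw [← Matrix.diagonal_one, ← Matrix.diagonal_smul, hprod] at h
    simp only [Pi.smul_apply, smul_eq_mul, mul_one] at h
    rw [Finset.prod_congr rfl fun j _ => hsame j i b, Finset.prod_const, Finset.card_univ,
      pow_mul] at h
    exact (pow_left_inj₀ (hJ _) (by positivity) Fintype.card_ne_zero).1 h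
  refine Matrix.diagonal_transvection_induction_of_det_ne_zero
    (fun A => J A = |A.det| ^ k) A hA ?_ ?_ ?_
  · intro D _
    rw [hprod, Matrix.det_diagonal, Finset.abs_prod, ← Finset.prod_pow]
    exact Finset.prod_congr rfl fun i _ => hpow i _
  · intro t
    rw [Matrix.TransvectionStruct.det, abs_one, one_pow]
    exact monoidHom_transvection J t.hij t.c
  · intro B C _ _ hB hC
    rw [map_mul, hB, hC, Matrix.det_mul, abs_mul, mul_pow]

end Multiplicative

/-- A multiplicative family of linear maps scales Lebesgue measure by a power of the
determinant. -/
lemma lintegral_comp_of_monoidHom {n E : Type*} [Fintype n] [DecidableEq n] [Nonempty n]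
    [NormedAddCommGroup E] [NormedSpace ℝ E] [MeasurableSpace E] [BorelSpace E]
    [FiniteDimensional ℝ E] (μ : Measure E) [μ.IsAddHaarMeasure]
    (L : Matrix n n ℝ →* (E →ₗ[ℝ] E)) {a k : ℕ} (hL : ∀ t : ℝ, L (t • 1) = t ^ a • LinearMap.id)
    (hk : a * Module.finrank ℝ E = k * Fintype.card n) {A : Matrix n n ℝ} (hA : A.det ≠ 0)
    {f : E → ENNReal} (hf : Measurable f) :
    ENNReal.ofReal |A.det| ^ k * ∫⁻ x, f (L A x) ∂μ = ∫⁻ x, f x ∂μ := by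
  set J : Matrix n n ℝ →* ℝ := (absHom : ℝ →*₀ ℝ).toMonoidHom.comp (LinearMap.det.comp L) with hJ
  have hJA : ∀ B, J B = |LinearMap.det (L B)| := fun B => rfl
  -- The matrix `t • 1` acts as `t ^ a`, whose determinant is `t ^ (a * dim E)`; `hk` identifies
  -- this exponent with that of `det (t • 1) ^ k`.
  have hdet : |LinearMap.det (L A)| = |A.det| ^ k := by
    rw [← hJA]
    refine monoidHom_eq_det_pow J (fun B => by rw [hJA]; positivity) (fun t => ?_) hA
    rw [hJA, hL, LinearMap.det_smul, LinearMap.det_id, mul_one, abs_pow, abs_pow, ← pow_mul, hk]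
  have h0 : LinearMap.det (L A) ≠ 0 := by
    rw [← abs_pos, hdet]; positivity
  have hm : Measurable (L A) := (LinearMap.continuous_of_finiteDimensional (L A)).measurable
  rw [← lintegral_map hf hm, Measure.map_linearMap_addHaar_eq_smul_addHaar μ h0,
    lintegral_smul_measure, smul_eq_mul, ← mul_assoc, abs_inv, hdet,
    ← ENNReal.ofReal_pow (abs_nonneg _), ← ENNReal.ofReal_mul (by positivity),
    mul_inv_cancel₀ (by positivity), ENNReal.ofReal_one, one_mul]

section Actions

variable {N d : ℕ}

/-- Multiplication of the matrix of Jacobi vectors by a matrix from the left. -/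
def leftMul : Matrix (Fin N) (Fin N) ℝ →* (RelSpace N d →ₗ[ℝ] RelSpace N d) where
  toFun W :=
    { toFun y := WithLp.toLp 2 fun p => (W * toMat y) p.1 p.2
      map_add' y z := by
        ext p
        simp [toMat, Matrix.mul_apply, mul_add, Finset.sum_add_distrib]
      map_smul' c y := by
        ext p
        simp [toMat, Matrix.mul_apply, Finset.mul_sum, mul_left_comm] }
  map_one' := by ext y p; simp [toMat]
  map_mul' W W' := by
    ext y p
    simp only [LinearMap.coe_mk, AddHom.coe_mk, Module.End.mul_apply, Matrix.mul_assoc]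
    rfl

lemma toMat_leftMul (W : Matrix (Fin N) (Fin N) ℝ) (y : RelSpace N d) :
    toMat (leftMul W y) = W * toMat y := rfl

/-- The action of matrices on each Jacobi vector, as a linear map. -/
def rotateHom : Matrix (Fin d) (Fin d) ℝ →* (RelSpace N d →ₗ[ℝ] RelSpace N d) where
  toFun A :=
    { toFun := rotate A
      map_add' y z := by
        ext p
        simp [rotate, Matrix.mulVec, dotProduct, mul_add, Finset.sum_add_distrib]
      map_smul' c y := by
        ext p
        simp [rotate, Matrix.mulVec, dotProduct, Finset.mul_sum, mul_left_comm] }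
  map_one' := LinearMap.ext rotate_one
  map_mul' A B := LinearMap.ext (rotate_mul A B)

/-- The action of linear transformations of the simplex on the squared edge lengths. -/
def congrHom : Matrix (Fin N) (Fin N) ℝ →* ((Pair N → ℝ) →ₗ[ℝ] (Pair N → ℝ)) where
  toFun W :=
    { toFun ρ := ungram (W * gram ρ * W.transpose)
      map_add' ρ σ := by rw [gram_add, mul_add, add_mul, map_add]
      map_smul' c ρ := by
        rw [gram_smul, Matrix.mul_smul, Matrix.smul_mul, map_smul, RingHom.id_apply] }
  map_one' := LinearMap.ext fun ρ => by simp [ungram_gram]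
  map_mul' W W' := LinearMap.ext fun ρ => by
    simp only [LinearMap.coe_mk, AddHom.coe_mk, Module.End.mul_apply]
    rw [gram_ungram]
    · simp only [Matrix.transpose_mul, Matrix.mul_assoc]
    · simp only [Matrix.transpose_mul, Matrix.transpose_transpose, gram_transpose,
        Matrix.mul_assoc]

lemma gram_congrHom (W : Matrix (Fin N) (Fin N) ℝ) (ρ : Pair N → ℝ) :
    gram (congrHom W ρ) = W * gram ρ * W.transpose := by
  refine gram_ungram ?_
  simp only [Matrix.transpose_mul, Matrix.transpose_transpose, gram_transpose, Matrix.mul_assoc]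

lemma congrHom_ungram (W : Matrix (Fin N) (Fin N) ℝ) {G : Matrix (Fin N) (Fin N) ℝ}
    (hG : G.transpose = G) : congrHom W (ungram G) = ungram (W * G * W.transpose) := by
  change ungram (W * gram (ungram G) * W.transpose) = _
  rw [gram_ungram hG]

lemma card_pair (N : ℕ) : Fintype.card (Pair N) * 2 = (N + 1) * N := by
  have e : Pair N ≃ (Σ j : Fin (N + 1), {i : Fin (N + 1) // i < j}) :=
    { toFun p := ⟨p.1.2, ⟨p.1.1, p.2⟩⟩
      invFun q := ⟨(q.2.1, q.1), q.2.2⟩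
      left_inv p := rfl
      right_inv q := rfl }
  have h : ∀ j : Fin (N + 1), Fintype.card {i : Fin (N + 1) // i < j} = j := by
    intro j
    rw [Fintype.card_subtype]
    have : Finset.univ.filter (fun i => i < j) = Finset.Iio j := by ext; simp
    rw [this, Fin.card_Iio]
  rw [Fintype.card_congr e, Fintype.card_sigma, Finset.sum_congr rfl fun j _ => h j,
    Fin.sum_univ_eq_sum_range (fun i => i), Finset.sum_range_id_mul_two]
  rfl

lemma lintegral_leftMul [NeZero N] {W : Matrix (Fin N) (Fin N) ℝ} (hW : W.det ≠ 0)
    {f : RelSpace N d → ENNReal} (hf : Measurable f) :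
    ENNReal.ofReal |W.det| ^ d * ∫⁻ y, f (leftMul W y) = ∫⁻ y, f y := by
  refine lintegral_comp_of_monoidHom volume leftMul (a := 1) (fun t => ?_) ?_ hW hf
  · ext y p
    simp [leftMul, toMat]
  · simp [mul_comm]

lemma lintegral_rotate [NeZero d] {A : Matrix (Fin d) (Fin d) ℝ} (hA : A.det ≠ 0)
    {f : RelSpace N d → ENNReal} (hf : Measurable f) :
    ENNReal.ofReal |A.det| ^ N * ∫⁻ y, f (rotate A y) = ∫⁻ y, f y := by
  refine lintegral_comp_of_monoidHom volume rotateHom (a := 1) (fun t => ?_) ?_ hA hf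
  · ext y p
    simp [rotateHom, rotate, Matrix.smul_mulVec]
  · simp

/-- The exponent: `t • 1` acts by `t ^ 2` on a space of dimension `N (N + 1) / 2`, with determinant
`t ^ (N (N + 1))`, which is `det (t • 1) ^ (N + 1)`. -/
lemma lintegral_congrHom [NeZero N] {W : Matrix (Fin N) (Fin N) ℝ} (hW : W.det ≠ 0)
    {f : (Pair N → ℝ) → ENNReal} (hf : Measurable f) :
    ENNReal.ofReal |W.det| ^ (N + 1) * ∫⁻ ρ, f (congrHom W ρ) = ∫⁻ ρ, f ρ := by
  refine lintegral_comp_of_monoidHom volume congrHom (a := 2) (fun t => ?_) ?_ hW hf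
  · refine LinearMap.ext fun ρ => ?_
    refine gram_injective ?_
    rw [gram_congrHom]
    simp only [LinearMap.smul_apply, LinearMap.id_apply, gram_smul]
    simp [smul_smul, sq]
  · rw [Module.finrank_fintype_fun_eq_card, Fintype.card_fin, mul_comm, card_pair]

/-! ### Degenerate configurations -/

lemma continuous_toMat : Continuous (toMat : RelSpace N d → _) :=
  continuous_matrix fun i j => by simp only [toMat, Matrix.of_apply]; fun_prop

/-- The configurations whose first `N` coordinates give a singular square matrix form a null
set. -/
lemma volume_det_submatrix_eq_zero (hd : N ≤ d) :
    volume {y : RelSpace N d | ((toMat y).submatrix id (Fin.castLE hd)).det = 0} = 0 := by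
  set B : RelSpace N d → Matrix (Fin N) (Fin N) ℝ :=
    fun y => (toMat y).submatrix id (Fin.castLE hd) with hB
  set e : RelSpace N d := WithLp.toLp 2 fun p => if p.2 = Fin.castLE hd p.1 then 1 else 0 with he
  have hBe : ∀ y (t : ℝ), B (y + t • e) = B y + t • 1 := by
    intro y t
    ext i j
    simp [hB, he, toMat, Matrix.one_apply, (Fin.castLE_injective hd).eq_iff, eq_comm]
  have hBc : Continuous B := continuous_toMat.matrix_submatrix _ _
  have hZ : MeasurableSet {q : RelSpace N d × ℝ | (B (q.1 + q.2 • e)).det = 0} := by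
    refine (isClosed_eq ?_ continuous_const).measurableSet
    exact (hBc.comp (by fun_prop)).matrix_det
  -- Along the line `y + t • e` the determinant is the characteristic polynomial of `-B y` evaluated
  -- at `t`, so each line meets the singular set in finitely many points.
  have h1 : ((volume : Measure (RelSpace N d)).prod (volume : Measure ℝ))
      {q | (B (q.1 + q.2 • e)).det = 0} = 0 := by
    rw [Measure.measure_prod_null hZ]
    refine Filter.Eventually.of_forall fun y => ?_
    have hfin : Set.Finite {t : ℝ | (B y + t • 1).det = 0} := by
      refine ((-B y).charpoly.rootSet_finite ℝ).subset fun t ht => ?_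
      rw [Polynomial.mem_rootSet_of_ne (Matrix.charpoly_monic _).ne_zero,
        Polynomial.coe_aeval_eq_eval, Matrix.eval_charpoly, sub_neg_eq_add, add_comm,
        Matrix.scalar_apply, ← Matrix.smul_one_eq_diagonal]
      exact ht
    have : Prod.mk y ⁻¹' {q : RelSpace N d × ℝ | (B (q.1 + q.2 • e)).det = 0} =
        {t : ℝ | (B y + t • 1).det = 0} := by
      ext t; simp [hBe]
    change volume (Prod.mk y ⁻¹' {q : RelSpace N d × ℝ | (B (q.1 + q.2 • e)).det = 0}) = 0
    rw [this]
    exact hfin.measure_zero _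
  have h2 : ((volume : Measure ℝ).prod (volume : Measure (RelSpace N d)))
      {q | (B (q.2 + q.1 • e)).det = 0} = 0 := by
    rw [← Measure.prod_swap, Measure.map_apply measurable_swap] at h1
    · exact h1
    · exact hZ
  -- By Fubini some translate of the singular set is null, and Lebesgue measure is translation
  -- invariant.
  obtain ⟨t, ht⟩ := (Measure.measure_ae_null_of_prod_null h2).exists
  have h3 : Prod.mk t ⁻¹' {q : ℝ × RelSpace N d | (B (q.2 + q.1 • e)).det = 0} =
      (fun y => y + t • e) ⁻¹' {y | (B y).det = 0} := rfl
  change volume (Prod.mk t ⁻¹' {q : ℝ × RelSpace N d | (B (q.2 + q.1 • e)).det = 0}) = 0 at ht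
  rwa [h3, measure_preimage_add_right] at ht

lemma posDef_mul_transpose_of_det_ne_zero (hd : N ≤ d) {C : Matrix (Fin N) (Fin N) ℝ}
    (hC : C.det ≠ 0) {y : RelSpace N d}
    (hy : ((toMat y).submatrix id (Fin.castLE hd)).det ≠ 0) :
    ((C * toMat y) * (C * toMat y).transpose).PosDef := by
  have h := Matrix.PosDef.mul_conjTranspose_self (C * toMat y) ?_
  · rwa [Matrix.conjTranspose_eq_transpose_of_trivial] at h
  · have hinj : Function.Injective fun v : Fin N → ℝ =>
        Matrix.vecMul v ((C * toMat y).submatrix id (Fin.castLE hd)) := by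
      refine Matrix.vecMul_injective_of_isUnit ?_
      rw [Matrix.isUnit_iff_isUnit_det]
      have : (C * toMat y).submatrix id (Fin.castLE hd) =
          C * (toMat y).submatrix id (Fin.castLE hd) := by
        ext; simp [Matrix.mul_apply]
      rw [this, Matrix.det_mul]
      exact (mul_ne_zero hC hy).isUnit
    intro v w hvw
    refine hinj ?_
    funext j
    exact congrFun hvw (Fin.castLE hd j)

end Actions

/-! ### The radial measure as the image of Lebesgue measure -/

section Pushforward

variable {N d : ℕ}

/-- By homogeneity positivity need only be tested on a compact set, so it persists for nearby `ρ`;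
this is what makes the region open. -/
lemma mem_region_iff_sphere (ρ : Pair N → ℝ) : ρ ∈ region N ↔
    ∀ x ∈ Metric.sphere (0 : Fin N → ℝ) 1, 0 < x ⬝ᵥ (gram ρ).mulVec x := by
  constructor
  · intro h x hx
    have hx0 : x ≠ 0 := by
      rintro rfl
      simp at hx
    simpa using (show (gram ρ).PosDef from h).dotProduct_mulVec_pos hx0
  · intro h
    refine Matrix.PosDef.of_dotProduct_mulVec_pos (gram_isHermitian ρ) fun x hx => ?_
    have hn : 0 < ‖x‖ := norm_pos_iff.2 hx
    have h1 := h (‖x‖⁻¹ • x) (by simp [norm_smul, hn.ne'])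
    rw [Matrix.mulVec_smul, dotProduct_smul, smul_dotProduct, smul_smul, smul_eq_mul] at h1
    rw [star_trivial]
    exact pos_of_mul_pos_right h1 (by positivity)

lemma region_isOpen (N : ℕ) : IsOpen (region N) := by
  rw [isOpen_iff_mem_nhds]
  intro ρ hρ
  have h := (isCompact_sphere (0 : Fin N → ℝ) 1).eventually_forall_of_forall_eventually
    (x₀ := ρ) (P := fun σ x => 0 < x ⬝ᵥ (gram σ).mulVec x) (fun x hx => by
      refine (continuous_const.continuousAt.eventually_lt (f := fun _ => (0 : ℝ)) ?_
        ((mem_region_iff_sphere ρ).1 hρ x hx))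
      refine Continuous.continuousAt ?_
      exact continuous_snd.dotProduct
        ((gram_continuous.comp continuous_fst).matrix_mulVec continuous_snd))
  filter_upwards [h] with σ hσ
  exact (mem_region_iff_sphere σ).2 hσ

lemma continuous_ungram : Continuous (ungram : Matrix (Fin N) (Fin N) ℝ → Pair N → ℝ) := by
  have h : ∀ i j, Continuous fun G : Matrix (Fin N) (Fin N) ℝ => border G i j := by
    intro i j
    cases i using Fin.cases with
    | zero => simpa [border] using continuous_const
    | succ a =>
      cases j using Fin.cases with
      | zero => simpa [border] using continuous_const
      | succ b => simpa [border] using continuous_id.matrix_elem a b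
  exact continuous_pi fun p => ((h _ _).add (h _ _)).sub (continuous_const.mul (h _ _))

/-- The squared edge lengths of the simplex whose edges at the vertex `0` are the linear
combinations of the Jacobi vectors given by the rows of `C`. -/
def shape (C : Matrix (Fin N) (Fin N) ℝ) (y : RelSpace N d) : Pair N → ℝ :=
  ungram ((C * toMat y) * (C * toMat y).transpose)

lemma continuous_shape (C : Matrix (Fin N) (Fin N) ℝ) :
    Continuous (shape C : RelSpace N d → _) := by
  have h : Continuous fun y : RelSpace N d => C * toMat y :=
    continuous_const.matrix_mul continuous_toMat
  exact continuous_ungram.comp (h.matrix_mul h.matrix_transpose)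

lemma gram_shape (C : Matrix (Fin N) (Fin N) ℝ) (y : RelSpace N d) :
    gram (shape C y) = (C * toMat y) * (C * toMat y).transpose :=
  gram_ungram (by rw [Matrix.transpose_mul, Matrix.transpose_transpose])

lemma sqDistances_eq_shape (m : Fin (N + 1) → ℝ) :
    (sqDistances m : RelSpace N d → _) = shape (posMat m) :=
  funext fun y => sqDistances_eq_ungram m y

lemma congrHom_shape (W C : Matrix (Fin N) (Fin N) ℝ) (y : RelSpace N d) :
    congrHom W (shape C y) = shape (W * C) y := by
  refine gram_injective ?_
  rw [gram_congrHom, gram_shape, gram_shape]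
  simp only [Matrix.transpose_mul, Matrix.mul_assoc]

lemma shape_leftMul (C W : Matrix (Fin N) (Fin N) ℝ) (y : RelSpace N d) :
    shape C (leftMul W y) = shape (C * W) y := by
  simp only [shape, toMat_leftMul, Matrix.mul_assoc]

/-- The homogeneity that both the image of Lebesgue measure and the radial measure have under
linear transformations of the simplex. -/
def IsRelInvariant (d : ℕ) (μ : Measure (Pair N → ℝ)) : Prop :=
  ∀ W : Matrix (Fin N) (Fin N) ℝ, W.det ≠ 0 → ∀ f : (Pair N → ℝ) → ENNReal, Measurable f →
    ENNReal.ofReal |W.det| ^ d * ∫⁻ ρ, f (congrHom W ρ) ∂μ = ∫⁻ ρ, f ρ ∂μ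

lemma measurable_congrHom (W : Matrix (Fin N) (Fin N) ℝ) : Measurable (congrHom W) :=
  (LinearMap.continuous_of_finiteDimensional (congrHom W)).measurable

/-- The action of `W` on shapes lifts to left multiplication of the Jacobi matrix by `C⁻¹ W C`,
which has the determinant of `W` and acts on each of the `d` columns. -/
lemma isRelInvariant_map_shape [NeZero N] {C : Matrix (Fin N) (Fin N) ℝ} (hC : C.det ≠ 0) :
    IsRelInvariant d (Measure.map (shape C : RelSpace N d → _) volume) := by
  intro W hW f hf
  have hm := (continuous_shape (d := d) C).measurable
  have hfW : Measurable fun ρ => f (congrHom W ρ) := hf.comp (measurable_congrHom W)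
  rw [lintegral_map hf hm, lintegral_map hfW hm]
  have hCu : IsUnit C.det := isUnit_iff_ne_zero.2 hC
  have h1 : ∀ y : RelSpace N d,
      congrHom W (shape C y) = shape C (leftMul (C⁻¹ * W * C) y) := by
    intro y
    rw [congrHom_shape, shape_leftMul, ← Matrix.mul_assoc, ← Matrix.mul_assoc,
      Matrix.mul_nonsing_inv _ hCu, Matrix.one_mul]
  have h2 : (C⁻¹ * W * C).det = W.det := by
    rw [Matrix.det_mul, Matrix.det_mul, Matrix.det_nonsing_inv, Ring.inverse_eq_inv']
    field_simp
  simp only [h1]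
  rw [← h2]
  exact lintegral_leftMul (by rwa [h2]) (hf.comp hm)

lemma congrHom_mem_region_iff {W : Matrix (Fin N) (Fin N) ℝ} (hW : W.det ≠ 0) (ρ : Pair N → ℝ) :
    congrHom W ρ ∈ region N ↔ ρ ∈ region N := by
  have hU : IsUnit W := (Matrix.isUnit_iff_isUnit_det _).2 hW.isUnit
  have h := Matrix.IsUnit.posDef_star_right_conjugate_iff hU (x := gram ρ)
  rw [Matrix.star_eq_conjTranspose, Matrix.conjTranspose_eq_transpose_of_trivial,
    ← gram_congrHom] at h
  exact h

lemma sqVol_congrHom (W : Matrix (Fin N) (Fin N) ℝ) (ρ : Pair N → ℝ) :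
    sqVol (congrHom W ρ) = W.det ^ 2 * sqVol ρ := by
  rw [sqVol, sqVol, gram_congrHom, Matrix.det_mul, Matrix.det_mul, Matrix.det_transpose]
  ring

lemma continuous_sqVol : Continuous (sqVol : (Pair N → ℝ) → ℝ) :=
  gram_continuous.matrix_det.div_const _

lemma sqVol_pos {ρ : Pair N → ℝ} (hρ : ρ ∈ region N) : 0 < sqVol ρ := by
  have h := (show (gram ρ).PosDef from hρ).det_pos
  rw [sqVol]; positivity

lemma lintegral_radMeasure (f : (Pair N → ℝ) → ENNReal) (hf : Measurable f) :
    ∫⁻ ρ, f ρ ∂(radMeasure N d) = ∫⁻ ρ, (region N).indicator (fun ρ =>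
      ENNReal.ofReal (sqVol ρ ^ (((d : ℝ) - ((N : ℝ) + 1)) / 2)) * f ρ) ρ := by
  rw [radMeasure, lintegral_withDensity_eq_lintegral_mul _ _ hf,
    lintegral_indicator (region_measurableSet N)]
  · rfl
  · exact (continuous_sqVol.measurable.pow_const _).ennreal_ofReal

/-- The exponents add up: Lebesgue measure in `ρ` contributes `N + 1`, and `V_n²` scales by `det W ^
2`, so the density contributes `d - (N + 1)`. -/
lemma isRelInvariant_radMeasure [NeZero N] : IsRelInvariant d (radMeasure N d) := by
  intro W hW f hf
  set e : ℝ := ((d : ℝ) - ((N : ℝ) + 1)) / 2 with he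
  have hW0 : 0 < |W.det| := abs_pos.2 hW
  have hmeas : Measurable fun ρ : Pair N → ℝ => ENNReal.ofReal (sqVol ρ ^ e) :=
    (continuous_sqVol.measurable.pow_const _).ennreal_ofReal
  have hfW : Measurable fun ρ => f (congrHom W ρ) := hf.comp (measurable_congrHom W)
  rw [lintegral_radMeasure _ hf, lintegral_radMeasure _ hfW,
    ← lintegral_congrHom hW (f := (region N).indicator fun ρ => ENNReal.ofReal (sqVol ρ ^ e) * f ρ)
      ((hmeas.mul hf).indicator (region_measurableSet N))]
  have h1 : ∀ ρ : Pair N → ℝ, (region N).indicator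
      (fun ρ => ENNReal.ofReal (sqVol ρ ^ e) * f ρ) (congrHom W ρ) =
      ENNReal.ofReal ((W.det ^ 2) ^ e) * (region N).indicator
      (fun ρ => ENNReal.ofReal (sqVol ρ ^ e) * f (congrHom W ρ)) ρ := by
    intro ρ
    by_cases hρ : ρ ∈ region N
    · rw [Set.indicator_of_mem ((congrHom_mem_region_iff hW ρ).2 hρ), Set.indicator_of_mem hρ,
        sqVol_congrHom, Real.mul_rpow (sq_nonneg _) (sqVol_pos hρ).le,
        ENNReal.ofReal_mul (by positivity), mul_assoc]
    · rw [Set.indicator_of_notMem (fun h => hρ ((congrHom_mem_region_iff hW ρ).1 h)),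
        Set.indicator_of_notMem hρ, mul_zero]
  change _ = ENNReal.ofReal |W.det| ^ (N + 1) * ∫⁻ ρ, (region N).indicator
      (fun ρ => ENNReal.ofReal (sqVol ρ ^ e) * f ρ) (congrHom W ρ)
  have hmW : Measurable ((region N).indicator
      fun ρ => ENNReal.ofReal (sqVol ρ ^ e) * f (congrHom W ρ)) :=
    (hmeas.mul hfW).indicator (region_measurableSet N)
  rw [lintegral_congr h1, lintegral_const_mul _ hmW,
    ← mul_assoc, ← ENNReal.ofReal_pow hW0.le, ← ENNReal.ofReal_pow hW0.le,
    ← ENNReal.ofReal_mul (by positivity)]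
  congr 2
  rw [← sq_abs, ← Real.rpow_natCast |W.det| 2, ← Real.rpow_mul hW0.le,
    ← Real.rpow_natCast, ← Real.rpow_natCast, ← Real.rpow_add hW0, he]
  congr 1
  push_cast
  ring

lemma exists_eq_mul_transpose {G : Matrix (Fin N) (Fin N) ℝ} (hG : G.PosDef) :
    ∃ C : Matrix (Fin N) (Fin N) ℝ, C.det ≠ 0 ∧ G = C * C.transpose := by
  open scoped MatrixOrder in
  obtain ⟨B, hB⟩ := CStarAlgebra.nonneg_iff_eq_star_mul_self.1
    (Matrix.nonneg_iff_posSemidef.2 hG.posSemidef)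
  rw [Matrix.star_eq_conjTranspose, Matrix.conjTranspose_eq_transpose_of_trivial] at hB
  refine ⟨B.transpose, fun h0 => ?_, by rw [hB, Matrix.transpose_transpose]⟩
  have h1 := hG.det_pos
  rw [hB, Matrix.det_mul, h0, zero_mul] at h1
  exact lt_irrefl _ h1

/-- The absolute determinant of a square matrix of Jacobi vectors. -/
def absDet (w : RelSpace N N) : ENNReal := ENNReal.ofReal |(toMat w).det|

lemma measurable_absDet : Measurable (absDet : RelSpace N N → ENNReal) :=
  (continuous_toMat.matrix_det.abs.measurable).ennreal_ofReal

lemma absDet_ne_top (w : RelSpace N N) : absDet w ≠ ⊤ := ENNReal.ofReal_ne_top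

lemma absDet_ne_zero {w : RelSpace N N} (hw : (toMat w).det ≠ 0) : absDet w ≠ 0 := by
  simpa [absDet, ENNReal.ofReal_eq_zero, not_le] using hw

lemma ae_det_ne_zero : ∀ᵐ w : RelSpace N N, (toMat w).det ≠ 0 := by
  have h := volume_det_submatrix_eq_zero (le_refl N)
  rw [ae_iff]
  simpa using h

lemma continuous_congrHom {X : Type*} [TopologicalSpace X] {A : X → Matrix (Fin N) (Fin N) ℝ}
    {ρ : X → Pair N → ℝ} (hA : Continuous A) (hρ : Continuous ρ) :
    Continuous fun x => congrHom (A x) (ρ x) :=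
  continuous_ungram.comp ((hA.matrix_mul (gram_continuous.comp hρ)).matrix_mul hA.matrix_transpose)

/-- Writing the inverse through the adjugate leaves a polynomial expression times a power of the
inverse determinant, which is measurable across the singular matrices. -/
lemma measurable_congrHom_inv :
    Measurable fun q : RelSpace N N × (Pair N → ℝ) => congrHom (toMat q.1)⁻¹ q.2 := by
  have h : ∀ q : RelSpace N N × (Pair N → ℝ), congrHom (toMat q.1)⁻¹ q.2 =
      ((toMat q.1).det⁻¹ ^ 2) • congrHom (toMat q.1).adjugate q.2 := by
    intro q
    refine gram_injective ?_
    rw [gram_smul, gram_congrHom, gram_congrHom, Matrix.inv_def, Ring.inverse_eq_inv',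
      Matrix.transpose_smul, Matrix.smul_mul, Matrix.smul_mul, Matrix.mul_smul, smul_smul, sq]
  simp only [h]
  have hc : Continuous fun q : RelSpace N N × (Pair N → ℝ) => toMat q.1 :=
    continuous_toMat.comp continuous_fst
  exact (hc.matrix_det.measurable.inv.pow_const 2).smul
    (continuous_congrHom hc.matrix_adjugate continuous_snd).measurable

lemma exists_ungram_mul_transpose {ρ : Pair N → ℝ} (hρ : ρ ∈ region N) :
    ∃ C : Matrix (Fin N) (Fin N) ℝ, C.det ≠ 0 ∧
      ρ = ungram (C * C.transpose) ∧ √(gram ρ).det = |C.det| := by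
  obtain ⟨C, h1, h2⟩ := exists_eq_mul_transpose hρ
  refine ⟨C, h1, by rw [← h2, ungram_gram], ?_⟩
  rw [h2, Matrix.det_mul, Matrix.det_transpose, ← sq, Real.sqrt_sq_eq_abs]

lemma transpose_mul_transpose_self (C : Matrix (Fin N) (Fin N) ℝ) :
    (C * C.transpose).transpose = C * C.transpose := by
  rw [Matrix.transpose_mul, Matrix.transpose_transpose]

lemma measurable_congrHom_toMat :
    Measurable fun q : RelSpace N N × (Pair N → ℝ) => congrHom (toMat q.1) q.2 :=
  (continuous_congrHom (continuous_toMat.comp continuous_fst) continuous_snd).measurable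

/-- First evaluation of the double integral. If the Gram matrix of `ρ` is `C Cᵀ`, the substitution
of `w C` for `w` removes `ρ` from the inner integral, at the price of `|det C| ^ N` from the
Jacobian and `|det C| ^ (d - N)` from the weight. -/
lemma lintegral_lintegral_congrHom [NeZero N] (hd : N ≤ d) {μ : Measure (Pair N → ℝ)}
    (hr : ∀ᵐ ρ ∂μ, ρ ∈ region N)
    {f h : (Pair N → ℝ) → ENNReal} (hf : Measurable f) (hh : Measurable h) :
    ∫⁻ ρ, (∫⁻ w : RelSpace N N, h ρ * (f (congrHom (toMat w) ρ) * absDet w ^ (d - N))) ∂μ =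
    (∫⁻ w : RelSpace N N, f (shape 1 w) * absDet w ^ (d - N)) *
      ∫⁻ ρ, h ρ * (ENNReal.ofReal √(gram ρ).det ^ d)⁻¹ ∂μ := by
  have hwm : Measurable fun ρ : Pair N → ℝ =>
      h ρ * (ENNReal.ofReal √(gram ρ).det ^ d)⁻¹ :=
    hh.mul ((gram_continuous.matrix_det.sqrt.measurable.ennreal_ofReal.pow_const d).inv)
  rw [← lintegral_const_mul _ hwm]
  refine lintegral_congr_ae (hr.mono fun ρ hρ => ?_)
  obtain ⟨C, h1, h2, h3⟩ := exists_ungram_mul_transpose hρ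
  have hfm : Measurable fun w : RelSpace N N => f (shape 1 w) * absDet w ^ (d - N) :=
    (hf.comp (continuous_shape 1).measurable).mul (measurable_absDet.pow_const _)
  have h4 := lintegral_rotate (N := N) (d := N) (A := C.transpose) (by rwa [Matrix.det_transpose])
    hfm
  have h5 : ∀ w : RelSpace N N, f (shape 1 (rotate C.transpose w)) *
      absDet (rotate C.transpose w) ^ (d - N) = ENNReal.ofReal |C.det| ^ (d - N) *
      (f (congrHom (toMat w) ρ) * absDet w ^ (d - N)) := by
    intro w
    have e1 : shape 1 (rotate C.transpose w) = congrHom (toMat w) ρ := by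
      rw [h2, congrHom_ungram _ (transpose_mul_transpose_self C), shape, toMat_rotate]
      simp only [Matrix.one_mul, Matrix.transpose_transpose, Matrix.transpose_mul,
        Matrix.mul_assoc]
    have e2 : absDet (rotate C.transpose w) = ENNReal.ofReal |C.det| * absDet w := by
      rw [absDet, absDet, toMat_rotate, Matrix.transpose_transpose, Matrix.det_mul, abs_mul,
        mul_comm, ENNReal.ofReal_mul (abs_nonneg _)]
    rw [e1, e2, mul_pow]
    ring
  have hgm : Measurable fun w : RelSpace N N => f (congrHom (toMat w) ρ) * absDet w ^ (d - N) :=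
    (hf.comp (measurable_congrHom_toMat.comp (measurable_id.prodMk measurable_const))).mul
      (measurable_absDet.pow_const _)
  rw [lintegral_congr h5, lintegral_const_mul _ hgm, ← mul_assoc, Matrix.det_transpose,
    ← pow_add, Nat.add_sub_cancel' hd] at h4
  have hne : ENNReal.ofReal |C.det| ^ d ≠ 0 := by
    refine pow_ne_zero _ ?_
    simpa [ENNReal.ofReal_eq_zero, not_le] using h1
  have hnt : ENNReal.ofReal |C.det| ^ d ≠ ⊤ := ENNReal.pow_ne_top ENNReal.ofReal_ne_top
  change ∫⁻ w : RelSpace N N, h ρ * (f (congrHom (toMat w) ρ) * absDet w ^ (d - N)) =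
    (∫⁻ w : RelSpace N N, f (shape 1 w) * absDet w ^ (d - N)) *
      (h ρ * (ENNReal.ofReal √(gram ρ).det ^ d)⁻¹)
  rw [lintegral_const_mul _ hgm, h3, ← h4]
  rw [mul_comm (_ * _) (h ρ * _), mul_assoc (h ρ), ← mul_assoc (_⁻¹),
    ENNReal.inv_mul_cancel hne hnt, one_mul]

lemma measurable_congrHom_inv_left (σ : Pair N → ℝ) :
    Measurable fun w : RelSpace N N => congrHom (toMat w)⁻¹ σ := by
  have h : Measurable fun w : RelSpace N N => (w, σ) := measurable_prodMk_right
  have h2 := (measurable_congrHom_inv (N := N)).comp h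
  simp only [Function.comp_def] at h2
  exact h2

/-- The measure `|det w| ^ (-N) dw` on matrices is invariant under left multiplication. Every `ρ` of
the region is `C` applied to the simplex with Gram matrix `1`, so the integral does not depend on
`ρ`. -/
lemma lintegral_absDet_inv_congrHom [NeZero N] {h : (Pair N → ℝ) → ENNReal} (hh : Measurable h)
    {ρ : Pair N → ℝ} (hρ : ρ ∈ region N) :
    ∫⁻ w : RelSpace N N, (absDet w ^ N)⁻¹ * h (congrHom (toMat w)⁻¹ ρ) =
      ∫⁻ w : RelSpace N N, (absDet w ^ N)⁻¹ * h (congrHom (toMat w)⁻¹ (ungram 1)) := by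
  obtain ⟨C, h1, h2, -⟩ := exists_ungram_mul_transpose hρ
  have hgm : ∀ σ, Measurable fun w : RelSpace N N =>
      (absDet w ^ N)⁻¹ * h (congrHom (toMat w)⁻¹ σ) := fun σ =>
    ((measurable_absDet.pow_const _).inv).mul
      (hh.comp (measurable_congrHom_inv_left _))
  have h3 := lintegral_leftMul (N := N) (d := N) h1
    (f := fun w => (absDet w ^ N)⁻¹ * h (congrHom (toMat w)⁻¹ ρ)) (hgm ρ)
  have h4 : ∀ w : RelSpace N N, (absDet (leftMul C w) ^ N)⁻¹ *
      h (congrHom (toMat (leftMul C w))⁻¹ ρ) = (ENNReal.ofReal |C.det| ^ N)⁻¹ *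
      ((absDet w ^ N)⁻¹ * h (congrHom (toMat w)⁻¹ (ungram 1))) := by
    intro w
    have e1 : absDet (leftMul C w) = ENNReal.ofReal |C.det| * absDet w := by
      rw [absDet, absDet, toMat_leftMul, Matrix.det_mul, abs_mul,
        ENNReal.ofReal_mul (abs_nonneg _)]
    have e2 : congrHom (toMat (leftMul C w))⁻¹ ρ = congrHom (toMat w)⁻¹ (ungram 1) := by
      rw [toMat_leftMul, Matrix.mul_inv_rev, map_mul, Module.End.mul_apply, h2,
        congrHom_ungram _ (transpose_mul_transpose_self C), ← Matrix.mul_assoc,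
        Matrix.nonsing_inv_mul _ h1.isUnit, Matrix.one_mul, ← Matrix.transpose_mul,
        Matrix.nonsing_inv_mul _ h1.isUnit, Matrix.transpose_one]
    rw [e1, e2, mul_pow, ENNReal.mul_inv (Or.inr (ENNReal.pow_ne_top (absDet_ne_top w)))
      (Or.inl (ENNReal.pow_ne_top ENNReal.ofReal_ne_top)), mul_assoc]
  have hne : ENNReal.ofReal |C.det| ^ N ≠ 0 := by
    refine pow_ne_zero _ ?_
    simpa [ENNReal.ofReal_eq_zero, not_le] using h1
  have hnt : ENNReal.ofReal |C.det| ^ N ≠ ⊤ := ENNReal.pow_ne_top ENNReal.ofReal_ne_top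
  rw [← h3, lintegral_congr h4, lintegral_const_mul _ (hgm _), ← mul_assoc,
    ENNReal.mul_inv_cancel hne hnt, one_mul]

/-- Second evaluation of the double integral. With `w` outermost, relative invariance moves the
action of `w` from `f` to its inverse on `h` and turns the weight into `|det w| ^ (-N)`. With the
order exchanged again, the inner integral is a constant. -/
lemma IsRelInvariant.lintegral_lintegral_congrHom [NeZero N] (hd : N ≤ d)
    {μ : Measure (Pair N → ℝ)} [SFinite μ] (hμ : IsRelInvariant d μ) (hr : ∀ᵐ ρ ∂μ, ρ ∈ region N)
    {f h : (Pair N → ℝ) → ENNReal} (hf : Measurable f) (hh : Measurable h) :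
    ∫⁻ ρ, (∫⁻ w : RelSpace N N, h ρ * (f (congrHom (toMat w) ρ) * absDet w ^ (d - N))) ∂μ =
    (∫⁻ ρ, f ρ ∂μ) *
      ∫⁻ w : RelSpace N N, (absDet w ^ N)⁻¹ * h (congrHom (toMat w)⁻¹ (ungram 1)) := by
  have hmeas1 : Measurable fun q : (Pair N → ℝ) × RelSpace N N =>
      h q.1 * (f (congrHom (toMat q.2) q.1) * absDet q.2 ^ (d - N)) :=
    (hh.comp measurable_fst).mul ((hf.comp (measurable_congrHom_toMat.comp measurable_swap)).mul
      ((measurable_absDet.comp measurable_snd).pow_const _))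
  have hmeas2 : Measurable fun q : RelSpace N N × (Pair N → ℝ) =>
      (absDet q.1 ^ N)⁻¹ * (f q.2 * h (congrHom (toMat q.1)⁻¹ q.2)) :=
    (((measurable_absDet.comp measurable_fst).pow_const _).inv).mul
      ((hf.comp measurable_snd).mul (hh.comp measurable_congrHom_inv))
  rw [lintegral_lintegral_swap hmeas1.aemeasurable]
  have step1 : ∫⁻ w : RelSpace N N, ∫⁻ ρ, h ρ * (f (congrHom (toMat w) ρ) *
      absDet w ^ (d - N)) ∂μ = ∫⁻ w : RelSpace N N, ∫⁻ ρ,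
      (absDet w ^ N)⁻¹ * (f ρ * h (congrHom (toMat w)⁻¹ ρ)) ∂μ := by
    refine lintegral_congr_ae (ae_det_ne_zero.mono fun w hw => ?_)
    have hF : Measurable fun ρ => f ρ * h (congrHom (toMat w)⁻¹ ρ) :=
      hf.mul (hh.comp (measurable_congrHom _))
    have h1 := hμ (toMat w) hw _ hF
    have h2 : ∀ ρ, congrHom (toMat w)⁻¹ (congrHom (toMat w) ρ) = ρ := by
      intro ρ
      rw [← Module.End.mul_apply, ← map_mul, Matrix.nonsing_inv_mul _ hw.isUnit, map_one,
        Module.End.one_apply]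
    simp only [h2] at h1
    change absDet w ^ d * _ = _ at h1
    have hm3 : Measurable fun ρ => f (congrHom (toMat w) ρ) * h ρ :=
      (hf.comp (measurable_congrHom _)).mul hh
    have hpow : absDet w ^ d = absDet w ^ N * absDet w ^ (d - N) := by
      rw [← pow_add, Nat.add_sub_cancel' hd]
    have h3 : ∀ ρ, h ρ * (f (congrHom (toMat w) ρ) * absDet w ^ (d - N)) =
        absDet w ^ (d - N) * (f (congrHom (toMat w) ρ) * h ρ) := fun ρ => by ring
    change ∫⁻ ρ, h ρ * (f (congrHom (toMat w) ρ) * absDet w ^ (d - N)) ∂μ =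
      ∫⁻ ρ, (absDet w ^ N)⁻¹ * (f ρ * h (congrHom (toMat w)⁻¹ ρ)) ∂μ
    rw [lintegral_congr h3, lintegral_const_mul _ hm3, lintegral_const_mul _ hF, ← h1,
      hpow, ← mul_assoc, ← mul_assoc,
      ENNReal.inv_mul_cancel (pow_ne_zero _ (absDet_ne_zero hw))
        (ENNReal.pow_ne_top (absDet_ne_top w)), one_mul]
  rw [step1, lintegral_lintegral_swap hmeas2.aemeasurable, ← lintegral_mul_const _ hf]
  refine lintegral_congr_ae (hr.mono fun ρ hρ => ?_)
  have hgm : Measurable fun w : RelSpace N N =>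
      (absDet w ^ N)⁻¹ * h (congrHom (toMat w)⁻¹ ρ) :=
    ((measurable_absDet.pow_const _).inv).mul
      (hh.comp (measurable_congrHom_inv_left _))
  have h5 : ∀ w : RelSpace N N, (absDet w ^ N)⁻¹ * (f ρ * h (congrHom (toMat w)⁻¹ ρ)) =
      f ρ * ((absDet w ^ N)⁻¹ * h (congrHom (toMat w)⁻¹ ρ)) := fun w => by ring
  beta_reduce
  rw [lintegral_congr h5, lintegral_const_mul _ hgm, lintegral_absDet_inv_congrHom hh hρ]

/-- Uniqueness of relatively invariant measures, in integrated form. -/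
lemma IsRelInvariant.lintegral_mul_eq [NeZero N] (hd : N ≤ d) {μ : Measure (Pair N → ℝ)}
    [SFinite μ] (hμ : IsRelInvariant d μ) (hr : ∀ᵐ ρ ∂μ, ρ ∈ region N)
    {f h : (Pair N → ℝ) → ENNReal} (hf : Measurable f) (hh : Measurable h) :
    (∫⁻ ρ, f ρ ∂μ) * ∫⁻ w : RelSpace N N, (absDet w ^ N)⁻¹ * h (congrHom (toMat w)⁻¹ (ungram 1)) =
      (∫⁻ w : RelSpace N N, f (shape 1 w) * absDet w ^ (d - N)) *
        ∫⁻ ρ, h ρ * (ENNReal.ofReal √(gram ρ).det ^ d)⁻¹ ∂μ := by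
  rw [← _root_.NBody.lintegral_lintegral_congrHom hd hr hf hh, hμ.lintegral_lintegral_congrHom hd hr hf hh]

end Pushforward

/-! ### Comparison of the two relatively invariant measures on a compact set -/

section Pushforward

variable {N d : ℕ}

lemma norm_leftMul_sq (C : Matrix (Fin N) (Fin N) ℝ) (y : RelSpace N d) :
    ‖leftMul C y‖ ^ 2 = (gram (shape C y)).trace := by
  rw [gram_shape, EuclideanSpace.norm_sq_eq, Fintype.sum_prod_type, Matrix.trace]
  refine Finset.sum_congr rfl fun i _ => ?_
  rw [Matrix.diag_apply, Matrix.mul_apply]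
  refine Finset.sum_congr rfl fun s _ => ?_
  rw [Matrix.transpose_apply, Real.norm_eq_abs, sq_abs, sq]
  rfl

/-- The trace of the Gram matrix is the squared norm of the transformed Jacobi vectors, so `shape C`
is proper. Compact sets therefore have finite measure under the image of Lebesgue measure. -/
lemma isCompact_shape_preimage {C : Matrix (Fin N) (Fin N) ℝ} (hC : C.det ≠ 0)
    {K : Set (Pair N → ℝ)} (hK : IsCompact K) : IsCompact (shape C ⁻¹' K : Set (RelSpace N d)) := by
  refine Metric.isCompact_of_isClosed_isBounded (hK.isClosed.preimage (continuous_shape C)) ?_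
  obtain ⟨B, hB⟩ := hK.bddAbove_image (gram_continuous.matrix_trace.continuousOn)
  set L : RelSpace N d →L[ℝ] RelSpace N d := LinearMap.toContinuousLinearMap (leftMul C⁻¹) with hL
  refine (Metric.isBounded_closedBall (x := (0 : RelSpace N d)) (r := ‖L‖ * √B)).subset ?_
  intro y hy
  have h1 : y = L (leftMul C y) := by
    change y = leftMul C⁻¹ (leftMul C y)
    rw [← Module.End.mul_apply, ← map_mul, Matrix.nonsing_inv_mul _ hC.isUnit, map_one,
      Module.End.one_apply]
  rw [mem_closedBall_zero_iff]
  have h2 : ‖leftMul C y‖ ≤ √B := by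
    refine Real.le_sqrt_of_sq_le ?_
    rw [norm_leftMul_sq]
    exact hB ⟨_, hy, rfl⟩
  calc ‖y‖ = ‖L (leftMul C y)‖ := by rw [← h1]
    _ ≤ ‖L‖ * ‖leftMul C y‖ := L.le_opNorm _
    _ ≤ ‖L‖ * √B := by gcongr

lemma ungram_one_mem_region : ungram (1 : Matrix (Fin N) (Fin N) ℝ) ∈ region N := by
  change (gram (ungram 1)).PosDef
  rw [gram_ungram Matrix.transpose_one]
  exact Matrix.PosDef.one

/-- The witness comes from the first `N` standard basis vectors of `ℝ^d`, which is where `N ≤ d`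
enters. -/
lemma exists_shape_eq (hd : N ≤ d) {C : Matrix (Fin N) (Fin N) ℝ} (hC : C.det ≠ 0) :
    ∃ y : RelSpace N d, shape C y = ungram 1 := by
  set e : RelSpace N d := WithLp.toLp 2 fun p => if p.2 = Fin.castLE hd p.1 then 1 else 0 with he
  refine ⟨leftMul C⁻¹ e, ?_⟩
  rw [shape_leftMul, Matrix.mul_nonsing_inv _ hC.isUnit, shape, Matrix.one_mul]
  congr 1
  ext i j
  rw [Matrix.mul_apply, Finset.sum_eq_single (Fin.castLE hd i)]
  · simp [toMat, he, Matrix.one_apply, (Fin.castLE_injective hd).eq_iff]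
  · intro s _ hs
    simp [toMat, he, hs]
  · simp

lemma ae_shape_mem_region (hd : N ≤ d) {C : Matrix (Fin N) (Fin N) ℝ} (hC : C.det ≠ 0) :
    ∀ᵐ y : RelSpace N d, shape C y ∈ region N := by
  have h : ∀ᵐ y : RelSpace N d, ((toMat y).submatrix id (Fin.castLE hd)).det ≠ 0 := by
    rw [ae_iff]
    simpa using volume_det_submatrix_eq_zero hd
  filter_upwards [h] with y hy
  change (gram (shape C y)).PosDef
  rw [gram_shape]
  exact posDef_mul_transpose_of_det_ne_zero hd hC hy

lemma volume_shape_preimage_pos (hd : N ≤ d) {C : Matrix (Fin N) (Fin N) ℝ} (hC : C.det ≠ 0)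
    {K : Set (Pair N → ℝ)} (hK : K ∈ nhds (ungram 1)) :
    0 < volume (shape C ⁻¹' K : Set (RelSpace N d)) := by
  obtain ⟨y, hy⟩ := exists_shape_eq hd hC
  refine Measure.measure_pos_of_mem_nhds volume (x := y) ?_
  exact (continuous_shape C).continuousAt.preimage_mem_nhds (by rwa [hy])

lemma radMeasure_pos {K : Set (Pair N → ℝ)} (hKm : MeasurableSet K) (hK : K ∈ nhds (ungram 1)) :
    0 < radMeasure N d K := by
  have h1 : 0 < volume (K ∩ region N) :=
    Measure.measure_pos_of_mem_nhds volume
      (Filter.inter_mem hK ((region_isOpen N).mem_nhds ungram_one_mem_region))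
  have hm : Measurable fun ρ : Pair N → ℝ =>
      ENNReal.ofReal (sqVol ρ ^ (((d : ℝ) - ((N : ℝ) + 1)) / 2)) :=
    (continuous_sqVol.measurable.pow_const _).ennreal_ofReal
  rw [radMeasure, withDensity_apply _ hKm, Measure.restrict_restrict hKm,
    setLIntegral_pos_iff hm]
  refine h1.trans_le (measure_mono fun ρ hρ => ⟨?_, hρ⟩)
  rw [Function.mem_support]
  have := sqVol_pos hρ.2
  exact (ENNReal.ofReal_pos.2 (by positivity)).ne'

lemma radMeasure_lt_top {K : Set (Pair N → ℝ)} (hK : IsCompact K) (hKr : K ⊆ region N) :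
    radMeasure N d K < ⊤ := by
  have hc : ContinuousOn (fun ρ : Pair N → ℝ => sqVol ρ ^ (((d : ℝ) - ((N : ℝ) + 1)) / 2)) K :=
    continuous_sqVol.continuousOn.rpow_const fun ρ hρ => Or.inl (sqVol_pos (hKr hρ)).ne'
  obtain ⟨B, hB⟩ := hK.bddAbove_image hc
  rw [radMeasure, withDensity_apply _ hK.measurableSet, Measure.restrict_restrict hK.measurableSet]
  refine (setLIntegral_mono measurable_const (fun ρ hρ =>
    ENNReal.ofReal_le_ofReal (hB ⟨ρ, hρ.1, rfl⟩))).trans_lt ?_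
  rw [setLIntegral_const]
  exact ENNReal.mul_lt_top ENNReal.ofReal_lt_top
    ((measure_mono Set.inter_subset_left).trans_lt hK.measure_lt_top)

instance instSFiniteRadMeasure : SFinite (radMeasure N d) := by
  unfold radMeasure; infer_instance

/-- The choice of `h` as the indicator of `s` times `det ^ (d / 2)` cancels the weight in
`lintegral_mul_eq`. The two factors multiplying `μ K` and `μ s` do not depend on `μ`, so two such
measures can be compared. -/
lemma IsRelInvariant.measure_mul_eq [NeZero N] (hd : N ≤ d) {μ : Measure (Pair N → ℝ)}
    [SFinite μ] (hμ : IsRelInvariant d μ) (hr : ∀ᵐ ρ ∂μ, ρ ∈ region N) {K s : Set (Pair N → ℝ)}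
    (hK : MeasurableSet K) (hs : MeasurableSet s) :
    μ K * ∫⁻ w : RelSpace N N, (absDet w ^ N)⁻¹ * (s.indicator fun ρ =>
        ENNReal.ofReal √(gram ρ).det ^ d) (congrHom (toMat w)⁻¹ (ungram 1)) =
      (∫⁻ w in shape 1 ⁻¹' K, absDet w ^ (d - N)) * μ s := by
  have hE : Measurable fun ρ : Pair N → ℝ => ENNReal.ofReal √(gram ρ).det ^ d :=
    gram_continuous.matrix_det.sqrt.measurable.ennreal_ofReal.pow_const d
  have h := hμ.lintegral_mul_eq hd hr (f := K.indicator 1) (measurable_one.indicator hK)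
    (hE.indicator hs)
  rw [lintegral_indicator_one hK] at h
  rw [h]
  congr 1
  · rw [← lintegral_indicator ((continuous_shape 1).measurable hK)]
    refine lintegral_congr fun w => ?_
    by_cases hw : shape 1 w ∈ K
    · rw [Set.indicator_of_mem hw, Set.indicator_of_mem (show w ∈ shape 1 ⁻¹' K from hw),
        Pi.one_apply, one_mul]
    · rw [Set.indicator_of_notMem hw, Set.indicator_of_notMem (show w ∉ shape 1 ⁻¹' K from hw),
        zero_mul]
  · rw [← lintegral_indicator_one hs]
    refine lintegral_congr_ae (hr.mono fun ρ hρ => ?_)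
    have h1 := (show (gram ρ).PosDef from hρ).det_pos
    by_cases hρs : ρ ∈ s
    · simp only [Set.indicator_of_mem hρs, Pi.one_apply]
      refine ENNReal.mul_inv_cancel (pow_ne_zero _ ?_) (ENNReal.pow_ne_top ENNReal.ofReal_ne_top)
      exact (ENNReal.ofReal_pos.2 (Real.sqrt_pos.2 h1)).ne'
    · simp only [Set.indicator_of_notMem hρs, zero_mul]

/-- The radial measure is, up to a constant, the image of Lebesgue measure under the squared
distances. -/
lemma exists_map_shape_eq_smul_radMeasure [NeZero N] (hd : N ≤ d) {C : Matrix (Fin N) (Fin N) ℝ}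
    (hC : C.det ≠ 0) : ∃ c : ℝ, 0 < c ∧
      Measure.map (shape C : RelSpace N d → _) volume = ENNReal.ofReal c • radMeasure N d := by
  obtain ⟨r, hr, hsub⟩ := Metric.nhds_basis_closedBall.mem_iff.1
    ((region_isOpen N).mem_nhds ungram_one_mem_region)
  set K := Metric.closedBall (ungram (1 : Matrix (Fin N) (Fin N) ℝ)) r with hKdef
  have hKc : IsCompact K := isCompact_closedBall _ _
  have hKm : MeasurableSet K := hKc.measurableSet
  have hKn : K ∈ nhds (ungram (1 : Matrix (Fin N) (Fin N) ℝ)) := Metric.closedBall_mem_nhds _ hr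
  have hmC := (continuous_shape (d := d) C).measurable
  set μ := Measure.map (shape C : RelSpace N d → _) volume with hμ
  have hμr : ∀ᵐ ρ ∂μ, ρ ∈ region N :=
    (ae_map_iff hmC.aemeasurable (region_measurableSet N)).2 (ae_shape_mem_region hd hC)
  have m1 : μ K = volume (shape C ⁻¹' K : Set (RelSpace N d)) := Measure.map_apply hmC hKm
  have hμ0 : μ K ≠ 0 := by rw [m1]; exact (volume_shape_preimage_pos hd hC hKn).ne'
  have hμt : μ K ≠ ⊤ := by rw [m1]; exact (isCompact_shape_preimage hC hKc).measure_lt_top.ne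
  have hν0 : radMeasure N d K ≠ 0 := (radMeasure_pos hKm hKn).ne'
  have hνt : radMeasure N d K ≠ ⊤ := (radMeasure_lt_top hKc hsub).ne
  have hdet1 : (1 : Matrix (Fin N) (Fin N) ℝ).det ≠ 0 := by simp
  have hpc : IsCompact (shape 1 ⁻¹' K : Set (RelSpace N N)) := isCompact_shape_preimage hdet1 hKc
  set Λ := ∫⁻ w in (shape 1 ⁻¹' K : Set (RelSpace N N)), absDet w ^ (d - N) with hΛ
  -- `K` lies in the region, so the determinant does not vanish on the preimage of `K`, which has
  -- positive measure. Finiteness of `Λ` below comes from compactness of that preimage.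
  have hΛ0 : Λ ≠ 0 := by
    rw [hΛ, ← pos_iff_ne_zero, setLIntegral_pos_iff (measurable_absDet.pow_const _)]
    refine (volume_shape_preimage_pos le_rfl hdet1 hKn).trans_le (measure_mono fun w hw => ⟨?_, hw⟩)
    rw [Function.mem_support]
    refine pow_ne_zero _ (absDet_ne_zero fun h0 => ?_)
    have h1 := (show (gram (shape 1 w)).PosDef from hsub hw).det_pos
    rw [gram_shape, Matrix.one_mul, Matrix.det_mul, h0, zero_mul] at h1
    exact lt_irrefl _ h1
  have hΛt : Λ ≠ ⊤ := by
    obtain ⟨B, hB⟩ := hpc.bddAbove_image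
      ((continuous_toMat (N := N) (d := N)).matrix_det.abs.continuousOn)
    refine ne_of_lt ((setLIntegral_mono (measurable_const (a := ENNReal.ofReal B ^ (d - N)))
      fun w hw => ?_).trans_lt ?_)
    · exact pow_le_pow_left' (ENNReal.ofReal_le_ofReal (hB ⟨w, hw, rfl⟩)) _
    · rw [setLIntegral_const]
      exact ENNReal.mul_lt_top (ENNReal.pow_lt_top ENNReal.ofReal_lt_top) hpc.measure_lt_top
  -- The cross relations for both measures share `Λ` and the factor `Q` depending on `s`.
  -- Eliminating `Q` and cancelling `Λ` leaves proportionality.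
  have hcross : ∀ s, MeasurableSet s → μ s = μ K / radMeasure N d K * radMeasure N d s := by
    intro s hs
    have h1 := (isRelInvariant_map_shape (d := d) hC).measure_mul_eq hd hμr hKm hs
    have h2 := (isRelInvariant_radMeasure (N := N) (d := d)).measure_mul_eq hd
      (radMeasure_ae_mem_region N d) hKm hs
    rw [← hΛ, ← hμ] at h1
    rw [← hΛ] at h2
    set Q := ∫⁻ w : RelSpace N N, (absDet w ^ N)⁻¹ * (s.indicator fun ρ =>
        ENNReal.ofReal √(gram ρ).det ^ d) (congrHom (toMat w)⁻¹ (ungram 1))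
    have h3 : Λ * (μ s * radMeasure N d K) = Λ * (μ K * radMeasure N d s) := by
      rw [← mul_assoc, ← h1, mul_left_comm, ← h2]
      ring
    have h4 := (ENNReal.mul_right_inj hΛ0 hΛt).1 h3
    rw [ENNReal.div_eq_inv_mul, mul_assoc, ← h4, mul_comm (μ s), ← mul_assoc,
      ENNReal.inv_mul_cancel hν0 hνt, one_mul]
  have hct : μ K / radMeasure N d K ≠ ⊤ := ENNReal.div_ne_top hμt hν0
  refine ⟨(μ K / radMeasure N d K).toReal,
    ENNReal.toReal_pos (ENNReal.div_ne_zero.2 ⟨hμ0, hνt⟩) hct, ?_⟩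
  rw [ENNReal.ofReal_toReal hct]
  ext s hs
  rw [hcross s hs, Measure.smul_apply, smul_eq_mul]

end Pushforward

/-! ### The Laplacian of a radial function -/

section ChainRule

lemma laplacian_eq_sum_fderiv {E F ι : Type*} [NormedAddCommGroup E] [InnerProductSpace ℝ E]
    [FiniteDimensional ℝ E] [NormedAddCommGroup F] [NormedSpace ℝ F] [Fintype ι]
    (v : OrthonormalBasis ι ℝ E) (φ : E → F) (y : E) :
    Δ φ y = ∑ i, fderiv ℝ (fderiv ℝ φ) y (v i) (v i) := by
  rw [InnerProductSpace.laplacian_eq_iteratedFDeriv_orthonormalBasis φ v]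
  simp [iteratedFDeriv_two_apply]

/-- Second derivatives of a composition with a map that is quadratic along a line. -/
lemma fderiv_fderiv_comp_of_quadratic {E F G : Type*} [NormedAddCommGroup E] [NormedSpace ℝ E]
    [NormedAddCommGroup F] [NormedSpace ℝ F] [NormedAddCommGroup G] [NormedSpace ℝ G]
    {f : F → G} {Φ : E → F} {y e : E} {v q : F} (hΦ : ∀ t : ℝ, Φ (y + t • e) = Φ y + t • v + t ^ 2 • q)
    (hf : ContDiffAt ℝ 2 f (Φ y)) (hφ : ContDiff ℝ 2 (fun z => f (Φ z))) :
    fderiv ℝ (fderiv ℝ fun z => f (Φ z)) y e e =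
      fderiv ℝ (fderiv ℝ f) (Φ y) v v + (2 : ℝ) • fderiv ℝ f (Φ y) q := by
  set φ := fun z => f (Φ z) with hφdef
  set γ : ℝ → F := fun t => Φ y + t • v + t ^ 2 • q with hγ
  have hγd : ∀ t, HasDerivAt γ (v + (2 * t) • q) t := by
    intro t
    have h1 : HasDerivAt (fun t : ℝ => Φ y + t • v) v t := by
      simpa using ((hasDerivAt_id t).smul_const v).const_add (Φ y)
    have h2 : HasDerivAt (fun t : ℝ => t ^ 2 • q) ((2 * t) • q) t := by
      simpa using (hasDerivAt_pow 2 t).smul_const q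
    exact h1.add h2
  have hl : ∀ t, HasDerivAt (fun t : ℝ => y + t • e) e t := fun t => by
    simpa using ((hasDerivAt_id t).smul_const e).const_add y
  have hφ1 : Differentiable ℝ φ := hφ.differentiable (by norm_num)
  have hφ2 : Differentiable ℝ (fderiv ℝ φ) :=
    (hφ.fderiv_right (m := 1) (by norm_num)).differentiable (by norm_num)
  have hγ0 : γ 0 = Φ y := by simp [hγ]
  -- Smoothness of `f` is known only near `Φ y`, so the first derivatives along the line are
  -- compared only for small `t`; that suffices for the second derivative at `0`.
  have hf1 : ∀ᶠ t in nhds (0 : ℝ), DifferentiableAt ℝ f (γ t) := by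
    have h1 : ∀ᶠ x in nhds (γ 0), DifferentiableAt ℝ f x := by
      rw [hγ0]
      exact ((hf.of_le (m := 1) (by norm_num)).eventually (by simp)).mono
        fun x hx => hx.differentiableAt (by norm_num)
    exact (hγd 0).continuousAt.eventually h1
  have hfirst : (fun t : ℝ => fderiv ℝ φ (y + t • e) e) =ᶠ[nhds 0]
      fun t => fderiv ℝ f (γ t) (v + (2 * t) • q) := by
    filter_upwards [hf1] with t ht
    have h1 : HasDerivAt (fun t : ℝ => φ (y + t • e)) (fderiv ℝ φ (y + t • e) e) t :=
      (hφ1 _).hasFDerivAt.comp_hasDerivAt t (hl t)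
    have h2 : HasDerivAt (fun t : ℝ => f (γ t)) (fderiv ℝ f (γ t) (v + (2 * t) • q)) t :=
      ht.hasFDerivAt.comp_hasDerivAt t (hγd t)
    have h3 : (fun t : ℝ => φ (y + t • e)) = fun t => f (γ t) := by
      funext t; simp only [hφdef, hΦ, hγ]
    rw [h3] at h1
    exact h1.unique h2
  have hleft : HasDerivAt (fun t : ℝ => fderiv ℝ φ (y + t • e) e)
      (fderiv ℝ (fderiv ℝ φ) y e e) 0 := by
    have h1 : HasDerivAt (fun t : ℝ => fderiv ℝ φ (y + t • e)) (fderiv ℝ (fderiv ℝ φ) y e) 0 := by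
      have h2 := (hφ2 (y + (0 : ℝ) • e)).hasFDerivAt.comp_hasDerivAt 0 (hl 0)
      simp only [zero_smul, add_zero] at h2
      exact h2
    have h3 := h1.clm_apply (hasDerivAt_const (0 : ℝ) e)
    simpa using h3
  have hright : HasDerivAt (fun t : ℝ => fderiv ℝ f (γ t) (v + (2 * t) • q))
      (fderiv ℝ (fderiv ℝ f) (Φ y) v v + (2 : ℝ) • fderiv ℝ f (Φ y) q) 0 := by
    have h1 : HasDerivAt (fun t : ℝ => fderiv ℝ f (γ t)) (fderiv ℝ (fderiv ℝ f) (Φ y) v) 0 := by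
      have h2 : DifferentiableAt ℝ (fderiv ℝ f) (γ 0) := by
        rw [hγ0]
        exact (hf.fderiv_right (m := 1) (by norm_num)).differentiableAt (by norm_num)
      have h3 := h2.hasFDerivAt.comp_hasDerivAt 0 (hγd 0)
      simp only [hγ0, mul_zero, zero_smul, add_zero] at h3
      exact h3
    have h4 : HasDerivAt (fun t : ℝ => v + (2 * t) • q) ((2 : ℝ) • q) 0 := by
      have := (((hasDerivAt_id (0 : ℝ)).const_mul 2).smul_const q).const_add v
      simpa using this
    have h5 := h1.clm_apply h4
    simpa [hγ0] using h5
  exact (hleft.congr_of_eventuallyEq hfirst.symm).unique hright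

variable {N d : ℕ} {m : Fin (N + 1) → ℝ}

/-- A sum over ordered pairs of distinct bodies as a sum over unordered pairs. -/
lemma sum_ne_eq_sum_pair {R : Type*} [AddCommMonoid R] (A : Fin (N + 1) → Fin (N + 1) → R) :
    ∑ i, ∑ j, (if i ≠ j then A i j else 0) = ∑ p : Pair N, (A p.1.1 p.1.2 + A p.1.2 p.1.1) := by
  have h1 : ∀ B : Fin (N + 1) → Fin (N + 1) → R,
      ∑ i, ∑ j, (if i < j then B i j else 0) = ∑ p : Pair N, B p.1.1 p.1.2 := by
    intro B
    rw [← Fintype.sum_prod_type' (f := fun i j => if i < j then B i j else 0),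
      ← Finset.sum_filter]
    exact (Finset.sum_subtype (p := fun q : Fin (N + 1) × Fin (N + 1) => q.1 < q.2) _ (by simp)
      (fun q => B q.1 q.2))
  have h2 : ∀ i j : Fin (N + 1), (if i ≠ j then A i j else 0) =
      (if i < j then A i j else 0) + (if j < i then A i j else 0) := by
    intro i j
    rcases lt_trichotomy i j with h | h | h
    · simp [h, h.ne, h.not_gt]
    · simp [h]
    · simp [h, h.ne', h.not_gt]
  simp only [h2, Finset.sum_add_distrib, h1]
  congr 1
  rw [Finset.sum_comm]
  exact h1 fun i j => A j i

/-- The direction of the partial derivative `∂_{ρ_ij}`. -/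
def edgeDir (i j : Fin (N + 1)) : Pair N → ℝ := fun p => if p.1 = (i, j) ∨ p.1 = (j, i) then 1 else 0

lemma edgeDir_comm (i j : Fin (N + 1)) : edgeDir i j = edgeDir j i := by
  funext p; simp only [edgeDir, or_comm]

lemma edgeDir_pair (p : Pair N) : edgeDir p.1.1 p.1.2 = Pi.single p (1 : ℝ) := by
  funext q
  have h : (q.1 = (p.1.1, p.1.2) ∨ q.1 = (p.1.2, p.1.1)) ↔ q = p := by
    constructor
    · rintro (h | h)
      · exact Subtype.ext h
      · exfalso
        have h1 := q.2
        rw [h] at h1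
        exact absurd h1 p.2.not_gt
    · rintro rfl; exact Or.inl rfl
  simp only [edgeDir, h, Pi.single_apply]

lemma pderiv_pderiv_eq {f : (Pair N → ℝ) → ℂ} {ρ : Pair N → ℝ} (hf : ContDiffAt ℝ 2 f ρ)
    (i j k l : Fin (N + 1)) :
    pderiv i j (pderiv k l f) ρ = fderiv ℝ (fderiv ℝ f) ρ (edgeDir i j) (edgeDir k l) := by
  have h1 : DifferentiableAt ℝ (fderiv ℝ f) ρ :=
    (hf.fderiv_right (m := 1) (by norm_num)).differentiableAt (by norm_num)
  have h2 := (h1.hasFDerivAt.clm_apply (hasFDerivAt_const (edgeDir k l) ρ)).fderiv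
  change fderiv ℝ (fun σ => fderiv ℝ f σ (edgeDir k l)) ρ (edgeDir i j) = _
  rw [h2]
  simp

/-- The second-order part of the Laplacian: a sum over pairs of edges of terms that only involve
adjacent edges. -/
lemma sum_pair_kinetic (m : Fin (N + 1) → ℝ) {x : Fin (N + 1) → EuclideanSpace ℝ (Fin d)}
    {ρ : Pair N → ℝ} (hρ : ∀ i j, coord ρ i j = dist (x i) (x j) ^ 2)
    (B : (Pair N → ℝ) → (Pair N → ℝ) → ℂ) (hB : ∀ u v, B u v = B v u)
    (κ : Fin (N + 1) → Fin (N + 1) → ℝ) (hκ : ∀ i k, κ i k = if i = k then 1 / m i else 0) :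
    ∑ p : Pair N, ∑ q : Pair N,
      (((κ p.1.1 q.1.1 - κ p.1.1 q.1.2 - κ p.1.2 q.1.1 + κ p.1.2 q.1.2) *
        inner ℝ (x p.1.1 - x p.1.2) (x q.1.1 - x q.1.2) : ℝ) : ℂ) *
        B (edgeDir p.1.1 p.1.2) (edgeDir q.1.1 q.1.2) =
    ∑ i, ∑ j, ∑ k, (if i ≠ j ∧ i ≠ k ∧ j < k then
      ((1 / m i * (coord ρ i j + coord ρ i k - coord ρ j k) : ℝ) : ℂ) *
        B (edgeDir i j) (edgeDir i k) else 0) +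
    ∑ p : Pair N, ((1 / m p.1.1 + 1 / m p.1.2 : ℝ) * ρ p : ℝ) *
      B (edgeDir p.1.1 p.1.2) (edgeDir p.1.1 p.1.2) := by
  -- The four terms of the kinetic coupling are the four choices of an orientation for each of the
  -- two edges; reversing an edge changes the sign of its vector and absorbs the minus signs.
  set S : Fin (N + 1) → Fin (N + 1) → Fin (N + 1) → Fin (N + 1) → ℂ := fun i j i' k =>
    ((κ i i' * inner ℝ (x i - x j) (x i' - x k) : ℝ) : ℂ) * B (edgeDir i j) (edgeDir i' k) with hS
  have hlhs : ∀ p q : Pair N,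
      (((κ p.1.1 q.1.1 - κ p.1.1 q.1.2 - κ p.1.2 q.1.1 + κ p.1.2 q.1.2) *
        inner ℝ (x p.1.1 - x p.1.2) (x q.1.1 - x q.1.2) : ℝ) : ℂ) *
        B (edgeDir p.1.1 p.1.2) (edgeDir q.1.1 q.1.2) =
      (S p.1.1 p.1.2 q.1.1 q.1.2 + S p.1.1 p.1.2 q.1.2 q.1.1) +
      (S p.1.2 p.1.1 q.1.1 q.1.2 + S p.1.2 p.1.1 q.1.2 q.1.1) := by
    intro p q
    simp only [hS]
    rw [edgeDir_comm p.1.2 p.1.1, edgeDir_comm q.1.2 q.1.1, ← neg_sub (x p.1.1) (x p.1.2),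
      ← neg_sub (x q.1.1) (x q.1.2), inner_neg_left, inner_neg_left, inner_neg_right]
    push_cast
    ring
  have hinner : ∀ i j k, inner ℝ (x i - x j) (x i - x k) =
      (coord ρ i j + coord ρ i k - coord ρ j k) / 2 := by
    intro i j k
    rw [real_inner_eq_norm_mul_self_add_norm_mul_self_sub_norm_sub_mul_self_div_two, hρ, hρ, hρ,
      dist_eq_norm, dist_eq_norm, dist_eq_norm, sub_sub_sub_cancel_left, norm_sub_rev (x k)]
    ring
  -- The inverse mass matrix is diagonal, so only oriented edges issuing from a common body `i`
  -- contribute.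
  have hsum : ∑ p : Pair N, ∑ q : Pair N,
      ((S p.1.1 p.1.2 q.1.1 q.1.2 + S p.1.1 p.1.2 q.1.2 q.1.1) +
      (S p.1.2 p.1.1 q.1.1 q.1.2 + S p.1.2 p.1.1 q.1.2 q.1.1)) =
      ∑ i, ∑ j, (if i ≠ j then ∑ k, (if i ≠ k then S i j i k else 0) else 0) := by
    rw [sum_ne_eq_sum_pair]
    refine Finset.sum_congr rfl fun p _ => ?_
    have h1 : ∀ i j, ∑ k, (if i ≠ k then S i j i k else 0) =
        ∑ q : Pair N, (S i j q.1.1 q.1.2 + S i j q.1.2 q.1.1) := by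
      intro i j
      rw [← sum_ne_eq_sum_pair fun i' k => S i j i' k]
      symm
      rw [Finset.sum_eq_single i]
      · intro i' _ hi'
        refine Finset.sum_eq_zero fun k _ => ?_
        simp [hS, hκ, hi'.symm]
      · simp
    rw [h1, h1, ← Finset.sum_add_distrib]
  rw [Finset.sum_congr rfl fun p _ => Finset.sum_congr rfl fun q _ => hlhs p q, hsum]
  -- The cases `j < k` and `k < j` contribute equally, and this factor two cancels the one half in
  -- the law of cosines. The case `j = k` gives the pure second derivatives.
  have hsplit : ∀ i j, (if i ≠ j then ∑ k, (if i ≠ k then S i j i k else 0) else 0) =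
      (∑ k, (if i ≠ j ∧ i ≠ k ∧ j < k then S i j i k else 0)) +
      (∑ k, (if i ≠ k ∧ i ≠ j ∧ k < j then S i j i k else 0)) +
      (if i ≠ j then S i j i j else 0) := by
    intro i j
    by_cases hij : i = j
    · simp [hij]
    simp only [ne_eq, hij, not_false_eq_true, if_true, true_and]
    have h1 : (S i j i j) = ∑ k, (if k = j then S i j i k else 0) := by simp
    rw [h1, ← Finset.sum_add_distrib, ← Finset.sum_add_distrib]
    refine Finset.sum_congr rfl fun k _ => ?_
    rcases lt_trichotomy j k with h | h | h
    · simp [h, h.ne', h.not_gt]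
    · subst h; simp [hij]
    · simp [h, h.ne, h.not_gt]
  have hsymm : ∀ i j k, S i j i k = S i k i j := by
    intro i j k
    simp only [hS]
    rw [real_inner_comm, hB]
  have hval : ∀ i j k, S i j i k + S i j i k =
      ((1 / m i * (coord ρ i j + coord ρ i k - coord ρ j k) : ℝ) : ℂ) *
        B (edgeDir i j) (edgeDir i k) := by
    intro i j k
    simp only [hS, hinner, hκ, if_true]
    push_cast
    ring
  simp only [hsplit, Finset.sum_add_distrib]
  congr 1
  · rw [← Finset.sum_add_distrib]
    refine Finset.sum_congr rfl fun i _ => ?_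
    rw [Finset.sum_comm (f := fun j k => if i ≠ k ∧ i ≠ j ∧ k < j then S i j i k else 0),
      ← Finset.sum_add_distrib]
    refine Finset.sum_congr rfl fun j _ => ?_
    rw [← Finset.sum_add_distrib]
    refine Finset.sum_congr rfl fun k _ => ?_
    split_ifs
    · rw [hsymm i k j, hval]
    · simp
  · rw [sum_ne_eq_sum_pair fun i j => S i j i j]
    refine Finset.sum_congr rfl fun p _ => ?_
    simp only [hS, hκ, if_true]
    rw [hinner, hinner, edgeDir_comm p.1.2 p.1.1, coord_comm ρ p.1.2 p.1.1, coord_self, coord_self,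
      coord_pair]
    push_cast
    ring

/-- The edge from the second to the first body of a pair. -/
def edge (m : Fin (N + 1) → ℝ) (p : Pair N) (y : RelSpace N d) : EuclideanSpace ℝ (Fin d) :=
  relPos m y p.1.1 - relPos m y p.1.2

lemma edge_apply (m : Fin (N + 1) → ℝ) (p : Pair N) (y : RelSpace N d) (s : Fin d) :
    edge m p y s = ∑ j, (relCoeff m p.1.1 j - relCoeff m p.1.2 j) * y (j, s) := by
  simp only [edge, PiLp.sub_apply, relPos_apply, sub_mul, Finset.sum_sub_distrib]

lemma edge_add_smul (m : Fin (N + 1) → ℝ) (p : Pair N) (y z : RelSpace N d) (t : ℝ) :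
    edge m p (y + t • z) = edge m p y + t • edge m p z := by
  ext s
  simp only [PiLp.add_apply, PiLp.smul_apply, edge_apply, smul_eq_mul, Finset.mul_sum, mul_add,
    Finset.sum_add_distrib]
  congr 1
  exact Finset.sum_congr rfl fun _ _ => by ring

lemma sqDistances_eq_norm_edge (m : Fin (N + 1) → ℝ) (y : RelSpace N d) (p : Pair N) :
    sqDistances m y p = ‖edge m p y‖ ^ 2 := by
  rw [sqDistances, distances, dist_eq_norm, edge]

lemma sqDistances_add_smul (m : Fin (N + 1) → ℝ) (y z : RelSpace N d) (t : ℝ) :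
    sqDistances m (y + t • z) = sqDistances m y +
      t • (fun p => 2 * inner ℝ (edge m p y) (edge m p z)) + t ^ 2 • sqDistances m z := by
  funext p
  simp only [Pi.add_apply, Pi.smul_apply, sqDistances_eq_norm_edge, edge_add_smul, smul_eq_mul]
  rw [norm_add_sq_real, inner_smul_right, norm_smul, mul_pow, Real.norm_eq_abs, sq_abs]
  ring

/-- The inverse mass matrix. -/
def invMass (m : Fin (N + 1) → ℝ) (i k : Fin (N + 1)) : ℝ := if i = k then 1 / m i else 0

/-- The kinetic coupling of two edges. -/
def edgeMass (m : Fin (N + 1) → ℝ) (p q : Pair N) : ℝ :=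
  invMass m p.1.1 q.1.1 - invMass m p.1.1 q.1.2 - invMass m p.1.2 q.1.1 + invMass m p.1.2 q.1.2

lemma sum_relCoeff_sub_mul (hm : ∀ i, 0 < m i) (p q : Pair N) :
    ∑ j, (relCoeff m p.1.1 j - relCoeff m p.1.2 j) * (relCoeff m q.1.1 j - relCoeff m q.1.2 j) =
      edgeMass m p q := by
  have h : ∀ j, (relCoeff m p.1.1 j - relCoeff m p.1.2 j) *
      (relCoeff m q.1.1 j - relCoeff m q.1.2 j) =
      relCoeff m p.1.1 j * relCoeff m q.1.1 j - relCoeff m p.1.1 j * relCoeff m q.1.2 j -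
      relCoeff m p.1.2 j * relCoeff m q.1.1 j + relCoeff m p.1.2 j * relCoeff m q.1.2 j :=
    fun j => by ring
  simp only [h, Finset.sum_add_distrib, Finset.sum_sub_distrib, sum_relCoeff_mul hm, edgeMass,
    invMass]
  ring

lemma edgeMass_self (m : Fin (N + 1) → ℝ) (p : Pair N) :
    edgeMass m p p = 1 / m p.1.1 + 1 / m p.1.2 := by
  simp [edgeMass, invMass, p.2.ne, p.2.ne']

lemma edge_single (m : Fin (N + 1) → ℝ) (p : Pair N) (k : Fin N × Fin d) (s : Fin d) :
    edge m p (EuclideanSpace.single k (1 : ℝ) : RelSpace N d) s =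
      if s = k.2 then relCoeff m p.1.1 k.1 - relCoeff m p.1.2 k.1 else 0 := by
  rw [edge_apply]
  by_cases h : s = k.2
  · subst h
    rw [Finset.sum_eq_single k.1]
    · simp
    · intro j _ hj
      have : (j, k.2) ≠ k := fun h => hj (by rw [← h])
      simp [this]
    · simp
  · rw [if_neg h]
    refine Finset.sum_eq_zero fun j _ => ?_
    have : (j, s) ≠ k := fun h' => h (by rw [← h'])
    simp [this]

lemma inner_edge_single (m : Fin (N + 1) → ℝ) (p : Pair N) (y : RelSpace N d)
    (k : Fin N × Fin d) :
    inner ℝ (edge m p y) (edge m p (EuclideanSpace.single k (1 : ℝ) : RelSpace N d)) =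
      (relCoeff m p.1.1 k.1 - relCoeff m p.1.2 k.1) * edge m p y k.2 := by
  rw [PiLp.inner_apply]
  simp only [edge_single, RCLike.inner_apply, conj_trivial]
  simp

lemma sum_inner_edge_mul (hm : ∀ i, 0 < m i) (p q : Pair N) (y : RelSpace N d) :
    ∑ k : Fin N × Fin d,
      (2 * inner ℝ (edge m p y) (edge m p (EuclideanSpace.single k (1 : ℝ) : RelSpace N d))) *
      (2 * inner ℝ (edge m q y) (edge m q (EuclideanSpace.single k (1 : ℝ) : RelSpace N d))) =
    4 * (edgeMass m p q * inner ℝ (edge m p y) (edge m q y)) := by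
  simp only [inner_edge_single]
  rw [← sum_relCoeff_sub_mul hm, PiLp.inner_apply, Finset.sum_mul_sum, Fintype.sum_prod_type,
    Finset.mul_sum]
  refine Finset.sum_congr rfl fun j _ => ?_
  rw [Finset.mul_sum]
  refine Finset.sum_congr rfl fun s _ => ?_
  simp only [RCLike.inner_apply, conj_trivial]
  ring

/-- Source of the factor `d` in the first-order part of `Δ_rad`: each of the `d` coordinate
directions contributes the same inverse reduced mass. -/
lemma sum_sqDistances_single (hm : ∀ i, 0 < m i) (p : Pair N) :
    ∑ k : Fin N × Fin d, sqDistances m (EuclideanSpace.single k (1 : ℝ) : RelSpace N d) p =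
      d * edgeMass m p p := by
  have h : ∀ k : Fin N × Fin d,
      sqDistances m (EuclideanSpace.single k (1 : ℝ) : RelSpace N d) p =
      (relCoeff m p.1.1 k.1 - relCoeff m p.1.2 k.1) *
        (relCoeff m p.1.1 k.1 - relCoeff m p.1.2 k.1) := by
    intro k
    rw [sqDistances_eq_norm_edge, ← real_inner_self_eq_norm_sq, inner_edge_single, edge_single,
      if_pos rfl]
  rw [Finset.sum_congr rfl fun k _ => h k, Fintype.sum_prod_type, ← sum_relCoeff_sub_mul hm,
    Finset.mul_sum]
  simp

lemma clm_apply_eq_sum {F : Type*} [NormedAddCommGroup F] [NormedSpace ℝ F]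
    (ℓ : (Pair N → ℝ) →L[ℝ] F) (v : Pair N → ℝ) : ℓ v = ∑ p, v p • ℓ (edgeDir p.1.1 p.1.2) := by
  conv_lhs => rw [pi_eq_sum_univ' v]
  rw [map_sum]
  refine Finset.sum_congr rfl fun p _ => ?_
  rw [map_smul, edgeDir_pair]

/-- Half of the Laplacian in the Jacobi coordinates acts on functions of the squared distances as
the radial operator. -/
lemma half_laplacian_comp_sqDistances (hm : ∀ i, 0 < m i) {f : (Pair N → ℝ) → ℂ}
    {y : RelSpace N d} (hf : ContDiffAt ℝ 2 f (sqDistances m y))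
    (hφ : ContDiff ℝ 2 (fun z : RelSpace N d => f (sqDistances m z))) :
    (1 / 2 : ℂ) * Δ (fun z : RelSpace N d => f (sqDistances m z)) y =
      radLaplacian d m f (sqDistances m y) := by
  set ρ := sqDistances m y with hρ
  set B : (Pair N → ℝ) → (Pair N → ℝ) → ℂ := fun u v => fderiv ℝ (fderiv ℝ f) ρ u v with hB
  have hBs : ∀ u v, B u v = B v u := fun u v =>
    (hf.isSymmSndFDerivAt (by simp)).eq u v
  rw [laplacian_eq_sum_fderiv (EuclideanSpace.basisFun (Fin N × Fin d) ℝ)]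
  simp only [EuclideanSpace.basisFun_apply]
  have h1 : ∀ k : Fin N × Fin d,
      fderiv ℝ (fderiv ℝ fun z : RelSpace N d => f (sqDistances m z)) y
        (EuclideanSpace.single k 1) (EuclideanSpace.single k 1) =
      ∑ p : Pair N, ∑ q : Pair N,
        (((2 * inner ℝ (edge m p y) (edge m p (EuclideanSpace.single k (1 : ℝ) : RelSpace N d))) *
        (2 * inner ℝ (edge m q y) (edge m q (EuclideanSpace.single k (1 : ℝ) : RelSpace N d))) : ℝ)
          : ℂ) * B (edgeDir p.1.1 p.1.2) (edgeDir q.1.1 q.1.2) +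
      ∑ p : Pair N, ((2 * sqDistances m (EuclideanSpace.single k (1 : ℝ) : RelSpace N d) p : ℝ) : ℂ)
        * pderiv p.1.1 p.1.2 f ρ := by
    intro k
    rw [fderiv_fderiv_comp_of_quadratic (sqDistances_add_smul m y _) hf hφ]
    congr 1
    · rw [clm_apply_eq_sum (fderiv ℝ (fderiv ℝ f) (sqDistances m y)) _,
        sum_apply]
      refine Finset.sum_congr rfl fun p _ => ?_
      rw [smul_apply, clm_apply_eq_sum, Finset.smul_sum]
      refine Finset.sum_congr rfl fun q _ => ?_
      rw [smul_smul, Complex.real_smul]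
    · rw [clm_apply_eq_sum, Finset.smul_sum]
      refine Finset.sum_congr rfl fun p _ => ?_
      rw [smul_smul, Complex.real_smul]
      rfl
  have hcoord : ∀ i j, coord ρ i j = dist (relPos m y i) (relPos m y j) ^ 2 :=
    coord_sqDistances m y
  have h2 : ∑ p : Pair N, ∑ q : Pair N,
      ((edgeMass m p q * inner ℝ (edge m p y) (edge m q y) : ℝ) : ℂ) *
        B (edgeDir p.1.1 p.1.2) (edgeDir q.1.1 q.1.2) = _ :=
    sum_pair_kinetic m hcoord B hBs (invMass m) (fun _ _ => rfl)
  rw [Finset.sum_congr rfl fun k _ => h1 k, Finset.sum_add_distrib]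
  have h3 : ∑ k : Fin N × Fin d, ∑ p : Pair N, ∑ q : Pair N,
        (((2 * inner ℝ (edge m p y) (edge m p (EuclideanSpace.single k (1 : ℝ) : RelSpace N d))) *
        (2 * inner ℝ (edge m q y) (edge m q (EuclideanSpace.single k (1 : ℝ) : RelSpace N d))) : ℝ)
          : ℂ) * B (edgeDir p.1.1 p.1.2) (edgeDir q.1.1 q.1.2) =
      4 * ∑ p : Pair N, ∑ q : Pair N,
        ((edgeMass m p q * inner ℝ (edge m p y) (edge m q y) : ℝ) : ℂ) *
        B (edgeDir p.1.1 p.1.2) (edgeDir q.1.1 q.1.2) := by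
    rw [Finset.sum_comm, Finset.mul_sum]
    refine Finset.sum_congr rfl fun p _ => ?_
    rw [Finset.sum_comm, Finset.mul_sum]
    refine Finset.sum_congr rfl fun q _ => ?_
    rw [← Finset.sum_mul, ← Complex.ofReal_sum, sum_inner_edge_mul hm, Complex.ofReal_mul,
      Complex.ofReal_ofNat, mul_assoc]
  have h4 : ∑ k : Fin N × Fin d, ∑ p : Pair N,
      ((2 * sqDistances m (EuclideanSpace.single k (1 : ℝ) : RelSpace N d) p : ℝ) : ℂ)
        * pderiv p.1.1 p.1.2 f ρ =
      2 * (d * ∑ p : Pair N, ((edgeMass m p p : ℝ) : ℂ) * pderiv p.1.1 p.1.2 f ρ) := by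
    rw [Finset.sum_comm, Finset.mul_sum, Finset.mul_sum]
    refine Finset.sum_congr rfl fun p _ => ?_
    rw [← Finset.sum_mul, ← Complex.ofReal_sum, ← Finset.mul_sum, sum_sqDistances_single hm]
    push_cast
    ring
  have h5 : ∀ p : Pair N, (m p.1.1 + m p.1.2) / (m p.1.1 * m p.1.2) =
      1 / m p.1.1 + 1 / m p.1.2 := by
    intro p
    have e1 := (hm p.1.1).ne'
    have e2 := (hm p.1.2).ne'
    field_simp
    ring
  have h6 : ∀ i j k l, pderiv i j (pderiv k l f) ρ = B (edgeDir i j) (edgeDir k l) :=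
    pderiv_pderiv_eq hf
  -- The factor one half turns the `4` of the second-order part into `2`, and the `2 d` of the
  -- first-order part into `d`.
  rw [h3, h4, h2, radLaplacian]
  simp only [h6, h5, edgeMass_self]
  ring

/-- On radial functions the Hamiltonian of relative motion acts as the restricted Hamiltonian. -/
lemma relExpr_comp_sqDistances (hm : ∀ i, 0 < m i) {V : (Pair N → ℝ) → ℝ} {f : (Pair N → ℝ) → ℂ}
    {y : RelSpace N d} (hf : ContDiffAt ℝ 2 f (sqDistances m y))
    (hφ : ContDiff ℝ 2 (fun z : RelSpace N d => f (sqDistances m z))) :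
    relExpr m V (fun z : RelSpace N d => f (sqDistances m z)) y =
      radExpr d m V f (sqDistances m y) := by
  rw [relExpr, radExpr, half_laplacian_comp_sqDistances hm hf hφ, sqrt_sqDistances]

end ChainRule

/-! ### Invariant functions are smooth functions of the squared distances -/

section SmoothQuotient

variable {N d : ℕ} {m : Fin (N + 1) → ℝ}

lemma exists_shape_eq_of_mem_region (hd : N ≤ d) {C : Matrix (Fin N) (Fin N) ℝ} (hC : C.det ≠ 0)
    {ρ : Pair N → ℝ} (hρ : ρ ∈ region N) : ∃ y : RelSpace N d, shape C y = ρ := by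
  obtain ⟨y, hy⟩ := exists_shape_eq hd hC
  obtain ⟨D, -, h2, -⟩ := exists_ungram_mul_transpose hρ
  refine ⟨leftMul (C⁻¹ * (D * C)) y, ?_⟩
  rw [shape_leftMul, ← Matrix.mul_assoc, Matrix.mul_nonsing_inv _ hC.isUnit, Matrix.one_mul,
    ← congrHom_shape, hy, congrHom_ungram _ Matrix.transpose_one, Matrix.mul_one, ← h2]

/-! ### Smoothness of matrix-valued maps, entry by entry -/

section EntrywiseSmooth

variable {E : Type*} [NormedAddCommGroup E] [NormedSpace ℝ E] {n : WithTop ℕ∞}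

lemma contDiff_mul_apply {ι κ l : Type*} [Fintype κ] {A : E → Matrix ι κ ℝ} {B : E → Matrix κ l ℝ}
    (hA : ∀ i j, ContDiff ℝ n fun x => A x i j) (hB : ∀ i j, ContDiff ℝ n fun x => B x i j)
    (i : ι) (j : l) : ContDiff ℝ n fun x => (A x * B x) i j := by
  simp only [Matrix.mul_apply]
  exact ContDiff.sum fun k _ => (hA i k).mul (hB k j)

lemma contDiff_mul_const_apply {ι κ l : Type*} [Fintype κ] {A : E → Matrix ι κ ℝ}
    (B : Matrix κ l ℝ) (hA : ∀ i j, ContDiff ℝ n fun x => A x i j) (i : ι) (j : l) :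
    ContDiff ℝ n fun x => (A x * B) i j :=
  contDiff_mul_apply (B := fun _ => B) hA (fun _ _ => contDiff_const) i j

lemma contDiff_const_mul_apply {ι κ l : Type*} [Fintype κ] (A : Matrix ι κ ℝ)
    {B : E → Matrix κ l ℝ} (hB : ∀ i j, ContDiff ℝ n fun x => B x i j) (i : ι) (j : l) :
    ContDiff ℝ n fun x => (A * B x) i j :=
  contDiff_mul_apply (A := fun _ => A) (fun _ _ => contDiff_const) hB i j

lemma contDiff_ungram {A : E → Matrix (Fin N) (Fin N) ℝ}
    (hA : ∀ i j, ContDiff ℝ n fun x => A x i j) : ContDiff ℝ n fun x => ungram (A x) := by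
  have h : ∀ i j, ContDiff ℝ n fun x => border (A x) i j := by
    intro i j
    cases i using Fin.cases with
    | zero => simpa [border] using contDiff_const
    | succ a =>
      cases j using Fin.cases with
      | zero => simpa [border] using contDiff_const
      | succ b => simpa [border] using hA a b
  exact contDiff_pi.2 fun p => ((h _ _).add (h _ _)).sub (contDiff_const.mul (h _ _))

lemma contDiff_gram_apply (i j : Fin N) : ContDiff ℝ n fun ρ : Pair N → ℝ => gram ρ i j := by
  have h : ∀ i j, ContDiff ℝ n fun ρ : Pair N → ℝ => coord ρ i j := by
    intro i j
    unfold coord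
    split_ifs <;> fun_prop
  exact (((h _ _).add (h _ _)).sub (h _ _)).div_const _

end EntrywiseSmooth

/-- A deformation of the identity that moves a nondegenerate simplex to nearby ones. -/
def deform (ρ τ : Pair N → ℝ) : Matrix (Fin N) (Fin N) ℝ := 1 + (1 / 2 : ℝ) • (gram τ * (gram ρ)⁻¹)

lemma contDiff_deform_apply {n : WithTop ℕ∞} (ρ : Pair N → ℝ) (i j : Fin N) :
    ContDiff ℝ n fun τ => deform ρ τ i j := by
  simp only [deform, Matrix.add_apply, Matrix.smul_apply]
  exact contDiff_const.add
    ((contDiff_mul_const_apply (A := gram) _ contDiff_gram_apply i j).const_smul _)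

/-- With `G` and `T` the Gram matrices of `ρ` and `τ`, expanding `(1 + ½ T G⁻¹) G (1 + ½ G⁻¹ T)`
gives `G + T + ¼ T G⁻¹ T`. The error is quadratic in `τ`, so the map has derivative the identity at
`0`. -/
lemma congrHom_deform {ρ : Pair N → ℝ} (hρ : ρ ∈ region N) (τ : Pair N → ℝ) :
    congrHom (deform ρ τ) ρ =
      ρ + τ + (1 / 4 : ℝ) • ungram (gram τ * (gram ρ)⁻¹ * gram τ) := by
  have hu : IsUnit (gram ρ).det := (show (gram ρ).PosDef from hρ).det_pos.ne'.isUnit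
  have hs : ((gram ρ)⁻¹).transpose = (gram ρ)⁻¹ := by
    rw [Matrix.transpose_nonsing_inv, gram_transpose]
  change ungram _ = _
  have h1 : deform ρ τ * gram ρ * (deform ρ τ).transpose = gram ρ + gram τ +
      (1 / 4 : ℝ) • (gram τ * (gram ρ)⁻¹ * gram τ) := by
    have e1 : deform ρ τ * gram ρ = gram ρ + (1 / 2 : ℝ) • gram τ := by
      rw [deform, add_mul, Matrix.one_mul, Matrix.smul_mul, Matrix.mul_assoc,
        Matrix.nonsing_inv_mul _ hu, Matrix.mul_one]
    have e2 : (deform ρ τ).transpose = 1 + (1 / 2 : ℝ) • ((gram ρ)⁻¹ * gram τ) := by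
      rw [deform, Matrix.transpose_add, Matrix.transpose_one, Matrix.transpose_smul,
        Matrix.transpose_mul, hs, gram_transpose]
    rw [e1, e2, mul_add, Matrix.mul_one, Matrix.mul_smul, add_mul, ← Matrix.mul_assoc,
      Matrix.mul_nonsing_inv _ hu, Matrix.one_mul, Matrix.smul_mul, ← Matrix.mul_assoc]
    module
  rw [h1, map_add, map_add, map_smul, ungram_gram, ungram_gram]

lemma fderiv_zero_eq_zero_of_quadratic {E : Type*} [NormedAddCommGroup E] [NormedSpace ℝ E]
    {q : E → E} (hqd : DifferentiableAt ℝ q 0) (hq : ∀ (t : ℝ) τ, q (t • τ) = t ^ 2 • q τ) :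
    fderiv ℝ q 0 = 0 := by
  ext1 τ
  have h1 : HasDerivAt (fun t : ℝ => t • τ) τ 0 := by
    simpa using (hasDerivAt_id (0 : ℝ)).smul_const τ
  have h2 : HasDerivAt (fun t : ℝ => q (t • τ)) (fderiv ℝ q 0 τ) 0 := by
    have h3 : HasFDerivAt q (fderiv ℝ q 0) ((0 : ℝ) • τ) := by
      rw [zero_smul]
      exact hqd.hasFDerivAt
    exact h3.comp_hasDerivAt 0 h1
  have h4 : HasDerivAt (fun t : ℝ => t ^ 2 • q τ) 0 0 := by
    simpa using (hasDerivAt_pow 2 (0 : ℝ)).smul_const (q τ)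
  simp only [hq] at h2
  simpa using h2.unique h4

lemma hasFDerivAt_congrHom_deform {ρ : Pair N → ℝ} (hρ : ρ ∈ region N) :
    HasFDerivAt (fun τ => congrHom (deform ρ τ) ρ)
      ((ContinuousLinearEquiv.refl ℝ (Pair N → ℝ) : (Pair N → ℝ) ≃L[ℝ] (Pair N → ℝ)) :
        (Pair N → ℝ) →L[ℝ] (Pair N → ℝ)) 0 := by
  set q : (Pair N → ℝ) → (Pair N → ℝ) :=
    fun τ => (1 / 4 : ℝ) • ungram (gram τ * (gram ρ)⁻¹ * gram τ) with hq
  have hqs : ContDiff ℝ 1 q := by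
    have h1 : ∀ i j, ContDiff ℝ 1 fun τ : Pair N → ℝ => (gram τ * (gram ρ)⁻¹) i j :=
      contDiff_mul_const_apply _ contDiff_gram_apply
    have h2 : ∀ i j, ContDiff ℝ 1 fun τ : Pair N → ℝ => (gram τ * (gram ρ)⁻¹ * gram τ) i j :=
      contDiff_mul_apply h1 contDiff_gram_apply
    exact (contDiff_ungram h2).const_smul (1 / 4 : ℝ)
  have hqd := (hqs.differentiable (by norm_num) 0).hasFDerivAt
  have hhom : ∀ (t : ℝ) τ, q (t • τ) = t ^ 2 • q τ := by
    intro t τ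
    simp only [hq, gram_smul, Matrix.smul_mul, Matrix.mul_smul, map_smul, smul_smul]
    congr 1
    ring
  have hzero : fderiv ℝ q 0 = 0 :=
    fderiv_zero_eq_zero_of_quadratic (hqs.differentiable (by norm_num) 0) hhom
  rw [hzero] at hqd
  simp only [congrHom_deform hρ]
  have h5 := ((hasFDerivAt_id (𝕜 := ℝ) (0 : Pair N → ℝ)).const_add ρ).add hqd
  rw [add_zero] at h5
  exact h5

/-- A rotation invariant function is a function of the squared distances, which inherits its
smoothness on the radial configuration space. -/
lemma exists_comp_sqDistances_eq (hm : ∀ i, 0 < m i) (hd : N ≤ d) {φ : RelSpace N d → ℂ}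
    (hφ : ContDiff ℝ ∞ φ)
    (hinv : ∀ A ∈ Matrix.orthogonalGroup (Fin d) ℝ, ∀ y, φ (rotate A y) = φ y) :
    ∃ f : (Pair N → ℝ) → ℂ, (∀ y, f (sqDistances m y) = φ y) ∧
      ∀ ρ ∈ region N, ContDiffAt ℝ ∞ f ρ := by
  classical
  have hC := det_posMat_ne_zero hm
  -- The choice of configuration is immaterial, since two with the same squared distances differ by
  -- a rotation. The default value `0` plays no role on the region, all of whose points are
  -- attained.
  set f : (Pair N → ℝ) → ℂ :=
    fun ρ => if h : ∃ y : RelSpace N d, sqDistances m y = ρ then φ h.choose else 0 with hf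
  have hfφ : ∀ y, f (sqDistances m y) = φ y := by
    intro y
    have hex : ∃ z : RelSpace N d, sqDistances m z = sqDistances m y := ⟨y, rfl⟩
    simp only [hf, dif_pos hex]
    obtain ⟨A, hA, hAy⟩ := exists_rotate_eq hm hex.choose_spec
    rw [← hinv A hA, hAy]
  refine ⟨f, hfφ, fun ρ hρ => ?_⟩
  obtain ⟨y, hy⟩ := exists_shape_eq_of_mem_region (d := d) hd hC hρ
  set Ξ : (Pair N → ℝ) → (Pair N → ℝ) := fun τ => congrHom (deform ρ τ) ρ with hΞ
  have hΞ0 : Ξ 0 = ρ := by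
    simp only [hΞ, congrHom_deform hρ]
    have h0 : gram (0 : Pair N → ℝ) = 0 := by simpa using gram_smul 0 (0 : Pair N → ℝ)
    simp [h0]
  -- A smooth family of configurations through `y` that realises the shapes `Ξ τ`. With a local
  -- inverse of `Ξ` it becomes a smooth section of the squared distances near `ρ`, along which `f`
  -- is `φ`.
  set z : (Pair N → ℝ) → RelSpace N d :=
    fun τ => leftMul ((posMat m)⁻¹ * (deform ρ τ * posMat m)) y with hz
  have hΞz : ∀ τ, sqDistances m (z τ) = Ξ τ := by
    intro τ
    rw [sqDistances_eq_shape, shape_leftMul, ← Matrix.mul_assoc,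
      Matrix.mul_nonsing_inv _ hC.isUnit, Matrix.one_mul, ← congrHom_shape, hy]
  have hzs : ContDiff ℝ ∞ z := by
    rw [contDiff_euclidean]
    intro p
    refine contDiff_mul_apply (B := fun _ => toMat y) (fun i j => ?_) (fun _ _ => contDiff_const)
      p.1 p.2
    exact contDiff_const_mul_apply (posMat m)⁻¹ (B := fun τ => deform ρ τ * posMat m)
      (contDiff_mul_const_apply _ (contDiff_deform_apply ρ)) i j
  have hΞs : ContDiff ℝ ∞ Ξ := by
    refine contDiff_ungram fun i j => contDiff_mul_apply (fun i j => ?_) (fun i j => ?_) i j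
    · exact contDiff_mul_const_apply _ (contDiff_deform_apply ρ) i j
    · exact contDiff_deform_apply ρ j i
  have hd0 := hasFDerivAt_congrHom_deform hρ
  have hn : (∞ : WithTop ℕ∞) ≠ 0 := by simp
  have hg := hΞs.contDiffAt.to_localInverse (a := 0) hd0 hn
  have hr := (hΞs.contDiffAt.hasStrictFDerivAt' hd0 hn).eventually_right_inverse
  change ContDiffAt ℝ ∞ _ (Ξ 0) at hg
  rw [hΞ0] at hg
  have hcomp : ContDiffAt ℝ ∞
      (fun σ => φ (z (hΞs.contDiffAt.localInverse (a := 0) hd0 hn σ))) ρ :=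
    (hφ.comp hzs).contDiffAt.comp ρ hg
  refine hcomp.congr_of_eventuallyEq ?_
  change ∀ᶠ σ in nhds (Ξ 0), Ξ _ = σ at hr
  rw [hΞ0] at hr
  filter_upwards [hr] with σ hσ
  have h1 : Ξ (hΞs.contDiffAt.localInverse (a := 0) hd0 hn σ) = σ := hσ
  rw [← hfφ, hΞz, h1]

end SmoothQuotient

/-! ### Integrals of composites with a compact family of linear maps -/

section ParametricIntegral

variable {G : Type} [TopologicalSpace G] {E : Type} [NormedAddCommGroup E] [NormedSpace ℝ E]
  {F F' : Type} [NormedAddCommGroup F] [NormedSpace ℝ F] [NormedAddCommGroup F'] [NormedSpace ℝ F']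

/-- The family of linear maps that turns the derivative of `φ` at `L a y` into the derivative of
`y ↦ M a (φ (L a y))`. -/
def derivFamily (L : G → E →L[ℝ] E) (M : G → F →L[ℝ] F') (a : G) :
    (E →L[ℝ] F) →L[ℝ] (E →L[ℝ] F') :=
  (ContinuousLinearMap.compL ℝ E F F' (M a)) ∘L ((ContinuousLinearMap.compL ℝ E E F).flip (L a))

lemma continuous_derivFamily {L : G → E →L[ℝ] E} {M : G → F →L[ℝ] F'} (hL : Continuous L)
    (hM : Continuous M) : Continuous (derivFamily L M) :=
  ((ContinuousLinearMap.continuous _).comp hM).clm_comp ((ContinuousLinearMap.continuous _).comp hL)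

lemma continuous_family {L : G → E →L[ℝ] E} {M : G → F →L[ℝ] F'} (hL : Continuous L)
    (hM : Continuous M) {φ : E → F} (hφ : Continuous φ) :
    Continuous fun p : G × E => M p.1 (φ (L p.1 p.2)) :=
  (hM.comp continuous_fst).clm_apply
    (hφ.comp ((hL.comp continuous_fst).clm_apply continuous_snd))

variable [CompactSpace G] [MeasurableSpace G] [BorelSpace G]
  {μ : Measure G} [IsFiniteMeasure μ]

lemma integrable_family {L : G → E →L[ℝ] E} {M : G → F →L[ℝ] F'} (hL : Continuous L)
    (hM : Continuous M) {φ : E → F} (hφ : Continuous φ) (y : E) :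
    Integrable (fun a => M a (φ (L a y))) μ :=
  ((continuous_family hL hM hφ).comp (Continuous.prodMk_left y)).integrable_of_hasCompactSupport
    (HasCompactSupport.of_compactSpace _)

variable [FiniteDimensional ℝ E]

/-- The derivative of the integrand is jointly continuous, so on the compact product of `G` with a
closed ball a constant dominates it. -/
lemma hasFDerivAt_integral_family {L : G → E →L[ℝ] E} {M : G → F →L[ℝ] F'} (hL : Continuous L)
    (hM : Continuous M) {φ : E → F} (hφ : ContDiff ℝ 1 φ) (y : E) :
    HasFDerivAt (fun y => ∫ a, M a (φ (L a y)) ∂μ)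
      (∫ a, derivFamily L M a (fderiv ℝ φ (L a y)) ∂μ) y := by
  have hφ' : Continuous (fderiv ℝ φ) := hφ.continuous_fderiv (by norm_num)
  have hc := continuous_family hL (continuous_derivFamily hL hM) hφ'
  obtain ⟨C, hC⟩ := (isCompact_univ.prod (isCompact_closedBall y 1)).exists_bound_of_continuousOn
    hc.continuousOn
  refine hasFDerivAt_integral_of_dominated_of_fderiv_le (bound := fun _ => C)
    (F' := fun y a => derivFamily L M a (fderiv ℝ φ (L a y)))
    (Metric.closedBall_mem_nhds y one_pos) ?_ (integrable_family hL hM hφ.continuous y)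
    (integrable_family hL (continuous_derivFamily hL hM) hφ' y).aestronglyMeasurable ?_
    (integrable_const C) ?_
  · exact Filter.Eventually.of_forall fun z =>
      (integrable_family hL hM hφ.continuous z).aestronglyMeasurable
  · exact Filter.Eventually.of_forall fun a z hz => hC (a, z) ⟨trivial, hz⟩
  · refine Filter.Eventually.of_forall fun a z _ => ?_
    exact (M a).hasFDerivAt.comp z
      ((hφ.differentiable (by norm_num) (L a z)).hasFDerivAt.comp z (L a).hasFDerivAt)

/-- Integrands of the form `M a (φ (L a y))` are closed under differentiation in `y`. The target
spaces change at each step, so the induction is uniform in `F`, `F'`, `M` and `φ`. -/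
lemma contDiff_integral_family {L : G → E →L[ℝ] E} (hL : Continuous L) (n : ℕ) :
    ∀ {F F' : Type} [NormedAddCommGroup F] [NormedSpace ℝ F] [NormedAddCommGroup F']
      [NormedSpace ℝ F'] {M : G → F →L[ℝ] F'} (_ : Continuous M) {φ : E → F} (_ : ContDiff ℝ ∞ φ),
      ContDiff ℝ n fun y => ∫ a, M a (φ (L a y)) ∂μ := by
  induction n with
  | zero =>
    intro F F' _ _ _ _ M hM φ hφ
    refine contDiff_zero.2 (continuous_iff_continuousAt.2 fun y => ?_)
    exact (hasFDerivAt_integral_family hL hM (hφ.of_le (by exact_mod_cast le_top)) y).continuousAt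
  | succ n ih =>
    intro F F' _ _ _ _ M hM φ hφ
    have h : ContDiff ℝ ((n : WithTop ℕ∞) + 1) fun y => ∫ a, M a (φ (L a y)) ∂μ := by
      rw [contDiff_succ_iff_hasFDerivAt]
      exact ⟨_, ih (continuous_derivFamily hL hM) (hφ.fderiv_right (by simp)),
        fun y => hasFDerivAt_integral_family hL hM (hφ.of_le (by exact_mod_cast le_top)) y⟩
    exact_mod_cast h

end ParametricIntegral


/-! ### Averages over the orthogonal group -/

section Average

variable {N d : ℕ}

/-- The orthogonal group of `ℝ^d`. -/
abbrev OGroup (d : ℕ) : Type := Matrix.orthogonalGroup (Fin d) ℝ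

instance : SecondCountableTopology (OGroup d) :=
  haveI : SecondCountableTopology (Matrix (Fin d) (Fin d) ℝ) :=
    inferInstanceAs (SecondCountableTopology (Fin d → Fin d → ℝ))
  TopologicalSpace.Subtype.secondCountableTopology _

instance : MeasurableSpace (OGroup d) := borel _

instance : BorelSpace (OGroup d) := ⟨rfl⟩

instance : CompactSpace (OGroup d) := by
  refine (isCompact_iff_compactSpace
    (s := (Matrix.orthogonalGroup (Fin d) ℝ : Set (Matrix (Fin d) (Fin d) ℝ)))).1 ?_
  have h1 : IsCompact (Set.univ.pi fun _ => Set.univ.pi fun _ => Set.Icc (-1) 1 :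
      Set (Fin d → Fin d → ℝ)) :=
    isCompact_univ_pi fun _ => isCompact_univ_pi fun _ => isCompact_Icc
  refine IsCompact.of_isClosed_subset (X := Matrix (Fin d) (Fin d) ℝ) h1 isClosed_unitary ?_
  intro A hA i _ j _
  have := entry_norm_bound_of_unitary (𝕜 := ℝ) hA i j
  exact abs_le.1 this

/-- The invariant probability measure of the orthogonal group. -/
def haarProb (d : ℕ) : Measure (OGroup d) := Measure.haarMeasure ⊤

instance : IsProbabilityMeasure (haarProb d) := ⟨Measure.haarMeasure_self⟩

instance : (haarProb d).IsMulLeftInvariant :=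
  inferInstanceAs ((Measure.haarMeasure (⊤ : TopologicalSpace.PositiveCompacts (OGroup d))).IsMulLeftInvariant)

/-- The action of an orthogonal matrix on the space of relative motion is isometric. -/
def rotateIsometry (A : OGroup d) : RelSpace N d ≃ₗᵢ[ℝ] RelSpace N d :=
  LinearIsometry.toLinearIsometryEquiv
    { toLinearMap := rotateHom (A : Matrix (Fin d) (Fin d) ℝ)
      norm_map' := fun y => by
        have h : ∀ z : RelSpace N d, ‖z‖ ^ 2 = (toMat z * (toMat z).transpose).trace := by
          intro z
          rw [EuclideanSpace.norm_sq_eq]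
          simp only [Matrix.trace, Matrix.diag, Matrix.mul_apply, Matrix.transpose_apply,
            Fintype.sum_prod_type, toMat, Matrix.of_apply, Real.norm_eq_abs, sq_abs, ← sq]
        have h2 : ‖rotate (A : Matrix (Fin d) (Fin d) ℝ) y‖ ^ 2 = ‖y‖ ^ 2 := by
          rw [h, h, toMat_rotate, Matrix.transpose_mul, Matrix.transpose_transpose,
            Matrix.mul_assoc, ← Matrix.mul_assoc _ (A : Matrix (Fin d) (Fin d) ℝ),
            transpose_mul_self_of_mem_orthogonalGroup A.2, Matrix.one_mul]
        exact (sq_eq_sq₀ (norm_nonneg _) (norm_nonneg _)).1 h2 } rfl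

lemma rotateIsometry_apply (A : OGroup d) (y : RelSpace N d) :
    rotateIsometry A y = rotate (A : Matrix (Fin d) (Fin d) ℝ) y := rfl

lemma continuous_rotate :
    Continuous fun p : OGroup d × RelSpace N d => rotate (p.1 : Matrix (Fin d) (Fin d) ℝ) p.2 := by
  have h : Continuous fun p : OGroup d × RelSpace N d => fun q : Fin N × Fin d =>
      (p.1 : Matrix (Fin d) (Fin d) ℝ).mulVec (fun s => p.2 (q.1, s)) q.2 := by
    refine continuous_pi fun q => ?_
    refine (continuous_apply q.2).comp (Continuous.matrix_mulVec
      (continuous_subtype_val.comp continuous_fst) (continuous_pi fun s => ?_))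
    exact (by fun_prop : Continuous fun y : RelSpace N d => y (q.1, s)).comp continuous_snd
  exact (PiLp.continuous_toLp 2 _).comp h

/-- The inverse rotations as a family of continuous linear maps. -/
def rotateInv (A : OGroup d) : RelSpace N d →L[ℝ] RelSpace N d :=
  (rotateIsometry (N := N) A⁻¹).toContinuousLinearEquiv.toContinuousLinearMap

lemma continuous_rotateInv : Continuous (rotateInv : OGroup d → RelSpace N d →L[ℝ] RelSpace N d) := by
  rw [continuous_clm_apply]
  intro y
  exact continuous_rotate.comp ((continuous_inv (G := OGroup d)).prodMk continuous_const)

/-- The average of a function over the orthogonal group. -/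
def average (φ : RelSpace N d → ℂ) (y : RelSpace N d) : ℂ :=
  ∫ A : OGroup d, φ (rotateIsometry A⁻¹ y) ∂(haarProb d)

/-- The inverse in the definition of `average` makes left invariance of the measure the right tool:
`(B A)⁻¹ B = A⁻¹`. -/
lemma average_rotate (φ : RelSpace N d → ℂ) (B : OGroup d) (y : RelSpace N d) :
    average φ (rotateIsometry B y) = average φ y := by
  rw [average, ← integral_mul_left_eq_self _ B]
  refine integral_congr_ae (Filter.Eventually.of_forall fun A => ?_)
  simp only [rotateIsometry_apply, ← rotate_mul, ← Submonoid.coe_mul]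
  congr 3
  group

lemma average_eq (φ : RelSpace N d → ℂ) : average φ = fun y => ∫ A : OGroup d,
    (ContinuousLinearMap.id ℝ ℂ) (φ (rotateInv A y)) ∂(haarProb d) := rfl

lemma contDiff_average {φ : RelSpace N d → ℂ} (hφ : ContDiff ℝ ∞ φ) :
    ContDiff ℝ ∞ (average φ) := by
  rw [average_eq, contDiff_infty]
  exact fun n => contDiff_integral_family continuous_rotateInv n
    (M := fun _ => ContinuousLinearMap.id ℝ ℂ) continuous_const hφ

lemma hasCompactSupport_average {φ : RelSpace N d → ℂ} (hφ : HasCompactSupport φ) :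
    HasCompactSupport (average φ) := by
  obtain ⟨R, hR⟩ := hφ.isCompact.isBounded.subset_closedBall 0
  refine HasCompactSupport.intro (isCompact_closedBall (0 : RelSpace N d) R) fun y hy => ?_
  rw [average]
  refine integral_eq_zero_of_ae (Filter.Eventually.of_forall fun A => ?_)
  refine image_eq_zero_of_notMem_tsupport fun h => hy ?_
  have := hR h
  simpa using this

/-- After differentiation under the integral, the second derivatives are evaluated on a rotated
orthonormal basis, and the Laplacian may be computed in any such basis. -/
lemma laplacian_average {φ : RelSpace N d → ℂ} (hφ : ContDiff ℝ ∞ φ) (y : RelSpace N d) :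
    Δ (average φ) y = average (Δ φ) y := by
  have hM : Continuous fun _ : OGroup d => ContinuousLinearMap.id ℝ ℂ := continuous_const
  have hL := continuous_rotateInv (N := N) (d := d)
  have h1 : ContDiff ℝ 1 φ := hφ.of_le (by exact_mod_cast le_top)
  have h2 : ContDiff ℝ 1 (fderiv ℝ φ) :=
    hφ.fderiv_right (WithTop.coe_le_coe.2 (le_top : (1 + 1 : ℕ∞) ≤ ⊤))
  have hM' := continuous_derivFamily hL hM
  have e1 : fderiv ℝ (average φ) = fun y => ∫ A : OGroup d,
      derivFamily rotateInv (fun _ => ContinuousLinearMap.id ℝ ℂ) A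
        (fderiv ℝ φ (rotateInv A y)) ∂(haarProb d) :=
    funext fun y => (hasFDerivAt_integral_family hL hM h1 y).fderiv
  have e2 := (hasFDerivAt_integral_family (μ := haarProb d) hL hM' h2 y).fderiv
  have hI := integrable_family (μ := haarProb d) hL (continuous_derivFamily hL hM')
    (h2.continuous_fderiv (by norm_num)) y
  set v := EuclideanSpace.basisFun (Fin N × Fin d) ℝ
  rw [laplacian_eq_sum_fderiv v, e1, e2, average]
  have e3 : ∀ i, (∫ A : OGroup d, derivFamily rotateInv (derivFamily rotateInv
      (fun _ => ContinuousLinearMap.id ℝ ℂ)) A (fderiv ℝ (fderiv ℝ φ) (rotateInv A y))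
        ∂(haarProb d)) (v i) (v i) = ∫ A : OGroup d, fderiv ℝ (fderiv ℝ φ)
          (rotateIsometry A⁻¹ y) (rotateIsometry A⁻¹ (v i)) (rotateIsometry A⁻¹ (v i))
            ∂(haarProb d) := by
    intro i
    rw [ContinuousLinearMap.integral_apply hI, ContinuousLinearMap.integral_apply
      (hI.apply_continuousLinearMap _)]
    rfl
  simp only [e3]
  rw [← integral_finsetSum]
  · refine integral_congr_ae (Filter.Eventually.of_forall fun A => ?_)
    have := laplacian_eq_sum_fderiv (v.map (rotateIsometry A⁻¹)) φ (rotateIsometry A⁻¹ y)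
    simp only [OrthonormalBasis.map_apply] at this
    exact this.symm
  · intro i _
    exact (hI.apply_continuousLinearMap (v i)).apply_continuousLinearMap (v i)

lemma integrable_comp_rotate {φ : RelSpace N d → ℂ} (hφ : Continuous φ) (y : RelSpace N d) :
    Integrable (fun A : OGroup d => φ (rotateIsometry A⁻¹ y)) (haarProb d) :=
  integrable_family (M := fun _ => ContinuousLinearMap.id ℝ ℂ) continuous_rotateInv continuous_const
    hφ y

lemma continuous_laplacian {φ : RelSpace N d → ℂ} (hφ : ContDiff ℝ ∞ φ) : Continuous (Δ φ) := by
  have h2 : Continuous (fderiv ℝ (fderiv ℝ φ)) :=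
    (hφ.fderiv_right (m := 1)
      (WithTop.coe_le_coe.2 (le_top : (1 + 1 : ℕ∞) ≤ ⊤))).continuous_fderiv (by norm_num)
  have : Δ φ = fun y => ∑ i, fderiv ℝ (fderiv ℝ φ) y
      (EuclideanSpace.basisFun (Fin N × Fin d) ℝ i)
      (EuclideanSpace.basisFun (Fin N × Fin d) ℝ i) :=
    funext (laplacian_eq_sum_fderiv _ φ)
  rw [this]
  fun_prop

/-- The potential depends on the distances alone, so it is constant along orbits and leaves the
integral. -/
lemma relExpr_average {m : Fin (N + 1) → ℝ} {V : (Pair N → ℝ) → ℝ} {φ : RelSpace N d → ℂ}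
    (hφ : ContDiff ℝ ∞ φ) (y : RelSpace N d) :
    relExpr m V (average φ) y = average (relExpr m V φ) y := by
  have hc := continuous_laplacian hφ
  have hV : ∀ A : OGroup d, distances m (rotateIsometry A⁻¹ y) = distances m y :=
    fun A => distances_rotate m (A⁻¹).2 y
  rw [relExpr, laplacian_average hφ]
  simp only [average, relExpr, hV]
  rw [integral_add, integral_neg, integral_const_mul, integral_const_mul]
  · exact ((integrable_comp_rotate hc y).const_mul _).neg
  · exact (integrable_comp_rotate hφ.continuous y).const_mul _

end Average

/-! ### Composition with a map that scales measures -/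

section Pullback

variable {X Y : Type*} [MeasurableSpace X] [MeasurableSpace Y] {Φ : X → Y} {μ : Measure X}
  {ν : Measure Y} {c : ℝ}

/-- The map `Φ` pushes `μ` forward to `c` times `ν`. -/
structure IsScaledPushforward (Φ : X → Y) (μ : Measure X) (ν : Measure Y) (c : ℝ) : Prop where
  measurable : Measurable Φ
  pos : 0 < c
  map_eq : Measure.map Φ μ = ENNReal.ofReal c • ν

namespace IsScaledPushforward

lemma ae_comp (h : IsScaledPushforward Φ μ ν c) {p : Y → Prop} (hp : ∀ᵐ y ∂ν, p y) :
    ∀ᵐ x ∂μ, p (Φ x) :=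
  ae_of_ae_map h.measurable.aemeasurable (by rw [h.map_eq]; exact Measure.ae_smul_measure hp _)

lemma memLp_comp (h : IsScaledPushforward Φ μ ν c) {g : Y → ℂ} (hg : MemLp g 2 ν) :
    MemLp (fun x => g (Φ x)) 2 μ := by
  have h1 : MemLp g 2 (Measure.map Φ μ) := by
    rw [h.map_eq]; exact hg.smul_measure ENNReal.ofReal_ne_top
  exact h1.comp_of_map h.measurable.aemeasurable

lemma integral_comp (h : IsScaledPushforward Φ μ ν c) {g : Y → ℂ} (hg : AEStronglyMeasurable g ν) :
    ∫ x, g (Φ x) ∂μ = (c : ℂ) * ∫ y, g y ∂ν := by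
  have h1 : AEStronglyMeasurable g (Measure.map Φ μ) := by
    rw [h.map_eq]; exact hg.smul_measure _
  rw [← integral_map h.measurable.aemeasurable h1, h.map_eq, integral_smul_measure,
    ENNReal.toReal_ofReal h.pos.le, Complex.real_smul]

lemma restrict (h : IsScaledPushforward Φ μ ν c) {s : Set Y} (hs : MeasurableSet s) :
    IsScaledPushforward Φ (μ.restrict (Φ ⁻¹' s)) (ν.restrict s) c where
  measurable := h.measurable
  pos := h.pos
  map_eq := by rw [← Measure.restrict_map h.measurable hs, h.map_eq, Measure.restrict_smul]

lemma integrable_comp_iff (h : IsScaledPushforward Φ μ ν c) {g : Y → ℂ}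
    (hg : AEStronglyMeasurable g ν) : Integrable (fun x => g (Φ x)) μ ↔ Integrable g ν := by
  have h1 : AEStronglyMeasurable g (Measure.map Φ μ) := by
    rw [h.map_eq]; exact hg.smul_measure _
  have h2 := integrable_map_measure h1 h.measurable.aemeasurable
  rw [h.map_eq, integrable_smul_measure (by simpa using h.pos) ENNReal.ofReal_ne_top] at h2
  exact h2.symm

/-- Composition with `Φ`, as a linear map between `L²` spaces. -/
def pullbackLinear (h : IsScaledPushforward Φ μ ν c) : Lp ℂ 2 ν →ₗ[ℂ] Lp ℂ 2 μ where
  toFun f := (h.memLp_comp (Lp.memLp f)).toLp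
  map_add' f g := by
    refine Lp.ext ?_
    filter_upwards [(h.memLp_comp (Lp.memLp (f + g))).coeFn_toLp,
      (h.memLp_comp (Lp.memLp f)).coeFn_toLp, (h.memLp_comp (Lp.memLp g)).coeFn_toLp,
      Lp.coeFn_add (h.memLp_comp (Lp.memLp f)).toLp (h.memLp_comp (Lp.memLp g)).toLp,
      h.ae_comp (Lp.coeFn_add f g)] with x h1 h2 h3 h4 h5
    rw [h1, h4, Pi.add_apply, h2, h3, h5, Pi.add_apply]
  map_smul' a f := by
    refine Lp.ext ?_
    filter_upwards [(h.memLp_comp (Lp.memLp (a • f))).coeFn_toLp,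
      (h.memLp_comp (Lp.memLp f)).coeFn_toLp,
      Lp.coeFn_smul a (h.memLp_comp (Lp.memLp f)).toLp,
      h.ae_comp (Lp.coeFn_smul a f)] with x h1 h2 h4 h5
    rw [RingHom.id_apply, h1, h4, Pi.smul_apply, h2, h5, Pi.smul_apply]

lemma coeFn_pullbackLinear (h : IsScaledPushforward Φ μ ν c) (f : Lp ℂ 2 ν) :
    h.pullbackLinear f =ᵐ[μ] fun x => f (Φ x) := (h.memLp_comp (Lp.memLp f)).coeFn_toLp

lemma inner_pullbackLinear (h : IsScaledPushforward Φ μ ν c) (f g : Lp ℂ 2 ν) :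
    inner ℂ (h.pullbackLinear f) (h.pullbackLinear g) = (c : ℂ) * inner ℂ f g := by
  rw [L2.inner_def, L2.inner_def, ← h.integral_comp (L2.integrable_inner f g).aestronglyMeasurable]
  refine integral_congr_ae ?_
  filter_upwards [h.coeFn_pullbackLinear f, h.coeFn_pullbackLinear g] with x h1 h2
  rw [h1, h2]

lemma norm_pullbackLinear (h : IsScaledPushforward Φ μ ν c) (f : Lp ℂ 2 ν) :
    ‖h.pullbackLinear f‖ = √c * ‖f‖ := by
  have h1 : ‖h.pullbackLinear f‖ ^ 2 = (√c * ‖f‖) ^ 2 := by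
    rw [mul_pow, Real.sq_sqrt h.pos.le, @norm_sq_eq_re_inner ℂ, @norm_sq_eq_re_inner ℂ _ _ _ _ f,
      inner_pullbackLinear]
    simp
  exact (sq_eq_sq₀ (norm_nonneg _) (by positivity)).1 h1

/-- Composition with `Φ`, as a continuous linear map between `L²` spaces. -/
def pullback (h : IsScaledPushforward Φ μ ν c) : Lp ℂ 2 ν →L[ℂ] Lp ℂ 2 μ :=
  h.pullbackLinear.mkContinuous (√c) fun f => (h.norm_pullbackLinear f).le

lemma coeFn_pullback (h : IsScaledPushforward Φ μ ν c) (f : Lp ℂ 2 ν) :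
    h.pullback f =ᵐ[μ] fun x => f (Φ x) := h.coeFn_pullbackLinear f

/-- The left inverse of the pullback that is proportional to its adjoint. -/
def pushforward (h : IsScaledPushforward Φ μ ν c) : Lp ℂ 2 μ →L[ℂ] Lp ℂ 2 ν :=
  ((c : ℂ)⁻¹) • ContinuousLinearMap.adjoint h.pullback

lemma inner_pullback (h : IsScaledPushforward Φ μ ν c) (k : Lp ℂ 2 ν) (v : Lp ℂ 2 μ) :
    inner ℂ (h.pullback k) v = (c : ℂ) * inner ℂ k (h.pushforward v) := by
  have hc : (c : ℂ) ≠ 0 := by exact_mod_cast h.pos.ne'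
  rw [pushforward, _root_.smul_apply, inner_smul_right,
    ContinuousLinearMap.adjoint_inner_right, mul_inv_cancel_left₀ hc]

lemma pushforward_pullback (h : IsScaledPushforward Φ μ ν c) (k : Lp ℂ 2 ν) :
    h.pushforward (h.pullback k) = k := by
  have hc : (c : ℂ) ≠ 0 := by exact_mod_cast h.pos.ne'
  refine ext_inner_left ℂ fun l => mul_left_cancel₀ hc ?_
  rw [← inner_pullback]
  exact h.inner_pullbackLinear l k

lemma measure_preimage_ne_top (h : IsScaledPushforward Φ μ ν c) {s : Set Y} (hs : MeasurableSet s)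
    (hsf : ν s < ⊤) : μ (Φ ⁻¹' s) ≠ ⊤ := by
  rw [← Measure.map_apply h.measurable hs, h.map_eq, Measure.smul_apply, smul_eq_mul]
  exact ENNReal.mul_ne_top ENNReal.ofReal_ne_top hsf.ne

/-- This is `inner_pullback` tested on the indicator of `s`, whose pullback is the indicator of the
preimage. It exhibits `pushforward` as a conditional expectation. -/
lemma setIntegral_preimage (h : IsScaledPushforward Φ μ ν c) (v : Lp ℂ 2 μ) {s : Set Y}
    (hs : MeasurableSet s) (hsf : ν s < ⊤) :
    ∫ x in Φ ⁻¹' s, v x ∂μ = (c : ℂ) * ∫ y in s, h.pushforward v y ∂ν := by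
  have h1 := h.inner_pullback (indicatorConstLp 2 hs hsf.ne (1 : ℂ)) v
  rw [L2.inner_indicatorConstLp_one] at h1
  rw [← h1, L2.inner_def, ← integral_indicator (h.measurable hs)]
  refine integral_congr_ae ?_
  filter_upwards [h.coeFn_pullback (indicatorConstLp 2 hs hsf.ne (1 : ℂ)),
    h.ae_comp (indicatorConstLp_coeFn (p := 2) (hs := hs) (hμs := hsf.ne) (c := (1 : ℂ)))]
    with x h2 h3
  rw [h2, h3]
  by_cases hx : Φ x ∈ s
  · have hx' : x ∈ Φ ⁻¹' s := hx
    simp [hx]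
  · have hx' : x ∉ Φ ⁻¹' s := hx
    simp [hx]

/-- The pushforward is determined by its integrals over sets of finite measure. -/
lemma pushforward_ae_eq [SigmaFinite ν] (h : IsScaledPushforward Φ μ ν c) {v : Lp ℂ 2 μ} {g : Y → ℂ}
    (hgi : ∀ s, MeasurableSet s → ν s < ⊤ → IntegrableOn g s ν)
    (hg : ∀ s, MeasurableSet s → ν s < ⊤ →
      ∫ x in Φ ⁻¹' s, v x ∂μ = (c : ℂ) * ∫ y in s, g y ∂ν) :
    h.pushforward v =ᵐ[ν] g := by
  have hc : (c : ℂ) ≠ 0 := by exact_mod_cast h.pos.ne'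
  refine ae_eq_of_forall_setIntegral_eq_of_sigmaFinite (fun s hs hsf => ?_) hgi
    fun s hs hsf => mul_left_cancel₀ hc ?_
  · exact integrableOn_Lp_of_measure_ne_top _ (by norm_num) hsf.ne
  · rw [← h.setIntegral_preimage v hs hsf, hg s hs hsf]

end IsScaledPushforward

end Pullback

/-! ### The restricted Hamiltonian as a compression -/

section Compression

variable {N d : ℕ} {m : Fin (N + 1) → ℝ} {V : (Pair N → ℝ) → ℝ} {c : ℝ}

instance : SigmaFinite (radMeasure N d) := by
  unfold radMeasure
  exact SigmaFinite.withDensity_ofReal _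

lemma exists_isScaledPushforward (hN : 1 ≤ N) (hd : N ≤ d) (hm : ∀ i, 0 < m i) :
    ∃ c, IsScaledPushforward (sqDistances m : RelSpace N d → _) volume (radMeasure N d) c := by
  have : NeZero N := ⟨by omega⟩
  obtain ⟨c, hc, h⟩ := exists_map_shape_eq_smul_radMeasure hd (det_posMat_ne_zero hm)
  rw [← sqDistances_eq_shape] at h
  exact ⟨c, (sqDistances_eq_shape (d := d) m ▸ continuous_shape (posMat m)).measurable, hc, h⟩

lemma ae_sqDistances_mem_region (hd : N ≤ d) (hm : ∀ i, 0 < m i) :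
    ∀ᵐ y : RelSpace N d, sqDistances m y ∈ region N := by
  rw [sqDistances_eq_shape]
  exact ae_shape_mem_region hd (det_posMat_ne_zero hm)

lemma continuous_sqDistances (m : Fin (N + 1) → ℝ) :
    Continuous (sqDistances m : RelSpace N d → _) := by
  rw [sqDistances_eq_shape]
  exact continuous_shape _

lemma continuous_distances (m : Fin (N + 1) → ℝ) :
    Continuous (distances m : RelSpace N d → _) := by
  have h : (distances m : RelSpace N d → _) = fun y p => √(sqDistances m y p) :=
    funext fun y => (sqrt_sqDistances m y).symm
  rw [h]
  exact continuous_pi fun p =>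
    Real.continuous_sqrt.comp ((continuous_apply p).comp (continuous_sqDistances m))

lemma measurable_relExpr (hV : Measurable V) {φ : RelSpace N d → ℂ} (hφ : ContDiff ℝ ∞ φ) :
    Measurable (relExpr m V φ) :=
  (((continuous_laplacian hφ).const_mul _).neg.measurable).add
    ((Complex.measurable_ofReal.comp (hV.comp (continuous_distances m).measurable)).mul
      hφ.continuous.measurable)

lemma contDiffAt_pderiv {i j : Fin (N + 1)} {f : (Pair N → ℝ) → ℂ} {ρ : Pair N → ℝ}
    (hf : ContDiffAt ℝ ∞ f ρ) : ContDiffAt ℝ ∞ (pderiv i j f) ρ :=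
  (hf.fderiv_right (m := ∞) (by simp)).clm_apply contDiffAt_const

lemma aestronglyMeasurable_of_continuousOn {f : (Pair N → ℝ) → ℂ}
    (hf : ContinuousOn f (region N)) : AEStronglyMeasurable f (radMeasure N d) :=
  (hf.aestronglyMeasurable (region_measurableSet N)).mono_ac (withDensity_absolutelyContinuous _ _)

lemma aestronglyMeasurable_radExpr (hV : Measurable V) {f : (Pair N → ℝ) → ℂ}
    (hf : ∀ ρ ∈ region N, ContDiffAt ℝ ∞ f ρ) :
    AEStronglyMeasurable (radExpr d m V f) (radMeasure N d) := by
  have h0 : ContinuousOn f (region N) := fun ρ hρ => (hf ρ hρ).continuousAt.continuousWithinAt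
  have h1 : ∀ i j, ContinuousOn (pderiv i j f) (region N) := fun i j ρ hρ =>
    (contDiffAt_pderiv (hf ρ hρ)).continuousAt.continuousWithinAt
  have h2 : ∀ i j k l, ContinuousOn (pderiv i j (pderiv k l f)) (region N) := fun i j k l ρ hρ =>
    (contDiffAt_pderiv (contDiffAt_pderiv (hf ρ hρ))).continuousAt.continuousWithinAt
  have hc : ∀ i j, ContinuousOn (fun ρ : Pair N → ℝ => coord ρ i j) (region N) := fun i j =>
    (coord_continuous i j).continuousOn
  have hL : ContinuousOn (radLaplacian d m f) (region N) := by
    unfold radLaplacian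
    refine ((continuousOn_const.mul ?_).add (continuousOn_const.mul ?_)).add
      (continuousOn_const.mul ?_)
    · refine continuousOn_finsetSum _ fun i _ => continuousOn_finsetSum _ fun j _ =>
        continuousOn_finsetSum _ fun k _ => ?_
      split_ifs
      · exact (Complex.continuous_ofReal.comp_continuousOn
          (continuousOn_const.mul (((hc i j).add (hc i k)).sub (hc j k)))).mul (h2 _ _ _ _)
      · exact continuousOn_const
    · refine continuousOn_finsetSum _ fun p _ => ?_
      exact (Complex.continuous_ofReal.comp_continuousOn
        (continuousOn_const.mul (continuous_apply p).continuousOn)).mul (h2 _ _ _ _)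
    · exact continuousOn_finsetSum _ fun p _ => continuousOn_const.mul (h1 _ _)
  have hVm : Measurable fun ρ : Pair N → ℝ => (V (fun p => √(ρ p)) : ℂ) := by
    refine Complex.measurable_ofReal.comp (hV.comp (measurable_pi_lambda _ fun p => ?_))
    exact Real.continuous_sqrt.measurable.comp (measurable_pi_apply p)
  exact (aestronglyMeasurable_of_continuousOn hL.neg).add
    (hVm.aestronglyMeasurable.mul (aestronglyMeasurable_of_continuousOn h0))

lemma relHamiltonian_graph (m : Fin (N + 1) → ℝ) (V : (Pair N → ℝ) → ℝ) :
    (relHamiltonian N d m V).graph = relGraph N d m V := by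
  refine Submodule.toLinearPMap_graph_eq _ ?_
  rintro ⟨a, b⟩ ⟨φ, h1, h2, h3, h4⟩ h0
  change a = 0 at h0
  subst h0
  have h5 : φ = 0 := by
    refine (Continuous.ae_eq_iff_eq volume h1.continuous continuous_const).1 ?_
    exact h3.symm.trans (Lp.coeFn_zero _ _ _)
  subst h5
  have h : relExpr m V (0 : RelSpace N d → ℂ) = 0 := by
    funext y
    have : Δ (0 : RelSpace N d → ℂ) y = 0 := by
      have := InnerProductSpace.laplacian_const (E := RelSpace N d) (c := (0 : ℂ))
      exact congrFun this y
    simp [relExpr, this]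
  rw [h] at h4
  exact (Lp.eq_zero_iff_ae_eq_zero).2 h4

lemma pullback_mem_relGraph (hd : N ≤ d) (hm : ∀ i, 0 < m i)
    (h : IsScaledPushforward (sqDistances m : RelSpace N d → _) volume (radMeasure N d) c)
    {a b : RadL2 N d} (hab : (a, b) ∈ radGraph N d m V) :
    (h.pullback a, h.pullback b) ∈ relGraph N d m V := by
  obtain ⟨f, h0, h1, h2, h3, h4⟩ := hab
  refine ⟨fun y => f (sqDistances m y), h1, h2, (h.coeFn_pullback a).trans (h.ae_comp h3), ?_⟩
  filter_upwards [h.coeFn_pullback b, h.ae_comp h4, ae_sqDistances_mem_region hd hm] with y e1 e2 hy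
  exact (e1.trans e2).trans (relExpr_comp_sqDistances hm
    ((h0 _ hy).of_le (WithTop.coe_le_coe.2 (le_top : (2 : ℕ∞) ≤ ⊤)))
    (h1.of_le (WithTop.coe_le_coe.2 (le_top : (2 : ℕ∞) ≤ ⊤)))).symm

/-- That the radial expression is determined by the class of `f` is inherited from `relGraph`,
because the pullback is injective and respects the graphs. -/
lemma radHamiltonian_graph (hd : N ≤ d) (hm : ∀ i, 0 < m i)
    (h : IsScaledPushforward (sqDistances m : RelSpace N d → _) volume (radMeasure N d) c)
    (V : (Pair N → ℝ) → ℝ) : (radHamiltonian N d m V).graph = radGraph N d m V := by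
  refine Submodule.toLinearPMap_graph_eq _ ?_
  rintro ⟨a, b⟩ hab h0
  change a = 0 at h0
  have h1 := pullback_mem_relGraph hd hm h hab
  rw [← relHamiltonian_graph] at h1
  have h2 := LinearPMap.graph_fst_eq_zero_snd _ h1 (by simp [h0])
  rw [← h.pushforward_pullback b, h2, map_zero]

lemma measurePreserving_rotate (A : OGroup d) :
    MeasurePreserving (rotateIsometry A : RelSpace N d → RelSpace N d) volume volume :=
  (rotateIsometry A).measurePreserving

lemma rotate_preimage (m : Fin (N + 1) → ℝ) (A : OGroup d) (s : Set (Pair N → ℝ)) :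
    (rotateIsometry A : RelSpace N d → RelSpace N d) ⁻¹' (sqDistances m ⁻¹' s) =
      sqDistances m ⁻¹' s := by
  ext y
  simp only [Set.mem_preimage, rotateIsometry_apply, sqDistances_rotate m A.2]

/-- The preimage of `s` is rotation invariant, so the integral of the norm over it is the same for
every rotation, and the orthogonal group has finite measure. -/
lemma integrable_rotate_prod {v : RelSpace N d → ℂ} (hv : Measurable v) {s : Set (Pair N → ℝ)}
    (hs : MeasurableSet s) (hvi : IntegrableOn v (sqDistances m ⁻¹' s)) :
    Integrable (fun p : OGroup d × RelSpace N d => v (rotateIsometry p.1⁻¹ p.2))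
      ((haarProb d).prod (volume.restrict (sqDistances m ⁻¹' s))) := by
  have hmeas : Measurable fun p : OGroup d × RelSpace N d => v (rotateIsometry p.1⁻¹ p.2) :=
    hv.comp (continuous_rotate.comp
      ((continuous_inv.comp continuous_fst).prodMk continuous_snd)).measurable
  have hp : ∀ A : OGroup d, MeasurePreserving (rotateIsometry A : RelSpace N d → RelSpace N d)
      (volume.restrict (sqDistances m ⁻¹' s)) (volume.restrict (sqDistances m ⁻¹' s)) := by
    intro A
    have := (measurePreserving_rotate (N := N) A).restrict_preimage
      ((continuous_sqDistances m).measurable hs)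
    rwa [rotate_preimage] at this
  rw [integrable_prod_iff hmeas.aestronglyMeasurable]
  constructor
  · exact Filter.Eventually.of_forall fun A =>
      (hp A⁻¹).integrable_comp_of_integrable hvi
  · have : ∀ A : OGroup d, ∫ y in (sqDistances m ⁻¹' s : Set (RelSpace N d)),
        ‖v (rotateIsometry A⁻¹ y)‖ = ∫ y in (sqDistances m ⁻¹' s : Set (RelSpace N d)), ‖v y‖ :=
      fun A => (hp A⁻¹).integral_comp (rotateIsometry A⁻¹).toHomeomorph.measurableEmbedding
        fun y => ‖v y‖
    simp only [this]
    exact integrable_const _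

lemma setIntegral_average {v : RelSpace N d → ℂ} (hv : Measurable v) {s : Set (Pair N → ℝ)}
    (hs : MeasurableSet s) (hvi : IntegrableOn v (sqDistances m ⁻¹' s)) :
    ∫ y in sqDistances m ⁻¹' s, average v y = ∫ y in sqDistances m ⁻¹' s, v y := by
  have hp : ∀ A : OGroup d, ∫ y in (sqDistances m ⁻¹' s : Set (RelSpace N d)),
      v (rotateIsometry A⁻¹ y) = ∫ y in (sqDistances m ⁻¹' s : Set (RelSpace N d)), v y := by
    intro A
    have := (measurePreserving_rotate (N := N) A⁻¹).restrict_preimage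
      ((continuous_sqDistances m).measurable hs)
    rw [rotate_preimage] at this
    exact this.integral_comp (rotateIsometry A⁻¹).toHomeomorph.measurableEmbedding _
  unfold average
  rw [← integral_integral_swap (integrable_rotate_prod hv hs hvi)]
  simp [hp]

/-- The projection to radial functions is the average over rotations. -/
lemma pushforward_ae_eq_of_average
    (h : IsScaledPushforward (sqDistances m : RelSpace N d → _) volume (radMeasure N d) c)
    {v : RelSpace N d → ℂ} (hv : Measurable v) {w : RelL2 N d} (hw : w =ᵐ[volume] v)
    {g : (Pair N → ℝ) → ℂ} (hg : AEStronglyMeasurable g (radMeasure N d))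
    (hgv : (fun y => g (sqDistances m y)) =ᵐ[volume] average v) :
    h.pushforward w =ᵐ[radMeasure N d] g := by
  have hvi : ∀ s, MeasurableSet s → radMeasure N d s < ⊤ →
      IntegrableOn v (sqDistances m ⁻¹' s) := by
    intro s hs hsf
    exact (integrableOn_Lp_of_measure_ne_top w (by norm_num) (h.measure_preimage_ne_top hs hsf)).congr
      (ae_restrict_of_ae hw)
  refine h.pushforward_ae_eq (fun s hs hsf => ?_) fun s hs hsf => ?_
  · have h1 := (integrable_rotate_prod hv hs (hvi s hs hsf)).integral_prod_right
    refine ((h.restrict hs).integrable_comp_iff hg.restrict).1 ?_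
    exact h1.congr (ae_restrict_of_ae hgv.symm)
  · rw [← (h.restrict hs).integral_comp hg.restrict,
      setIntegral_congr_ae (h.measurable hs) (hw.mono fun y hy _ => hy),
      ← setIntegral_average hv hs (hvi s hs hsf)]
    exact (integral_congr_ae (ae_restrict_of_ae hgv)).symm

/-- The projection of a test function is its average, again a test function and a smooth function of
`ρ` on the region. Averaging commutes with the Hamiltonian, so the second component follows suit. -/
lemma pushforward_mem_radGraph (hd : N ≤ d) (hm : ∀ i, 0 < m i) (hV : Measurable V)
    (h : IsScaledPushforward (sqDistances m : RelSpace N d → _) volume (radMeasure N d) c)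
    {a b : RelL2 N d} (hab : (a, b) ∈ relGraph N d m V) :
    (h.pushforward a, h.pushforward b) ∈ radGraph N d m V := by
  obtain ⟨φ, h1, h2, h3, h4⟩ := hab
  obtain ⟨f, hf, hfs⟩ := exists_comp_sqDistances_eq hm hd (contDiff_average h1)
    (fun A hA y => average_rotate φ ⟨A, hA⟩ y)
  have hf' : (fun y => f (sqDistances m y)) = average φ := funext hf
  refine ⟨f, hfs, hf' ▸ contDiff_average h1, hf' ▸ hasCompactSupport_average h2, ?_, ?_⟩
  · exact pushforward_ae_eq_of_average h h1.continuous.measurable h3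
      (aestronglyMeasurable_of_continuousOn fun ρ hρ =>
        (hfs ρ hρ).continuousAt.continuousWithinAt) (hf' ▸ Filter.EventuallyEq.rfl)
  · refine pushforward_ae_eq_of_average h (measurable_relExpr hV h1) h4
      (aestronglyMeasurable_radExpr hV hfs) ?_
    -- The chain rule is available only at nondegenerate configurations, where `f` is smooth; these
    -- are almost all.
    filter_upwards [ae_sqDistances_mem_region hd hm] with y hy
    rw [← relExpr_average h1, ← hf', relExpr_comp_sqDistances hm
      ((hfs _ hy).of_le (WithTop.coe_le_coe.2 (le_top : (2 : ℕ∞) ≤ ⊤)))]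
    rw [hf']
    exact (contDiff_average h1).of_le (WithTop.coe_le_coe.2 (le_top : (2 : ℕ∞) ≤ ⊤))

/-- The restricted Hamiltonian is a compression of the Hamiltonian of relative motion. -/
lemma isCompression (hd : N ≤ d) (hm : ∀ i, 0 < m i) (hV : Measurable V)
    (h : IsScaledPushforward (sqDistances m : RelSpace N d → _) volume (radMeasure N d) c) :
    IsCompression (relHamiltonian N d m V) (radHamiltonian N d m V) h.pullback h.pushforward c where
  pos := h.pos
  left_inv := h.pushforward_pullback
  inner_map := h.inner_pullback
  map_graph a b hab := by
    rw [radHamiltonian_graph hd hm h] at hab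
    rw [relHamiltonian_graph]
    exact pullback_mem_relGraph hd hm h hab
  comap_graph a b hab := by
    rw [relHamiltonian_graph] at hab
    rw [radHamiltonian_graph hd hm h]
    exact pushforward_mem_radGraph hd hm hV h hab

end Compression

/-! ### Smooth approximations of the modulus -/

section Modulus

/-- A smooth approximation of the modulus. -/
def smoothAbs (ε : ℝ) (z : ℂ) : ℂ := ((√(‖z‖ ^ 2 + ε ^ 2) - ε : ℝ) : ℂ)

lemma contDiff_smoothAbs {ε : ℝ} (hε : 0 < ε) : ContDiff ℝ ∞ (smoothAbs ε) := by
  have h : ContDiff ℝ ∞ fun z : ℂ => √(‖z‖ ^ 2 + ε ^ 2) - ε :=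
    (((contDiff_norm_sq ℝ).add contDiff_const).sqrt fun z => by positivity).sub contDiff_const
  exact Complex.ofRealCLM.contDiff.comp h

/-- The subtraction of `ε` in `smoothAbs` serves this: composition with it preserves compact
support. -/
lemma smoothAbs_zero {ε : ℝ} (hε : 0 < ε) : smoothAbs ε 0 = 0 := by
  simp [smoothAbs, Real.sqrt_sq hε.le]

lemma sqrt_add_sq_le (a b ε : ℝ) : √(a ^ 2 + ε ^ 2) ≤ √(b ^ 2 + ε ^ 2) + |a - b| := by
  refine Real.sqrt_le_iff.2 ⟨by positivity, ?_⟩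
  have h1 : |b| ≤ √(b ^ 2 + ε ^ 2) := Real.abs_le_sqrt (by nlinarith [sq_nonneg ε])
  have h2 := Real.sq_sqrt (by positivity : 0 ≤ b ^ 2 + ε ^ 2)
  have h3 : b * (a - b) ≤ |b| * |a - b| := by rw [← abs_mul]; exact le_abs_self _
  have h4 : |b| * |a - b| ≤ √(b ^ 2 + ε ^ 2) * |a - b| :=
    mul_le_mul_of_nonneg_right h1 (abs_nonneg _)
  have h5 := sq_abs (a - b)
  nlinarith

/-- The constant `1` carries the energy comparison: it bounds the gradient of `smoothAbs ε ∘ φ` by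
that of `φ` and, as `0` is fixed, the modulus as well. -/
lemma lipschitzWith_smoothAbs (ε : ℝ) : LipschitzWith 1 (smoothAbs ε) := by
  refine LipschitzWith.of_dist_le_mul fun z w => ?_
  rw [NNReal.coe_one, one_mul, smoothAbs, smoothAbs, Complex.dist_eq, ← Complex.ofReal_sub,
    Complex.norm_real, Real.norm_eq_abs, dist_eq_norm]
  refine le_trans ?_ (abs_norm_sub_norm_le z w)
  rw [sub_sub_sub_cancel_right, abs_sub_le_iff]
  constructor
  · linarith [sqrt_add_sq_le ‖z‖ ‖w‖ ε]
  · have := sqrt_add_sq_le ‖w‖ ‖z‖ ε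
    rw [abs_sub_comm] at this
    linarith

lemma norm_smoothAbs_le {ε : ℝ} (hε : 0 < ε) (z : ℂ) : ‖smoothAbs ε z‖ ≤ ‖z‖ := by
  have := (lipschitzWith_smoothAbs ε).dist_le_mul z 0
  simpa [smoothAbs_zero hε] using this

lemma tendsto_smoothAbs (z : ℂ) :
    Filter.Tendsto (fun n : ℕ => smoothAbs (1 / ((n : ℝ) + 1)) z) Filter.atTop
      (nhds ((‖z‖ : ℝ) : ℂ)) := by
  have hc : Continuous fun ε : ℝ => smoothAbs ε z := by
    unfold smoothAbs
    fun_prop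
  have h := hc.tendsto 0
  have h0 : smoothAbs 0 z = ((‖z‖ : ℝ) : ℂ) := by simp [smoothAbs]
  rw [h0] at h
  exact h.comp tendsto_one_div_add_atTop_nhds_zero_nat

lemma lipschitzWith_norm_complex : LipschitzWith 1 fun z : ℂ => ((‖z‖ : ℝ) : ℂ) := by
  refine LipschitzWith.of_dist_le_mul fun z w => ?_
  rw [NNReal.coe_one, one_mul, Complex.dist_eq, ← Complex.ofReal_sub, Complex.norm_real,
    Real.norm_eq_abs, dist_eq_norm]
  exact abs_norm_sub_norm_le z w

/-- The modulus of a square integrable function. -/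
def absL2 {X : Type*} [MeasurableSpace X] {μ : Measure X} (f : Lp ℂ 2 μ) : Lp ℂ 2 μ :=
  lipschitzWith_norm_complex.compLp (by simp) f

lemma coeFn_absL2 {X : Type*} [MeasurableSpace X] {μ : Measure X} (f : Lp ℂ 2 μ) :
    absL2 f =ᵐ[μ] fun x => ((‖f x‖ : ℝ) : ℂ) :=
  lipschitzWith_norm_complex.coeFn_compLp (by simp) f

lemma continuous_absL2 {X : Type*} [MeasurableSpace X] {μ : Measure X} :
    Continuous (absL2 : Lp ℂ 2 μ → Lp ℂ 2 μ) :=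
  LipschitzWith.continuous_compLp lipschitzWith_norm_complex (by simp)

lemma norm_absL2 {X : Type*} [MeasurableSpace X] {μ : Measure X} (f : Lp ℂ 2 μ) :
    ‖absL2 f‖ = ‖f‖ := by
  rw [Lp.norm_def, Lp.norm_def]
  congr 1
  refine eLpNorm_congr_norm_ae ?_
  filter_upwards [coeFn_absL2 f] with x hx
  rw [hx]
  simp

end Modulus

/-! ### The energy of a test function -/

section Energy

variable {N d : ℕ} {m : Fin (N + 1) → ℝ} {V : (Pair N → ℝ) → ℝ}

/-- The integrand of the kinetic energy. -/
def gradSq (φ : RelSpace N d → ℂ) (y : RelSpace N d) : ℝ :=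
  ∑ i, ‖fderiv ℝ φ y (EuclideanSpace.basisFun (Fin N × Fin d) ℝ i)‖ ^ 2

lemma continuous_gradSq {φ : RelSpace N d → ℂ} (hφ : ContDiff ℝ ∞ φ) : Continuous (gradSq φ) := by
  have h1 : Continuous (fderiv ℝ φ) := hφ.continuous_fderiv (by simp)
  unfold gradSq
  fun_prop

lemma integrable_gradSq {φ : RelSpace N d → ℂ} (hφ : ContDiff ℝ ∞ φ) (hs : HasCompactSupport φ) :
    Integrable (gradSq φ) := by
  refine (continuous_gradSq hφ).integrable_of_hasCompactSupport ?_
  refine (hs.fderiv ℝ).mono' fun y hy => ?_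
  refine subset_tsupport _ fun h0 => hy ?_
  simp [gradSq, h0]

lemma hasCompactSupport_laplacian {φ : RelSpace N d → ℂ} (hs : HasCompactSupport φ) :
    HasCompactSupport (Δ φ) := by
  refine ((hs.fderiv ℝ).fderiv ℝ).mono' fun y hy => ?_
  refine subset_tsupport _ fun h0 => hy ?_
  rw [laplacian_eq_sum_fderiv (EuclideanSpace.basisFun (Fin N × Fin d) ℝ), h0]
  simp

/-- Green's identity. -/
lemma integral_inner_laplacian {φ : RelSpace N d → ℂ} (hφ : ContDiff ℝ ∞ φ)
    (hs : HasCompactSupport φ) :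
    ∫ y, inner ℝ (φ y) (Δ φ y) = -∫ y, gradSq φ y := by
  set v := EuclideanSpace.basisFun (Fin N × Fin d) ℝ with hv
  set B : ℂ →L[ℝ] ℂ →L[ℝ] ℝ :=
    (isBoundedBilinearMap_inner (𝕜 := ℝ) (E := ℂ)).toContinuousLinearMap with hB
  have hBa : ∀ z w, B z w = inner ℝ z w := fun _ _ => rfl
  have hφ1 : ContDiff ℝ ∞ (fderiv ℝ φ) := hφ.fderiv_right (by simp)
  have c1 : Continuous (fderiv ℝ φ) := hφ1.continuous
  have c2 : Continuous (fderiv ℝ (fderiv ℝ φ)) := hφ1.continuous_fderiv (by simp)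
  have c0 := hφ.continuous
  have hint : ∀ g : RelSpace N d → ℂ, Continuous g → Integrable fun y => B (φ y) (g y) := by
    intro g hg
    refine Continuous.integrable_of_hasCompactSupport (by fun_prop) (hs.mono' fun y hy => ?_)
    refine subset_tsupport _ fun h0 => hy ?_
    simp [h0]
  have hg2 : ∀ i, Integrable fun y => inner ℝ (φ y) (fderiv ℝ (fderiv ℝ φ) y (v i) (v i)) :=
    fun i => hint _ (by fun_prop)
  have hg1 : ∀ i, Integrable fun y => ‖fderiv ℝ φ y (v i)‖ ^ 2 := by
    intro i
    refine Continuous.integrable_of_hasCompactSupport (by fun_prop)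
      ((hs.fderiv ℝ).mono' fun y hy => ?_)
    refine subset_tsupport _ fun h0 => hy ?_
    simp [h0]
  have key : ∀ i, ∫ y, inner ℝ (φ y) (fderiv ℝ (fderiv ℝ φ) y (v i) (v i)) =
      -∫ y, ‖fderiv ℝ φ y (v i)‖ ^ 2 := by
    intro i
    have hder : ∀ y, HasFDerivAt (fun z => fderiv ℝ φ z (v i))
        ((fderiv ℝ (fderiv ℝ φ) y).flip (v i)) y := by
      intro y
      have h1 := (hφ1.differentiable (by simp) y).hasFDerivAt
      exact (ContinuousLinearMap.apply ℝ ℂ (v i)).hasFDerivAt.comp y h1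
    have h := integral_bilinear_hasFDerivAt_right_eq_neg_left_of_integrable (μ := volume)
      (f := φ) (f' := fderiv ℝ φ) (g := fun y => fderiv ℝ φ y (v i))
      (g' := fun y => (fderiv ℝ (fderiv ℝ φ) y).flip (v i)) (v := v i) (B := B)
      ?_ (hg2 i) (hint _ (by fun_prop))
      (fun y _ => (hφ.differentiable (by simp) y).hasFDerivAt) (fun y _ => hder y)
    · simpa only [hBa, ContinuousLinearMap.flip_apply, real_inner_self_eq_norm_sq] using h
    · simpa only [hBa, real_inner_self_eq_norm_sq] using hg1 i
  simp only [gradSq, laplacian_eq_sum_fderiv v φ, inner_sum]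
  rw [integral_finsetSum _ fun i _ => hg2 i, integral_finsetSum _ fun i _ => hg1 i]
  simp only [key, Finset.sum_neg_distrib]

lemma inner_relExpr (φ : RelSpace N d → ℂ) (y : RelSpace N d) :
    (inner ℂ (φ y) (relExpr m V φ y)).re =
      -(1 / 2) * inner ℝ (φ y) (Δ φ y) + V (distances m y) * ‖φ y‖ ^ 2 := by
  rw [relExpr, Complex.sq_norm, Complex.normSq_apply]
  simp only [RCLike.inner_apply, Complex.inner, Complex.add_re, Complex.add_im, Complex.mul_re,
    Complex.mul_im, Complex.neg_re, Complex.neg_im, Complex.conj_re, Complex.conj_im,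
    Complex.ofReal_re, Complex.ofReal_im, Complex.div_re, Complex.div_im]
  norm_num
  ring

/-- The energy of a test function. -/
lemma re_inner_relGraph {φ : RelSpace N d → ℂ} (hφ : ContDiff ℝ ∞ φ) (hs : HasCompactSupport φ)
    {a b : RelL2 N d} (ha : a =ᵐ[volume] φ) (hb : b =ᵐ[volume] relExpr m V φ) :
    Integrable (fun y => V (distances m y) * ‖φ y‖ ^ 2) ∧
      (inner ℂ a b).re = 1 / 2 * (∫ y, gradSq φ y) +
        ∫ y, V (distances m y) * ‖φ y‖ ^ 2 := by
  have h1 : Integrable fun y => (inner ℂ (φ y) (relExpr m V φ y)).re := by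
    refine ((L2.integrable_inner (𝕜 := ℂ) a b).re).congr ?_
    filter_upwards [ha, hb] with y e1 e2
    rw [e1, e2]
    rfl
  have h2 : Integrable fun y => inner ℝ (φ y) (Δ φ y) := by
    have := continuous_laplacian hφ
    have := hφ.continuous
    refine Continuous.integrable_of_hasCompactSupport (by fun_prop) (hs.mono' fun y hy => ?_)
    refine subset_tsupport _ fun h0 => hy ?_
    simp [h0]
  have h3 : Integrable fun y => V (distances m y) * ‖φ y‖ ^ 2 := by
    refine (h1.add (h2.const_mul (1 / 2))).congr (Filter.Eventually.of_forall fun y => ?_)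
    simp only [Pi.add_apply, inner_relExpr]
    ring
  refine ⟨h3, ?_⟩
  have h4 : (inner ℂ a b).re = ∫ y, (inner ℂ (φ y) (relExpr m V φ y)).re := by
    rw [L2.inner_def]
    have := integral_re (L2.integrable_inner (𝕜 := ℂ) a b)
    refine this.symm.trans (integral_congr_ae ?_)
    filter_upwards [ha, hb] with y e1 e2
    rw [e1, e2]
    rfl
  rw [h4]
  simp only [inner_relExpr]
  rw [integral_add (h2.const_mul _) h3, integral_const_mul, integral_inner_laplacian hφ hs]
  ring

end Energy

/-! ### The modulus of a ground state is a ground state -/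

section Positivity

variable {N d : ℕ} {m : Fin (N + 1) → ℝ} {V : (Pair N → ℝ) → ℝ}

lemma gradSq_smoothAbs_le {ε : ℝ} (hε : 0 < ε) {φ : RelSpace N d → ℂ} (hφ : ContDiff ℝ ∞ φ)
    (y : RelSpace N d) : gradSq (fun z => smoothAbs ε (φ z)) y ≤ gradSq φ y := by
  refine Finset.sum_le_sum fun i _ => ?_
  have h1 := ((contDiff_smoothAbs hε).differentiable (by simp) (φ y)).hasFDerivAt
  have h2 := (hφ.differentiable (by simp) y).hasFDerivAt
  have h3 : HasFDerivAt (fun z => smoothAbs ε (φ z))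
      ((fderiv ℝ (smoothAbs ε) (φ y)).comp (fderiv ℝ φ y)) y := h1.comp y h2
  rw [h3.fderiv, ContinuousLinearMap.comp_apply]
  gcongr
  refine (ContinuousLinearMap.le_opNorm _ _).trans ?_
  have := norm_fderiv_le_of_lipschitz ℝ (x₀ := φ y) (lipschitzWith_smoothAbs ε)
  exact mul_le_of_le_one_left (norm_nonneg _) (by simpa using this)

lemma norm_sq_eq_integral {X : Type*} [MeasurableSpace X] {μ : Measure X} (w : Lp ℂ 2 μ) :
    ‖w‖ ^ 2 = ∫ x, ‖w x‖ ^ 2 ∂μ := by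
  rw [@norm_sq_eq_re_inner ℂ, L2.inner_def, ← integral_re (L2.integrable_inner (𝕜 := ℂ) w w)]
  exact integral_congr_ae (Filter.Eventually.of_forall fun x => inner_self_eq_norm_sq (𝕜 := ℂ) (w x))

/-- Membership in the domain needs `V χ` square integrable for the regularised modulus `χ`. As `Δ φ`
is continuous with compact support, `V φ` is square integrable, and it dominates `V χ`. -/
lemma exists_mem_relGraph_smoothAbs (hV : Measurable V) {φ : RelSpace N d → ℂ}
    (hφ : ContDiff ℝ ∞ φ) (hs : HasCompactSupport φ) (hL : MemLp (relExpr m V φ) 2 volume)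
    {ε : ℝ} (hε : 0 < ε) :
    ∃ u : RelL2 N d × RelL2 N d, u ∈ relGraph N d m V ∧
      u.1 =ᵐ[volume] (fun y => smoothAbs ε (φ y)) ∧
      u.2 =ᵐ[volume] relExpr m V fun y => smoothAbs ε (φ y) := by
  set χ : RelSpace N d → ℂ := fun y => smoothAbs ε (φ y) with hχ
  have hχs : ContDiff ℝ ∞ χ := (contDiff_smoothAbs hε).comp hφ
  have hχc : HasCompactSupport χ := hs.comp_left (smoothAbs_zero hε)
  have hΔ : ∀ {η : RelSpace N d → ℂ}, ContDiff ℝ ∞ η → HasCompactSupport η →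
      MemLp (fun y => (1 / 2 : ℂ) * Δ η y) 2 volume := fun h1 h2 =>
    ((continuous_laplacian h1).memLp_of_hasCompactSupport
      (hasCompactSupport_laplacian h2)).const_mul _
  have hVφ : MemLp (fun y => (V (distances m y) : ℂ) * φ y) 2 volume := by
    refine (hL.add (hΔ hφ hs)).ae_eq (Filter.Eventually.of_forall fun y => ?_)
    simp only [Pi.add_apply, relExpr]
    ring
  have hVm : Measurable fun y : RelSpace N d => (V (distances m y) : ℂ) :=
    Complex.measurable_ofReal.comp (hV.comp (continuous_distances m).measurable)
  have hVχ : MemLp (fun y => (V (distances m y) : ℂ) * χ y) 2 volume := by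
    refine hVφ.mono (hVm.mul hχs.continuous.measurable).aestronglyMeasurable
      (Filter.Eventually.of_forall fun y => ?_)
    rw [norm_mul, norm_mul]
    exact mul_le_mul_of_nonneg_left (norm_smoothAbs_le hε _) (norm_nonneg _)
  have hχL : MemLp (relExpr m V χ) 2 volume := (hΔ hχs hχc).neg.add hVχ
  have hχM : MemLp χ 2 volume := hχs.continuous.memLp_of_hasCompactSupport hχc
  exact ⟨(hχM.toLp, hχL.toLp), ⟨χ, hχs, hχc, hχM.coeFn_toLp, hχL.coeFn_toLp⟩,
    hχM.coeFn_toLp, hχL.coeFn_toLp⟩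

/-- The energy does not increase, up to a small error, when a test function is replaced by a
smooth approximation of its modulus. -/
lemma exists_regularization (hV : Measurable V) {a b : RelL2 N d} (hab : (a, b) ∈ relGraph N d m V)
    {δ : ℝ} (hδ : 0 < δ) :
    ∃ u : RelL2 N d × RelL2 N d, u ∈ relGraph N d m V ∧ ‖u.1 - absL2 a‖ < δ ∧
      (inner ℂ u.1 u.2).re < (inner ℂ a b).re + δ := by
  obtain ⟨φ, h1, h2, h3, h4⟩ := hab
  change a =ᵐ[volume] φ at h3
  change b =ᵐ[volume] relExpr m V φ at h4
  have hL : MemLp (relExpr m V φ) 2 volume := (Lp.memLp b).ae_eq h4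
  have hε : ∀ n : ℕ, 0 < 1 / ((n : ℝ) + 1) := fun n => Nat.one_div_pos_of_nat
  choose u hu hu1 hu2 using fun n : ℕ => exists_mem_relGraph_smoothAbs (m := m) hV h1 h2 hL (hε n)
  set χ : ℕ → RelSpace N d → ℂ := fun n y => smoothAbs (1 / ((n : ℝ) + 1)) (φ y) with hχ
  have hχs : ∀ n, ContDiff ℝ ∞ (χ n) := fun n => (contDiff_smoothAbs (hε n)).comp h1
  have hχc : ∀ n, HasCompactSupport (χ n) := fun n => h2.comp_left (smoothAbs_zero (hε n))
  have hχle : ∀ n y, ‖χ n y‖ ≤ ‖φ y‖ := fun n y => norm_smoothAbs_le (hε n) _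
  have hχt : ∀ y, Filter.Tendsto (fun n => χ n y) Filter.atTop (nhds ((‖φ y‖ : ℝ) : ℂ)) :=
    fun y => tendsto_smoothAbs (φ y)
  have hφ2 : Integrable fun y => ‖φ y‖ ^ 2 := by
    have := h1.continuous
    refine Continuous.integrable_of_hasCompactSupport (by fun_prop) (h2.mono' fun y hy => ?_)
    refine subset_tsupport _ fun h0 => hy ?_
    simp [h0]
  obtain ⟨hVi, he⟩ := re_inner_relGraph h1 h2 h3 h4
  have hχe := fun n => re_inner_relGraph (hχs n) (hχc n) (hu1 n) (hu2 n)
  have t1 : Filter.Tendsto (fun n => ‖(u n).1 - absL2 a‖) Filter.atTop (nhds 0) := by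
    have t2 : Filter.Tendsto (fun n => ‖(u n).1 - absL2 a‖ ^ 2) Filter.atTop (nhds 0) := by
      have e : ∀ n, ‖(u n).1 - absL2 a‖ ^ 2 = ∫ y, ‖χ n y - ((‖φ y‖ : ℝ) : ℂ)‖ ^ 2 := by
        intro n
        rw [norm_sq_eq_integral]
        refine integral_congr_ae ?_
        filter_upwards [Lp.coeFn_sub (u n).1 (absL2 a), hu1 n, coeFn_absL2 a, h3] with y e1 e2 e3 e4
        rw [e1, Pi.sub_apply, e2, e3, e4]
      simp only [e]
      have := tendsto_integral_of_dominated_convergence (μ := volume)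
        (F := fun n y => ‖χ n y - ((‖φ y‖ : ℝ) : ℂ)‖ ^ 2) (f := fun _ => (0 : ℝ))
        (fun y => 4 * ‖φ y‖ ^ 2) (fun n => ?_) (hφ2.const_mul 4) (fun n => ?_) ?_
      · simpa using this
      · have c1 := (hχs n).continuous
        have c2 := h1.continuous
        exact (by fun_prop : Continuous fun y => ‖χ n y - ((‖φ y‖ : ℝ) : ℂ)‖ ^ 2).aestronglyMeasurable
      · refine Filter.Eventually.of_forall fun y => ?_
        have e1 : ‖χ n y - ((‖φ y‖ : ℝ) : ℂ)‖ ≤ 2 * ‖φ y‖ := by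
          refine (norm_sub_le _ _).trans ?_
          have := hχle n y
          simp only [Complex.norm_real, norm_norm]
          linarith
        rw [Real.norm_of_nonneg (by positivity)]
        have := pow_le_pow_left₀ (norm_nonneg _) e1 2
        linarith [mul_pow 2 ‖φ y‖ 2]
      · refine Filter.Eventually.of_forall fun y => ?_
        have := (((hχt y).sub_const ((‖φ y‖ : ℝ) : ℂ)).norm).pow 2
        simpa using this
    have := (Real.continuous_sqrt.tendsto 0).comp t2
    simpa [Function.comp_def, Real.sqrt_sq] using this
  -- `V` need not have a sign. The regularised moduli are dominated by `|φ|`, so `|V| |φ|²`, which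
  -- is integrable, serves as the bound.
  have t3 : Filter.Tendsto (fun n => ∫ y, V (distances m y) * ‖χ n y‖ ^ 2) Filter.atTop
      (nhds (∫ y, V (distances m y) * ‖φ y‖ ^ 2)) := by
    refine tendsto_integral_of_dominated_convergence (fun y => ‖V (distances m y) * ‖φ y‖ ^ 2‖)
      (fun n => (hχe n).1.aestronglyMeasurable) hVi.norm (fun n => ?_) ?_
    · refine Filter.Eventually.of_forall fun y => ?_
      rw [norm_mul, norm_mul]
      refine mul_le_mul_of_nonneg_left ?_ (norm_nonneg _)
      rw [Real.norm_of_nonneg (by positivity), Real.norm_of_nonneg (by positivity)]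
      exact pow_le_pow_left₀ (norm_nonneg _) (hχle n y) 2
    · refine Filter.Eventually.of_forall fun y => ?_
      have := (((hχt y).norm).pow 2).const_mul (V (distances m y))
      simpa using this
  obtain ⟨n, hn1, hn2⟩ := ((t1.eventually (gt_mem_nhds hδ)).and
    (t3.eventually (gt_mem_nhds (lt_add_of_pos_right _ hδ)))).exists
  refine ⟨u n, hu n, hn1, ?_⟩
  -- The kinetic energy needs only an inequality, so convergence of the gradients plays no part.
  have h5 : ∫ y, gradSq (χ n) y ≤ ∫ y, gradSq φ y :=
    integral_mono (integrable_gradSq (hχs n) (hχc n)) (integrable_gradSq h1 h2)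
      (gradSq_smoothAbs_le (hε n) h1)
  rw [(hχe n).2, he]
  linarith

/-- Test functions approximating `ψ` in the graph norm have energy tending to `E ‖ψ‖²`. Their
regularised moduli have asymptotically no more energy and tend to `|ψ|`, which has the same norm; so
they form a minimising sequence, and its limit is an eigenvector. -/
lemma absL2_mem_closure_graph (hV : Measurable V)
    (hT : IsEssentiallySelfAdjoint (relHamiltonian N d m V)) {E : ℝ} {ψ : RelL2 N d}
    (hψ : IsNondegenerateGroundState (relHamiltonian N d m V).closure E ψ) :
    (absL2 ψ, (E : ℂ) • absL2 ψ) ∈ (relHamiltonian N d m V).closure.graph := by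
  set T := relHamiltonian N d m V with hTdef
  have hgraph : T.graph = relGraph N d m V := relHamiltonian_graph m V
  have hle : ∀ {a b : RelL2 N d}, (a, b) ∈ T.graph → E * ‖a‖ ^ 2 ≤ (inner ℂ a b).re := by
    intro a b hab
    have h1 : (a, b) ∈ T.closure.graph := LinearPMap.le_graph_of_le T.le_closure hab
    obtain ⟨x, hx1, hx2⟩ := LinearPMap.mem_graph_iff _ |>.1 h1
    have h2 := hψ.2.2.1 x
    change (x : RelL2 N d) = a at hx1
    change T.closure x = b at hx2
    rwa [hx1, hx2] at h2
  obtain ⟨hd, he⟩ := hψ.2.1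
  have hmem : (ψ, (E : ℂ) • ψ) ∈ T.closure.graph :=
    (LinearPMap.mem_graph_iff _).2 ⟨⟨ψ, hd⟩, rfl, he⟩
  rw [← hT.isClosable.graph_closure_eq_closure_graph] at hmem
  obtain ⟨s, hs, hst⟩ := mem_closure_iff_seq_limit.1
    (hmem : (ψ, (E : ℂ) • ψ) ∈ _root_.closure (T.graph : Set (RelL2 N d × RelL2 N d)))
  have hδ : ∀ n : ℕ, 0 < 1 / ((n : ℝ) + 1) := fun n => Nat.one_div_pos_of_nat
  have hδt : Filter.Tendsto (fun n : ℕ => 1 / ((n : ℝ) + 1)) Filter.atTop (nhds 0) :=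
    tendsto_one_div_add_atTop_nhds_zero_nat
  choose u hu hu1 hu2 using fun n : ℕ => exists_regularization (m := m) (a := (s n).1)
    (b := (s n).2) hV (hgraph ▸ hs n) (hδ n)
  have hs1 : Filter.Tendsto (fun n => (s n).1) Filter.atTop (nhds ψ) :=
    (continuous_fst.tendsto _).comp hst
  have hs2 : Filter.Tendsto (fun n => (s n).2) Filter.atTop (nhds ((E : ℂ) • ψ)) :=
    (continuous_snd.tendsto _).comp hst
  have hut : Filter.Tendsto (fun n => (u n).1) Filter.atTop (nhds (absL2 ψ)) := by
    have t1 : Filter.Tendsto (fun n => (u n).1 - absL2 (s n).1) Filter.atTop (nhds 0) :=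
      squeeze_zero_norm (fun n => (hu1 n).le) hδt
    have t2 := t1.add ((continuous_absL2.tendsto ψ).comp hs1)
    simpa [Function.comp_def] using t2
  have hug : ∀ n, ∃ x : T.domain, (x : RelL2 N d) = (u n).1 ∧ T x = (u n).2 := fun n =>
    (LinearPMap.mem_graph_iff _).1 (hgraph ▸ hu n)
  choose x hx1 hx2 using hug
  refine mem_closure_graph_of_minimizing hT (fun φ => hle ((LinearPMap.mem_graph_iff _).2 ⟨φ, rfl, rfl⟩))
    (u := x) (by simpa only [hx1] using hut) ?_
  simp only [hx1, hx2]
  -- An upper bound for the excess energy of the regularisations; the lower bound `0` is the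
  -- semiboundedness of `T`.
  have hub : Filter.Tendsto (fun n : ℕ => (inner ℂ (s n).1 (s n).2).re + 1 / ((n : ℝ) + 1)
      - E * ‖(u n).1‖ ^ 2) Filter.atTop (nhds 0) := by
    have t1 : Filter.Tendsto (fun n => (inner ℂ (s n).1 (s n).2).re) Filter.atTop
        (nhds (inner ℂ ψ ((E : ℂ) • ψ)).re) :=
      (Complex.continuous_re.tendsto _).comp (hs1.inner hs2)
    have t2 := (t1.add hδt).sub ((hut.norm.pow 2).const_mul E)
    rw [norm_absL2, inner_smul_right, Complex.re_ofReal_mul] at t2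
    have e : (inner ℂ ψ ψ).re = ‖ψ‖ ^ 2 := inner_self_eq_norm_sq (𝕜 := ℂ) ψ
    rw [e, add_zero, sub_self] at t2
    exact t2
  refine squeeze_zero (fun n => ?_) (fun n => ?_) hub
  · have : ((u n).1, (u n).2) ∈ T.graph := by rw [hgraph]; exact hu n
    linarith [hle this]
  · linarith [hu2 n]

end Positivity

/-! ### The ground state is radial -/

section GroundState

variable {X Y : Type*} [MeasurableSpace X] [MeasurableSpace Y] {Φ : X → Y} {μ : Measure X}
  {ν : Measure Y} {c : ℝ}

/-- If the projection vanishes, then `‖f‖` has integral zero over the preimage of each set of a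
countable exhaustion by sets of finite measure; being nonnegative, it vanishes almost everywhere. -/
lemma IsScaledPushforward.pushforward_absL2_ne_zero [SigmaFinite ν]
    (h : IsScaledPushforward Φ μ ν c) {f : Lp ℂ 2 μ} (hf : f ≠ 0) :
    h.pushforward (absL2 f) ≠ 0 := by
  intro h0
  refine hf ((Lp.eq_zero_iff_ae_eq_zero).2 ?_)
  have key : ∀ n : ℕ, ∀ᵐ x ∂μ, x ∈ Φ ⁻¹' (spanningSets ν n) → f x = 0 := by
    intro n
    have hs := measurableSet_spanningSets ν n
    have hsf := measure_spanningSets_lt_top ν n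
    have h1 := h.setIntegral_preimage (absL2 f) hs hsf
    have h2 : ∫ y in spanningSets ν n, h.pushforward (absL2 f) y ∂ν = 0 := by
      rw [h0]
      refine integral_eq_zero_of_ae ?_
      exact ae_restrict_of_ae (Lp.coeFn_zero _ _ _)
    have h3 : ∫ x in Φ ⁻¹' (spanningSets ν n), absL2 f x ∂μ =
        ((∫ x in Φ ⁻¹' (spanningSets ν n), ‖f x‖ ∂μ : ℝ) : ℂ) := by
      rw [← integral_complex_ofReal]
      exact integral_congr_ae (ae_restrict_of_ae (coeFn_absL2 f))
    rw [h2, mul_zero, h3, Complex.ofReal_eq_zero, integral_eq_zero_iff_of_nonneg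
      (fun x => norm_nonneg _) (integrableOn_Lp_of_measure_ne_top f (by norm_num)
        (h.measure_preimage_ne_top hs hsf)).norm] at h1
    filter_upwards [(ae_restrict_iff' (h.measurable hs)).1 h1] with x hx hxs
    exact norm_eq_zero.1 (hx hxs)
  filter_upwards [ae_all_iff.2 key] with x hx
  obtain ⟨n, hn⟩ := Set.mem_iUnion.1 ((iUnion_spanningSets ν).symm ▸ Set.mem_univ (Φ x))
  exact hx n hn

variable {N d : ℕ} {m : Fin (N + 1) → ℝ} {V : (Pair N → ℝ) → ℝ}

/-- The radial projection of `ψ` is in the eigenspace of `E`, hence equals `b • ψ`. If `b` were `0`,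
the projection of `|ψ|`, itself a multiple of `ψ`, would vanish, contrary to positivity. So `ψ` is
radial. -/
lemma exists_pullback_eq (hd : N ≤ d) (hm : ∀ i, 0 < m i) (hV : Measurable V)
    (h : IsScaledPushforward (sqDistances m : RelSpace N d → _) volume (radMeasure N d) c)
    (hT : IsEssentiallySelfAdjoint (relHamiltonian N d m V)) {E : ℝ} {ψ : RelL2 N d}
    (hψ : IsNondegenerateGroundState (relHamiltonian N d m V).closure E ψ) :
    ∃ k, h.pullback k = ψ := by
  have hcomp := isCompression hd hm hV h
  have huniq : ∀ {χ : RelL2 N d},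
      (χ, (E : ℂ) • χ) ∈ (relHamiltonian N d m V).closure.graph → ∃ a : ℂ, χ = a • ψ := by
    intro χ hχ
    obtain ⟨x, hx1, hx2⟩ := (LinearPMap.mem_graph_iff _).1 hχ
    change (x : RelL2 N d) = χ at hx1
    change _ = (E : ℂ) • χ at hx2
    obtain ⟨a, ha⟩ := hψ.2.2.2 x (by rw [hx2, hx1])
    exact ⟨a, hx1 ▸ ha⟩
  obtain ⟨a, ha⟩ := huniq (absL2_mem_closure_graph hV hT hψ)
  have hW : h.pushforward ψ ≠ 0 := by
    intro h0
    refine h.pushforward_absL2_ne_zero hψ.1 ?_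
    rw [ha, map_smul, h0, smul_zero]
  obtain ⟨hdom, he⟩ := hψ.2.1
  have hmem : (ψ, (E : ℂ) • ψ) ∈ (relHamiltonian N d m V).closure.graph :=
    (LinearPMap.mem_graph_iff _).2 ⟨⟨ψ, hdom⟩, rfl, he⟩
  have hproj := hcomp.map_closure hT (hcomp.comap_closure hT hmem)
  rw [map_smul, map_smul] at hproj
  obtain ⟨b, hb⟩ := huniq hproj
  have hb0 : b ≠ 0 := by
    rintro rfl
    refine hW ?_
    rw [← h.pushforward_pullback (h.pushforward ψ), hb, zero_smul, map_zero]
  exact ⟨b⁻¹ • h.pushforward ψ, by rw [map_smul, hb, inv_smul_smul₀ hb0]⟩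

lemma nonneg_of_mem_region (hd : N ≤ d) (hm : ∀ i, 0 < m i) {ρ : Pair N → ℝ} (hρ : ρ ∈ region N)
    (p : Pair N) : 0 ≤ ρ p := by
  obtain ⟨y, rfl⟩ := exists_shape_eq_of_mem_region (d := d) hd (det_posMat_ne_zero hm) hρ
  rw [← sqDistances_eq_shape]
  exact sq_nonneg _

end GroundState

end NBody

end

theorem theorem4 (N d : ℕ) (hN : 1 ≤ N) (hd : N ≤ d)
    (m : Fin (N + 1) → ℝ) (hm : ∀ i, 0 < m i)
    (V : (NBody.Pair N → ℝ) → ℝ) (hV : Measurable V)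
    (hesa : NBody.IsEssentiallySelfAdjoint (NBody.relHamiltonian N d m V))
    (E₀ : ℝ) (Ψ₀ : NBody.RelL2 N d)
    (hΨ₀ : NBody.IsNondegenerateGroundState (NBody.relHamiltonian N d m V).closure E₀ Ψ₀) :
    (∀ A ∈ Matrix.orthogonalGroup (Fin d) ℝ,
      (fun y => Ψ₀ (NBody.rotate A y)) =ᵐ[MeasureTheory.volume] Ψ₀) ∧
    ∃ F : (NBody.Pair N → ℝ) → ℂ,
      Ψ₀ =ᵐ[MeasureTheory.volume] (fun y => F (NBody.distances m y)) ∧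
      ∃ hF : MeasureTheory.MemLp (fun ρ => F fun p => √(ρ p)) 2 (NBody.radMeasure N d),
        NBody.IsEssentiallySelfAdjoint (NBody.radHamiltonian N d m V) ∧
        NBody.IsNondegenerateGroundState (NBody.radHamiltonian N d m V).closure E₀ hF.toLp := by
  obtain ⟨c, h⟩ := NBody.exists_isScaledPushforward hN hd hm
  have hcomp := NBody.isCompression hd hm hV h
  obtain ⟨k, rfl⟩ := NBody.exists_pullback_eq hd hm hV h hesa hΨ₀
  have hk : h.pullback k =ᵐ[MeasureTheory.volume] fun y => k (NBody.sqDistances m y) :=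
    h.coeFn_pullback k
  -- `k` is a function of the squared distances, so `F` squares the distances first.
  refine ⟨fun A hA => ?_, fun r => k fun p => r p ^ 2, hk, ?_⟩
  · have h1 := (NBody.measurePreserving_rotate (N := N) ⟨A, hA⟩).quasiMeasurePreserving.ae_eq_comp hk
    filter_upwards [h1, hk] with y e1 e2
    have e3 : h.pullback k (NBody.rotate A y) = k (NBody.sqDistances m (NBody.rotate A y)) := e1
    rw [e3, e2, NBody.sqDistances_rotate m hA]
  -- Squaring undoes the square root only for `ρ ≥ 0`. That holds on the region, which carries the
  -- radial measure, so `F` after square roots represents the class `k`.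
  · have h1 : (k : (NBody.Pair N → ℝ) → ℂ) =ᵐ[NBody.radMeasure N d]
        fun ρ => k fun p => √(ρ p) ^ 2 := by
      filter_upwards [NBody.radMeasure_ae_mem_region N d] with ρ hρ
      congr 1
      funext p
      exact (Real.sq_sqrt (NBody.nonneg_of_mem_region hd hm hρ p)).symm
    have hF := (MeasureTheory.Lp.memLp k).ae_eq h1
    have hFk : hF.toLp = k := MeasureTheory.Lp.ext (hF.coeFn_toLp.trans h1.symm)
    exact ⟨hF, hcomp.isEssentiallySelfAdjoint hesa,
      hFk.symm ▸ hcomp.isNondegenerateGroundState hesa hΨ₀⟩
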